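/- Let $\mathbb{T}^m=\mathbb{R}^m/\mathbb{Z}^m$ carry the Euclidean metric and Lebesgue measure $|\cdot|$, and identify $(\mathbb{T}^d)^n$ with $\mathbb{T}^{dn}$. For a compact set $Z\subset\mathbb{T}^{m}$ with open $r$-thickening $Z_r$, the lower Minkowski dimension of $Z$ is $\liminf_{r\to0^+}\bigl(m-\log_r|Z_r|\bigr)$ (equal to $-\infty$ if $Z=\emptyset$). For a finite Borel measure $\mu$ on $\mathbb{T}^d$ put $\widehat\mu(\xi)=\int e^{-2\pi i\xi\cdot x}\,d\mu(x)$ and $\|\mu\|_{M(\lambda)}=\sup_{\xi\in\mathbb{Z}^d}|\widehat\mu(\xi)||\xi|^{\lambda/2}$, and use the same formula for differences of such measures. The Fourier dimension of $\mu$ is the supremum of all $s\in[0,d]$ with $\|\mu\|_{M(s)}<\infty$; the Fourier dimension $\dim_{\mathbb F}(E)$ of a Borel set $E\subset\mathbb{T}^d$ is the supremum of the Fourier dimensions of the Borel probability measures $\mu$ with $\operatorname{supp}(\mu)\subset E$; and $E$ is a Salem set if $\dim_{\mathbb F}(E)$ equals the Hausdorff dimension of $E$. For $\beta\in(0,d]$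 let $\mathcal{X}_\beta$ be the set of pairs $(E,\mu)$, where $E\subset\mathbb{T}^d$ is compact and $\mu$ is a Borel probability measure with $\operatorname{supp}(\mu)\subset E$ and $\|\mu\|_{M(\lambda)}<\infty$ for all $\lambda\in[0,\beta)$, with the topology given by the Hausdorff distance in $E$ and by all the seminorm distances $\|\mu-\nu\|_{M(\lambda)}$, $\lambda\in[0,\beta)$, in $\mu$. A set is comeager if it contains a countable intersection of dense open sets. Let $d,n$ be natural numbers, let $0\le\alpha<dn$, and let $Z\subset\mathbb{T}^{dn}$ be a compact set with lower Minkowski dimension at most $\alpha$. Set \[ \beta_0=\min\left(\frac{dn-\alpha}{n-1/2},\,d\right). \] Then there exists a compact Salem set $E\subset\mathbb{T}^d$ with $\dim_{\mathbb F}(E)=\beta_0$ such that $(x_1,\dots,x_n)\notin Z$ for all distinct points $x_1,\dots,x_n\in E$. Moreover, for every $\beta$ with $0<\beta\le\beta_0$, the set of all pairs $(E,\mu)\in\mathcal{X}_\beta$ such that $E$ is Salem and $(x_1,\dots,x_n)\notin Z$ for all distinct points $x_1,\dots,x_n\in E$ is comeager in $\mathcal{X}_\beta$. -/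

import Mathlib

open scoped ENNReal Topology

noncomputable section

namespace SalemAvoidance

open MeasureTheory TopologicalSpace

/-- The torus `𝕋^ι = ℝ^ι / ℤ^ι` with its Euclidean metric
`d(x, y) = (∑ i, |x i - y i| ^ 2) ^ (1 / 2)`, where `|t|` is the distance from `t` to `0` in `ℝ/ℤ`. -/
abbrev Torus (ι : Type) [Fintype ι] : Type := PiLp 2 (fun _ : ι => UnitAddCircle)

/-- Lebesgue (normalized Haar) measure on the torus. -/
def lebesgue (ι : Type) [Fintype ι] : Measure (Torus ι) :=
  (volume : Measure (ι → UnitAddCircle)).map (WithLp.toLp 2)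

/-- The point `(x_1, …, x_n)` of `𝕋^{dn}` given by `n` points of `𝕋^d`. -/
def tuple {d n : ℕ} (x : Fin n → Torus (Fin d)) : Torus (Fin n × Fin d) :=
  WithLp.toLp 2 (fun p => x p.1 p.2)

/-- The lower Minkowski dimension `liminf_{r → 0+} (dim - log_r |E_r|)`, where `E_r` is the open
`r`-thickening of `E`. It takes values in the extended reals; `log 0 = -∞`, so the
empty set has dimension `-∞`. -/
def lowerMinkowskiDim {ι : Type} [Fintype ι] (E : Set (Torus ι)) : EReal :=
  Filter.liminf
    (fun r : ℝ => ((Fintype.card ι : ℝ) : EReal) -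
      ENNReal.log (lebesgue ι (Metric.thickening r E)) / ((Real.log r : ℝ) : EReal))
    (𝓝[>] (0 : ℝ))

/-- The Euclidean length of a frequency `ξ ∈ ℤ^d`. -/
def freqNorm {d : ℕ} (ξ : Fin d → ℤ) : ℝ := √(∑ i, (ξ i : ℝ) ^ 2)

/-- The Fourier coefficient `μ̂(ξ) = ∫ exp(-2πi ξ·x) dμ(x)`. -/
def fourierCoeff {d : ℕ} (μ : Measure (Torus (Fin d))) (ξ : Fin d → ℤ) : ℂ :=
  ∫ x, UnitAddTorus.mFourier (-ξ) (WithLp.ofLp x) ∂μ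

/-- `sup_ξ |c(ξ)| |ξ|^{s/2}` for a family `c` of Fourier coefficients (with `0 ^ 0 = 1`). Applied to
`c = μ̂` this is `‖μ‖_{M(s)}`, and applied to `c = μ̂ - ν̂` it is `‖μ - ν‖_{M(s)}`. -/
def decayNorm {d : ℕ} (s : ℝ) (c : (Fin d → ℤ) → ℂ) : ℝ≥0∞ :=
  ⨆ ξ, ENNReal.ofReal (‖c ξ‖ * freqNorm ξ ^ (s / 2))

/-- The Fourier dimension of a measure: the supremum of all `s ∈ [0, d]` with
`sup_ξ |μ̂(ξ)| |ξ|^{s/2} < ∞`. -/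
def fourierDimMeasure {d : ℕ} (μ : Measure (Torus (Fin d))) : ℝ≥0∞ :=
  ⨆ (s : ℝ) (_ : 0 ≤ s ∧ s ≤ d ∧ decayNorm s (fourierCoeff μ) < ∞), ENNReal.ofReal s

/-- The Fourier dimension of a set: the supremum of the Fourier dimensions of the Borel probability
measures whose support is contained in it. -/
def fourierDim {d : ℕ} (E : Set (Torus (Fin d))) : ℝ≥0∞ :=
  ⨆ (μ : ProbabilityMeasure (Torus (Fin d))) (_ : (μ : Measure (Torus (Fin d))).support ⊆ E),
    fourierDimMeasure (μ : Measure (Torus (Fin d)))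

/-- A Salem set: its Fourier dimension equals its Hausdorff dimension. -/
def IsSalem {d : ℕ} (E : Set (Torus (Fin d))) : Prop := fourierDim E = dimH E

/-- `E` avoids the pattern `Z`: no tuple of `n` distinct points of `E` lies in `Z`. -/
def Avoids {d n : ℕ} (E : Set (Torus (Fin d))) (Z : Set (Torus (Fin n × Fin d))) : Prop :=
  ∀ x : Fin n → Torus (Fin d), Function.Injective x → (∀ i, x i ∈ E) → tuple x ∉ Z

theorem decayNorm_zero {d : ℕ} (s : ℝ) : decayNorm (d := d) s 0 = 0 := by
  simp [decayNorm]

theorem decayNorm_neg {d : ℕ} (s : ℝ) (c : (Fin d → ℤ) → ℂ) :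
    decayNorm s (-c) = decayNorm s c := by
  simp [decayNorm]

theorem decayNorm_add_le {d : ℕ} (s : ℝ) (c c' : (Fin d → ℤ) → ℂ) :
    decayNorm s (c + c') ≤ decayNorm s c + decayNorm s c' := by
  refine iSup_le fun ξ => ?_
  have h0 : 0 ≤ freqNorm ξ ^ (s / 2) := Real.rpow_nonneg (Real.sqrt_nonneg _) _
  calc ENNReal.ofReal (‖(c + c') ξ‖ * freqNorm ξ ^ (s / 2))
      ≤ ENNReal.ofReal (‖c ξ‖ * freqNorm ξ ^ (s / 2) + ‖c' ξ‖ * freqNorm ξ ^ (s / 2)) := by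
        refine ENNReal.ofReal_le_ofReal ?_
        rw [← add_mul]
        exact mul_le_mul_of_nonneg_right (norm_add_le _ _) h0
    _ ≤ _ := ENNReal.ofReal_add_le
    _ ≤ decayNorm s c + decayNorm s c' :=
        add_le_add
          (le_iSup (fun ξ => ENNReal.ofReal (‖c ξ‖ * freqNorm ξ ^ (s / 2))) ξ)
          (le_iSup (fun ξ => ENNReal.ofReal (‖c' ξ‖ * freqNorm ξ ^ (s / 2))) ξ)

/-- The (extended) pseudometric `‖μ - ν‖_{M(s)}` on Borel probability measures. -/
abbrev decayPseudoEMetric (d : ℕ) (s : ℝ) :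
    PseudoEMetricSpace (ProbabilityMeasure (Torus (Fin d))) where
  edist μ ν := decayNorm s
    (fourierCoeff (μ : Measure (Torus (Fin d))) - fourierCoeff (ν : Measure (Torus (Fin d))))
  edist_self μ := by rw [sub_self, decayNorm_zero]
  edist_comm μ ν := by rw [← decayNorm_neg, neg_sub]
  edist_triangle μ ν ρ := by
    rw [← sub_add_sub_cancel (fourierCoeff (μ : Measure (Torus (Fin d))))
      (fourierCoeff (ν : Measure (Torus (Fin d))))]
    exact decayNorm_add_le _ _ _

/-- The space `𝓧_β` of pairs `(E, μ)`, where `E ⊆ 𝕋^d` is compact and `μ` is a Borel probability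
measure with support in `E` and `‖μ‖_{M(s)} < ∞` for all `s ∈ [0, β)`. Such an `E` is never empty,
since it contains the support of a probability measure. -/
structure XSpace (d : ℕ) (β : ℝ) where
  E : NonemptyCompacts (Torus (Fin d))
  μ : ProbabilityMeasure (Torus (Fin d))
  support_subset : (μ : Measure (Torus (Fin d))).support ⊆ (E : Set (Torus (Fin d)))
  decay : ∀ s : ℝ, 0 ≤ s → s < β →
    decayNorm s (fourierCoeff (μ : Measure (Torus (Fin d)))) < ∞

/-- The topology of `𝓧_β`, as a subspace of the product of the compact sets with the Hausdorff
metric and the space of measures with the seminorms `‖·‖_{M(s)}`, `s ∈ [0, β)`. -/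
instance XSpace.instTopologicalSpace (d : ℕ) (β : ℝ) : TopologicalSpace (XSpace d β) :=
  TopologicalSpace.induced XSpace.E
      (inferInstance : MetricSpace (NonemptyCompacts (Torus (Fin d)))).toPseudoMetricSpace.toUniformSpace.toTopologicalSpace ⊓
    ⨅ s : Set.Ico (0 : ℝ) β,
      TopologicalSpace.induced XSpace.μ (decayPseudoEMetric d s).toUniformSpace.toTopologicalSpace

end SalemAvoidance

end

/-!
Call a pair `(E, μ)` good at scale `γ` if a neighbourhood of `E` contains no tuple of `γ`-separated
points lying in `Z`, and is covered by at most `γ * ρ ^ (-(β + γ))` balls of some radius `ρ < γ`.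
The good pairs form an open set, and a pair which is good at scales tending to `0` avoids `Z` and
has Hausdorff dimension at most `β`. Since `E` carries `μ`, its Fourier dimension is at least `β`,
and the Fourier dimension never exceeds the Hausdorff dimension, so such an `E` is Salem of
dimension `β`. As `𝓧_β` is a nonempty Baire space, it remains to see that good pairs are dense.

By mollification one may start from a measure `μ` with bounded density. Sample `N` independent
points from `μ`. Their empirical measure has the Fourier coefficients of `μ` up to an error of order
`N ^ (-1/2)`, which is not affected by deleting of order `N ^ (1/2)` points. The expected number of
`n`-tuples within `ρ` of `Z` is about `N ^ n * ρ ^ (d * n - α)`, and deleting one point from each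
of them is affordable as long as `N ^ (n - 1/2)` stays below `ρ ^ (-(d * n - α))`. This allows
`N ≈ ρ ^ (-β)` exactly for `β` up to `(d * n - α) / (n - 1/2)`. Mollifying the remaining points at a
scale comparable to `ρ` gives a good pair close to the original one.
-/

open scoped ENNReal Topology

noncomputable section

namespace SalemAvoidance

open MeasureTheory TopologicalSpace

section Torus

variable {ι : Type} [Fintype ι]

instance : CompactSpace (Torus ι) :=
  (PiLp.homeomorph 2 (fun _ : ι => UnitAddCircle)).symm.compactSpace

instance : IsProbabilityMeasure (volume : Measure UnitAddCircle) :=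
  ⟨UnitAddCircle.measure_univ⟩

instance : IsProbabilityMeasure (volume : Measure (ι → UnitAddCircle)) :=
  inferInstanceAs (IsProbabilityMeasure (Measure.pi fun _ : ι => (volume : Measure UnitAddCircle)))

instance : IsProbabilityMeasure (lebesgue ι) :=
  Measure.isProbabilityMeasure_map (WithLp.measurable_toLp 2 _).aemeasurable

lemma norm_le_sqrt_card_mul {x : Torus ι} {r : ℝ} (hr : 0 ≤ r) (h : ∀ i, ‖x i‖ ≤ r) :
    ‖x‖ ≤ √(Fintype.card ι) * r := by
  rw [PiLp.norm_eq_of_L2, ← Real.sqrt_sq hr, ← Real.sqrt_mul (Nat.cast_nonneg _)]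
  refine Real.sqrt_le_sqrt ?_
  calc ∑ i, ‖x i‖ ^ 2 ≤ ∑ _i : ι, r ^ 2 :=
        Finset.sum_le_sum fun i _ => pow_le_pow_left₀ (norm_nonneg _) (h i) 2
    _ = Fintype.card ι * r ^ 2 := by simp

end Torus

section Character

variable {ι : Type} [Fintype ι]

/-- The character `x ↦ exp (2πi ξ·x)` of the torus. -/
def char (ξ : ι → ℤ) (x : Torus ι) : ℂ := UnitAddTorus.mFourier ξ (WithLp.ofLp x)

lemma continuous_char (ξ : ι → ℤ) : Continuous (char ξ) :=
  (UnitAddTorus.mFourier ξ).continuous.comp (PiLp.continuous_ofLp 2 _)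

lemma norm_char (ξ : ι → ℤ) (x : Torus ι) : ‖char ξ x‖ = 1 := by
  simp only [char, UnitAddTorus.mFourier, ContinuousMap.coe_mk, norm_prod, fourier_apply]
  exact Finset.prod_eq_one fun i _ => Circle.norm_coe _

lemma char_zero_left (x : Torus ι) : char 0 x = 1 := by
  simp [char, UnitAddTorus.mFourier]

lemma char_neg_left (ξ : ι → ℤ) (x : Torus ι) : char (-ξ) x = starRingEnd ℂ (char ξ x) :=
  UnitAddTorus.mFourier_neg

lemma char_sub_left (ξ η : ι → ℤ) (x : Torus ι) : char (ξ - η) x = char ξ x * char (-η) x := by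
  rw [sub_eq_add_neg]
  exact UnitAddTorus.mFourier_add

lemma char_neg_right (ξ : ι → ℤ) (x : Torus ι) : char ξ (-x) = char (-ξ) x := by
  simp [char, UnitAddTorus.mFourier, fourier_apply]

lemma char_add (ξ : ι → ℤ) (x y : Torus ι) : char ξ (x + y) = char ξ x * char ξ y := by
  simp only [char, UnitAddTorus.mFourier, ContinuousMap.coe_mk, ← Finset.prod_mul_distrib,
    WithLp.ofLp_add, Pi.add_apply, fourier_apply, smul_add, AddCircle.toCircle_add, Circle.coe_mul]

lemma integrable_char (ξ : ι → ℤ) (μ : Measure (Torus ι)) [IsFiniteMeasure μ] :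
    Integrable (char ξ) μ :=
  .of_bound (continuous_char ξ).aestronglyMeasurable 1 (.of_forall fun x => (norm_char ξ x).le)

end Character

section Frequency

variable {d : ℕ}

lemma freqNorm_nonneg (ξ : Fin d → ℤ) : 0 ≤ freqNorm ξ := Real.sqrt_nonneg _

@[simp] lemma freqNorm_zero : freqNorm (0 : Fin d → ℤ) = 0 := by simp [freqNorm]

@[simp] lemma freqNorm_neg (ξ : Fin d → ℤ) : freqNorm (-ξ) = freqNorm ξ := by simp [freqNorm]

lemma abs_le_freqNorm (ξ : Fin d → ℤ) (i : Fin d) : |(ξ i : ℝ)| ≤ freqNorm ξ := by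
  rw [← Real.sqrt_sq_eq_abs]
  exact Real.sqrt_le_sqrt (Finset.single_le_sum (f := fun i => (ξ i : ℝ) ^ 2)
    (fun i _ => sq_nonneg _) (Finset.mem_univ i))

lemma one_le_freqNorm {ξ : Fin d → ℤ} (h : ξ ≠ 0) : 1 ≤ freqNorm ξ := by
  obtain ⟨i, hi⟩ := Function.ne_iff.mp h
  refine le_trans ?_ (abs_le_freqNorm ξ i)
  exact_mod_cast Int.one_le_abs hi

lemma freqNorm_pos {ξ : Fin d → ℤ} (h : ξ ≠ 0) : 0 < freqNorm ξ :=
  one_pos.trans_le (one_le_freqNorm h)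

lemma freqNorm_le_of_forall_abs_le {ξ : Fin d → ℤ} {M : ℝ} (hM : 0 ≤ M)
    (h : ∀ i, |(ξ i : ℝ)| ≤ M) : freqNorm ξ ≤ √d * M := by
  rw [freqNorm, ← Real.sqrt_sq hM, ← Real.sqrt_mul (Nat.cast_nonneg _)]
  refine Real.sqrt_le_sqrt ?_
  calc ∑ i, (ξ i : ℝ) ^ 2 ≤ ∑ _i : Fin d, M ^ 2 :=
        Finset.sum_le_sum fun i _ => sq_le_sq' (abs_le.1 (h i)).1 (abs_le.1 (h i)).2
    _ = d * M ^ 2 := by simp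

end Frequency

section CharacterNearZero

lemma exists_coe_eq_and_abs_eq_norm (x : UnitAddCircle) :
    ∃ t : ℝ, (t : UnitAddCircle) = x ∧ |t| = ‖x‖ := by
  induction x using QuotientAddGroup.induction_on with
  | H t =>
    refine ⟨t - round t, ?_, UnitAddCircle.norm_eq.symm⟩
    rw [AddCircle.coe_sub]
    exact sub_eq_self.2 (by simp)

lemma norm_fourier_sub_one_le (k : ℤ) (x : UnitAddCircle) :
    ‖(fourier k x : ℂ) - 1‖ ≤ 2 * Real.pi * (|(k : ℝ)| * ‖x‖) := by
  obtain ⟨t, rfl, ht⟩ := exists_coe_eq_and_abs_eq_norm x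
  have exp_eq : (fourier k (t : UnitAddCircle) : ℂ)
      = Complex.exp (Complex.I * ((2 * Real.pi * (k * t) : ℝ) : ℂ)) := by
    rw [fourier_coe_apply]
    push_cast
    ring_nf
  rw [exp_eq, ← ht]
  refine Real.norm_exp_I_mul_ofReal_sub_one_le.trans_eq ?_
  rw [Real.norm_eq_abs, abs_mul, abs_mul (k : ℝ), abs_of_pos Real.two_pi_pos]

lemma norm_prod_sub_one_le {κ : Type*} (s : Finset κ) {f : κ → ℂ} (hf : ∀ i, ‖f i‖ ≤ 1) :
    ‖∏ i ∈ s, f i - 1‖ ≤ ∑ i ∈ s, ‖f i - 1‖ := by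
  classical
  induction s using Finset.induction_on with
  | empty => simp
  | insert a s ha ih =>
    rw [Finset.prod_insert ha, Finset.sum_insert ha]
    calc ‖f a * ∏ i ∈ s, f i - 1‖ = ‖(f a - 1) + f a * (∏ i ∈ s, f i - 1)‖ := by ring_nf
      _ ≤ ‖f a - 1‖ + ‖f a‖ * ‖∏ i ∈ s, f i - 1‖ := by
          rw [← norm_mul]; exact norm_add_le _ _
      _ ≤ ‖f a - 1‖ + ∑ i ∈ s, ‖f i - 1‖ := by
          gcongr; exact (mul_le_of_le_one_left (norm_nonneg _) (hf a)).trans ih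

lemma norm_char_sub_one_le {d : ℕ} (ξ : Fin d → ℤ) (x : Torus (Fin d)) :
    ‖char ξ x - 1‖ ≤ 2 * Real.pi * freqNorm ξ * ‖x‖ :=
  calc ‖char ξ x - 1‖ ≤ ∑ i, ‖(fourier (ξ i) (x i) : ℂ) - 1‖ :=
        norm_prod_sub_one_le Finset.univ fun i => by
          rw [fourier_apply]; exact (Circle.norm_coe _).le
    _ ≤ ∑ i, 2 * Real.pi * (|(ξ i : ℝ)| * ‖x i‖) :=
        Finset.sum_le_sum fun i _ => norm_fourier_sub_one_le _ _
    _ = 2 * Real.pi * ∑ i, |(ξ i : ℝ)| * ‖x i‖ := (Finset.mul_sum ..).symm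
    _ ≤ 2 * Real.pi * (freqNorm ξ * ‖x‖) := by
        gcongr
        rw [PiLp.norm_eq_of_L2, freqNorm]
        simpa only [sq_abs] using Real.sum_mul_le_sqrt_mul_sqrt Finset.univ
          (fun i => |(ξ i : ℝ)|) (fun i => ‖x i‖)
    _ = 2 * Real.pi * freqNorm ξ * ‖x‖ := (mul_assoc ..).symm

end CharacterNearZero

section FourierCoefficient

variable {d : ℕ} (μ ν : Measure (Torus (Fin d)))

lemma fourierCoeff_eq (ξ : Fin d → ℤ) : fourierCoeff μ ξ = ∫ x, char (-ξ) x ∂μ := rfl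

lemma norm_fourierCoeff_le_one [IsProbabilityMeasure μ] (ξ : Fin d → ℤ) :
    ‖fourierCoeff μ ξ‖ ≤ 1 := by
  simpa [fourierCoeff_eq] using norm_integral_le_of_norm_le_const (μ := μ) (f := char (-ξ)) (C := 1)
    (.of_forall fun x => (norm_char _ x).le)

lemma fourierCoeff_zero [IsProbabilityMeasure μ] : fourierCoeff μ 0 = 1 := by
  simp [fourierCoeff_eq, char_zero_left]

lemma fourierCoeff_conv [IsFiniteMeasure μ] [IsFiniteMeasure ν] (ξ : Fin d → ℤ) :
    fourierCoeff (μ ∗ ν) ξ = fourierCoeff μ ξ * fourierCoeff ν ξ := by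
  simp only [fourierCoeff_eq]
  rw [integral_conv (integrable_char _ _)]
  simp_rw [char_add, integral_const_mul, integral_mul_const]

lemma fourierCoeff_add [IsFiniteMeasure μ] [IsFiniteMeasure ν] (ξ : Fin d → ℤ) :
    fourierCoeff (μ + ν) ξ = fourierCoeff μ ξ + fourierCoeff ν ξ :=
  integral_add_measure (integrable_char _ _) (integrable_char _ _)

lemma fourierCoeff_smul (c : ℝ≥0∞) (ξ : Fin d → ℤ) :
    fourierCoeff (c • μ) ξ = c.toReal * fourierCoeff μ ξ :=
  integral_smul_measure _ _

variable {μ} in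
lemma norm_fourierCoeff_sub_one_le [IsProbabilityMeasure μ] {r : ℝ} (h : ∀ᵐ x ∂μ, ‖x‖ ≤ r)
    (ξ : Fin d → ℤ) : ‖fourierCoeff μ ξ - 1‖ ≤ 2 * Real.pi * freqNorm ξ * r := by
  have integral_eq : fourierCoeff μ ξ - 1 = ∫ x, (char (-ξ) x - 1) ∂μ := by
    rw [integral_sub (integrable_char _ _) (integrable_const _)]
    simp [fourierCoeff_eq]
  have norm_le : ∀ᵐ x ∂μ, ‖char (-ξ) x - 1‖ ≤ 2 * Real.pi * freqNorm ξ * r := by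
    filter_upwards [h] with x hx
    calc ‖char (-ξ) x - 1‖ ≤ 2 * Real.pi * freqNorm ξ * ‖x‖ := by
          simpa using norm_char_sub_one_le (-ξ) x
      _ ≤ 2 * Real.pi * freqNorm ξ * r := by
          have := freqNorm_nonneg ξ
          gcongr
  simpa [integral_eq] using norm_integral_le_of_norm_le_const norm_le

end FourierCoefficient

section DecayNorm

variable {d : ℕ}

lemma ofReal_le_decayNorm (s : ℝ) (c : (Fin d → ℤ) → ℂ) (ξ : Fin d → ℤ) :
    ENNReal.ofReal (‖c ξ‖ * freqNorm ξ ^ (s / 2)) ≤ decayNorm s c :=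
  le_iSup (fun ξ => ENNReal.ofReal (‖c ξ‖ * freqNorm ξ ^ (s / 2))) ξ

lemma decayNorm_le_ofReal {s B : ℝ} {c : (Fin d → ℤ) → ℂ} (h0 : c 0 = 0)
    (h : ∀ ξ, ξ ≠ 0 → ‖c ξ‖ * freqNorm ξ ^ (s / 2) ≤ B) :
    decayNorm s c ≤ ENNReal.ofReal B := by
  refine iSup_le fun ξ => ?_
  by_cases hξ : ξ = 0
  · simp [hξ, h0]
  · exact ENNReal.ofReal_le_ofReal (h ξ hξ)

lemma decayNorm_mono {s t : ℝ} (hst : s ≤ t) {c : (Fin d → ℤ) → ℂ} (h0 : c 0 = 0) :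
    decayNorm s c ≤ decayNorm t c := by
  refine iSup_le fun ξ => ?_
  by_cases hξ : ξ = 0
  · simp [hξ, h0]
  · refine le_trans (ENNReal.ofReal_le_ofReal ?_) (ofReal_le_decayNorm t c ξ)
    have := one_le_freqNorm hξ
    gcongr

lemma exists_bound_of_decayNorm_lt_top {s : ℝ} {c : (Fin d → ℤ) → ℂ} (h : decayNorm s c < ∞) :
    ∃ B : ℝ, 0 ≤ B ∧ ∀ ξ, ‖c ξ‖ * freqNorm ξ ^ (s / 2) ≤ B :=
  ⟨(decayNorm s c).toReal, ENNReal.toReal_nonneg, fun ξ =>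
    (ENNReal.ofReal_le_iff_le_toReal h.ne).1 (ofReal_le_decayNorm s c ξ)⟩

end DecayNorm

section PiMeasure

variable {κ : Type*} [Fintype κ]

lemma pi_measure_mono {X : κ → Type*} [∀ i, MeasurableSpace (X i)] {μ ν : ∀ i, Measure (X i)}
    [∀ i, SigmaFinite (μ i)] [∀ i, SigmaFinite (ν i)] (h : ∀ i, μ i ≤ ν i) :
    Measure.pi μ ≤ Measure.pi ν := by
  have outer_le : OuterMeasure.pi (fun i => (μ i).toOuterMeasure) ≤
      OuterMeasure.pi (fun i => (ν i).toOuterMeasure) :=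
    OuterMeasure.le_pi.2 fun t _ =>
      (OuterMeasure.pi_pi_le _ _).trans (Finset.prod_le_prod' fun i _ => h i (t i))
  refine Measure.le_iff.2 fun s hs => ?_
  rw [Measure.pi, Measure.pi, toMeasure_apply _ _ hs, toMeasure_apply _ _ hs]
  exact outer_le s

variable {X : Type*} [MeasurableSpace X]

lemma pi_const_smul (ν : Measure X) [IsFiniteMeasure ν] {c : ℝ≥0∞} (hc : c ≠ ∞) :
    Measure.pi (fun _ : κ => c • ν) = c ^ Fintype.card κ • Measure.pi (fun _ : κ => ν) := by
  have := Measure.smul_finite ν hc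
  refine Measure.pi_eq fun s _ => ?_
  simp [Finset.prod_mul_distrib]

lemma pi_le_pow_smul_pi {μ ν : Measure X} [IsFiniteMeasure μ] [IsFiniteMeasure ν] {c : ℝ≥0∞}
    (hc : c ≠ ∞) (h : μ ≤ c • ν) :
    Measure.pi (fun _ : κ => μ) ≤ c ^ Fintype.card κ • Measure.pi (fun _ : κ => ν) := by
  have := Measure.smul_finite ν hc
  rw [← pi_const_smul ν hc]
  exact pi_measure_mono fun _ => h

end PiMeasure

section Convolution

variable {ι : Type} [Fintype ι] {μ ν : Measure (Torus ι)}

lemma lebesgue_preimage_const_add (x : Torus ι) {s : Set (Torus ι)} (hs : MeasurableSet s) :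
    lebesgue ι ((fun y => x + y) ⁻¹' s) = lebesgue ι s := by
  have measurable_toLp : Measurable (WithLp.toLp 2 : _ → Torus ι) := WithLp.measurable_toLp 2 _
  rw [lebesgue, Measure.map_apply measurable_toLp (measurable_const_add x hs),
    Measure.map_apply measurable_toLp hs]
  exact measure_preimage_add volume (WithLp.ofLp x) (WithLp.toLp 2 ⁻¹' s)

lemma conv_le_smul_lebesgue [IsProbabilityMeasure μ] [IsFiniteMeasure ν] {c : ℝ≥0∞}
    (h : ν ≤ c • lebesgue ι) : μ ∗ ν ≤ c • lebesgue ι := by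
  refine Measure.le_iff.2 fun s hs => ?_
  have translate_le (x : Torus ι) :
      ∫⁻ y, s.indicator 1 (x + y) ∂ν ≤ c * lebesgue ι s :=
    calc ∫⁻ y, s.indicator 1 (x + y) ∂ν = ν ((fun y => x + y) ⁻¹' s) :=
          lintegral_indicator_one (measurable_const_add x hs)
      _ ≤ c * lebesgue ι ((fun y => x + y) ⁻¹' s) := h _
      _ = c * lebesgue ι s := by rw [lebesgue_preimage_const_add x hs]
  calc (μ ∗ ν) s = ∫⁻ x, ∫⁻ y, s.indicator 1 (x + y) ∂ν ∂μ := by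
        rw [← lintegral_indicator_one hs, Measure.lintegral_conv (measurable_one.indicator hs)]
    _ ≤ ∫⁻ _x, c * lebesgue ι s ∂μ := lintegral_mono translate_le
    _ = (c • lebesgue ι) s := by simp

lemma ae_conv_of_ae_of_ae [SFinite μ] [SFinite ν] {p q r : Torus ι → Prop}
    (hr : MeasurableSet {z | r z}) (hμ : ∀ᵐ x ∂μ, p x) (hν : ∀ᵐ y ∂ν, q y)
    (h : ∀ x y, p x → q y → r (x + y)) : ∀ᵐ z ∂(μ ∗ ν), r z := by
  rw [Measure.conv, ae_map_iff (by fun_prop) hr]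
  filter_upwards [Measure.quasiMeasurePreserving_fst.ae hμ,
    Measure.quasiMeasurePreserving_snd.ae hν] with x hx hy
  exact h _ _ hx hy

lemma ae_norm_le_conv [SFinite μ] [SFinite ν] {a b : ℝ}
    (hμ : ∀ᵐ x ∂μ, ‖x‖ ≤ a) (hν : ∀ᵐ x ∂ν, ‖x‖ ≤ b) : ∀ᵐ x ∂(μ ∗ ν), ‖x‖ ≤ a + b :=
  ae_conv_of_ae_of_ae (measurableSet_le measurable_norm measurable_const) hμ hν
    fun _ _ hx hy => (norm_add_le _ _).trans (add_le_add hx hy)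

end Convolution

section ArcMeasure

variable {h : ℝ}

/-- The uniform distribution on the arc `(0, h]` of the circle, the one-dimensional building block
of the mollifiers. -/
def arcMeasure (h : ℝ) : Measure UnitAddCircle :=
  ((ENNReal.ofReal h)⁻¹ • (volume : Measure ℝ).restrict (Set.Ioc 0 h)).map (↑)

lemma isProbabilityMeasure_arcMeasure (hh : 0 < h) : IsProbabilityMeasure (arcMeasure h) := by
  have : IsProbabilityMeasure
      ((ENNReal.ofReal h)⁻¹ • (volume : Measure ℝ).restrict (Set.Ioc 0 h)) := by
    refine ⟨?_⟩
    simp only [Measure.smul_apply, Measure.restrict_apply MeasurableSet.univ, Set.univ_inter,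
      Real.volume_Ioc, sub_zero, smul_eq_mul]
    exact ENNReal.inv_mul_cancel (by simpa using hh) ENNReal.ofReal_ne_top
  exact Measure.isProbabilityMeasure_map AddCircle.measurable_mk'.aemeasurable

lemma arcMeasure_le (h1 : h ≤ 1) :
    arcMeasure h ≤ (ENNReal.ofReal h)⁻¹ • (volume : Measure UnitAddCircle) := by
  have map_unit : Measure.map ((↑) : ℝ → UnitAddCircle) (volume.restrict (Set.Ioc 0 1)) = volume :=
    by simpa using (UnitAddCircle.measurePreserving_mk 0).map_eq
  rw [arcMeasure, Measure.map_smul, ← map_unit]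
  gcongr
  exact AddCircle.measurable_mk'

lemma ae_norm_le_arcMeasure (h : ℝ) : ∀ᵐ x ∂(arcMeasure h), ‖x‖ ≤ h := by
  rw [arcMeasure, ae_map_iff AddCircle.measurable_mk'.aemeasurable
    (measurableSet_le measurable_norm measurable_const)]
  refine Measure.ae_smul_measure ((ae_restrict_iff' measurableSet_Ioc).2 (.of_forall ?_)) _
  intro t ht
  calc ‖(t : UnitAddCircle)‖ = |t - round t| := UnitAddCircle.norm_eq
    _ ≤ |t - (0 : ℤ)| := round_le t 0
    _ ≤ h := by simpa [abs_of_pos ht.1] using ht.2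

lemma norm_integral_exp_mul_I_le {c : ℝ} (hc : c ≠ 0) (h : ℝ) :
    ‖∫ t in (0 : ℝ)..h, Complex.exp (c * Complex.I * t)‖ ≤ 2 / |c| := by
  have hc' : (c * Complex.I : ℂ) ≠ 0 := by simpa using hc
  have norm_exp (t : ℝ) : ‖Complex.exp (c * Complex.I * t)‖ = 1 := by
    rw [mul_right_comm, ← Complex.ofReal_mul, Complex.norm_exp_ofReal_mul_I]
  rw [integral_exp_mul_complex hc', norm_div, norm_mul, Complex.norm_I, mul_one, Complex.norm_real,
    Real.norm_eq_abs]
  gcongr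
  refine (norm_sub_le _ _).trans_eq ?_
  rw [norm_exp, norm_exp, one_add_one_eq_two]

lemma norm_integral_fourier_arcMeasure_le (hh : 0 < h) {k : ℤ} (hk : k ≠ 0) :
    ‖∫ x, (fourier k x : ℂ) ∂(arcMeasure h)‖ ≤ (h * |(k : ℝ)|)⁻¹ := by
  have : 0 < |(k : ℝ)| := abs_pos.2 (by exact_mod_cast hk)
  have integral_eq : ∫ x, (fourier k x : ℂ) ∂(arcMeasure h) =
      h⁻¹ • ∫ t in (0 : ℝ)..h, Complex.exp ((2 * Real.pi * k : ℝ) * Complex.I * t) := by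
    rw [arcMeasure, integral_map AddCircle.measurable_mk'.aemeasurable
      (fourier k).continuous.aestronglyMeasurable, integral_smul_measure,
      ← intervalIntegral.integral_of_le hh.le, ENNReal.toReal_inv, ENNReal.toReal_ofReal hh.le]
    congr! 4 with t
    rw [fourier_coe_apply]
    push_cast
    ring_nf
  calc ‖∫ x, (fourier k x : ℂ) ∂(arcMeasure h)‖
      ≤ h⁻¹ * (2 / |2 * Real.pi * k|) := by
        rw [integral_eq, norm_smul, Real.norm_of_nonneg (inv_pos.2 hh).le]
        gcongr
        exact norm_integral_exp_mul_I_le (by simp [Real.pi_ne_zero, hk]) h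
    _ = (h * |(k : ℝ)|)⁻¹ * Real.pi⁻¹ := by
        rw [abs_mul, abs_of_pos Real.two_pi_pos]
        field_simp
    _ ≤ (h * |(k : ℝ)|)⁻¹ :=
        mul_le_of_le_one_right (by positivity)
          (inv_le_one_of_one_le₀ (by linarith [Real.pi_gt_three]))

end ArcMeasure

section CubeMeasure

variable {ι : Type} [Fintype ι] {d : ℕ} {h : ℝ}

/-- The uniform distribution on the cube `(0, h]^ι` of the torus. -/
def cubeMeasure (ι : Type) [Fintype ι] (h : ℝ) : Measure (Torus ι) :=
  (Measure.pi fun _ : ι => arcMeasure h).map (WithLp.toLp 2)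

lemma isProbabilityMeasure_cubeMeasure (hh : 0 < h) : IsProbabilityMeasure (cubeMeasure ι h) := by
  have := isProbabilityMeasure_arcMeasure hh
  exact Measure.isProbabilityMeasure_map (WithLp.measurable_toLp 2 _).aemeasurable

lemma cubeMeasure_le (hh : 0 < h) (h1 : h ≤ 1) :
    cubeMeasure ι h ≤ (ENNReal.ofReal h)⁻¹ ^ Fintype.card ι • lebesgue ι := by
  have := isProbabilityMeasure_arcMeasure hh
  rw [cubeMeasure, lebesgue, ← Measure.map_smul]
  exact Measure.map_mono (pi_le_pow_smul_pi (by simpa using hh) (arcMeasure_le h1))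
    (WithLp.measurable_toLp 2 _)

lemma ae_norm_le_cubeMeasure (hh : 0 < h) :
    ∀ᵐ x ∂(cubeMeasure ι h), ‖x‖ ≤ √(Fintype.card ι) * h := by
  have := isProbabilityMeasure_arcMeasure hh
  rw [cubeMeasure, ae_map_iff (WithLp.measurable_toLp 2 _).aemeasurable
    (measurableSet_le measurable_norm measurable_const)]
  have coord_le : ∀ᵐ x ∂(Measure.pi fun _ : ι => arcMeasure h), ∀ i, ‖x i‖ ≤ h :=
    ae_all_iff.2 fun i => (measurePreserving_eval (fun _ : ι => arcMeasure h) i)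
      |>.quasiMeasurePreserving.ae (ae_norm_le_arcMeasure h)
  filter_upwards [coord_le] with x hx
  exact norm_le_sqrt_card_mul hh.le hx

lemma fourierCoeff_cubeMeasure (hh : 0 < h) (ξ : Fin d → ℤ) :
    fourierCoeff (cubeMeasure (Fin d) h) ξ
      = ∏ j, ∫ x, (fourier (-ξ j) x : ℂ) ∂(arcMeasure h) := by
  have := isProbabilityMeasure_arcMeasure hh
  rw [fourierCoeff_eq, cubeMeasure, integral_map (WithLp.measurable_toLp 2 _).aemeasurable
    (continuous_char _).aestronglyMeasurable]
  exact integral_fintype_prod_eq_prod (𝕜 := ℂ) (μ := fun _ : Fin d => arcMeasure h)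
    (fun j x => (fourier (-ξ j) x : ℂ))

lemma norm_integral_fourier_le_one {μ : Measure UnitAddCircle} [IsProbabilityMeasure μ] (k : ℤ) :
    ‖∫ x, (fourier k x : ℂ) ∂μ‖ ≤ 1 := by
  simpa using norm_integral_le_of_norm_le_const (μ := μ) (f := fun x => (fourier k x : ℂ)) (C := 1)
    (.of_forall fun x => by rw [fourier_apply]; exact (Circle.norm_coe _).le)

lemma exists_freqNorm_le_sqrt_mul_abs {ξ : Fin d → ℤ} (hξ : ξ ≠ 0) :
    ∃ i, ξ i ≠ 0 ∧ freqNorm ξ ≤ √d * |(ξ i : ℝ)| := by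
  obtain ⟨i₀, hi₀⟩ := Function.ne_iff.mp hξ
  obtain ⟨i, -, hi⟩ := Finset.exists_max_image Finset.univ (fun i => |(ξ i : ℝ)|)
    ⟨i₀, Finset.mem_univ _⟩
  refine ⟨i, fun hz => ?_, freqNorm_le_of_forall_abs_le (abs_nonneg _) fun j =>
    hi j (Finset.mem_univ _)⟩
  have := hi i₀ (Finset.mem_univ _)
  simp only [hz, Int.cast_zero, abs_zero, abs_nonpos_iff, Int.cast_eq_zero] at this
  exact hi₀ this

lemma norm_fourierCoeff_cubeMeasure_le (hh : 0 < h) {ξ : Fin d → ℤ} (hξ : ξ ≠ 0) :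
    ‖fourierCoeff (cubeMeasure (Fin d) h) ξ‖ ≤ √d / (h * freqNorm ξ) := by
  have := isProbabilityMeasure_arcMeasure hh
  obtain ⟨i, hi, hi_max⟩ := exists_freqNorm_le_sqrt_mul_abs hξ
  have : 0 < |(ξ i : ℝ)| := abs_pos.2 (by exact_mod_cast hi)
  have hξ_pos := freqNorm_pos hξ
  rw [fourierCoeff_cubeMeasure hh, norm_prod, ← Finset.mul_prod_erase _ _ (Finset.mem_univ i)]
  calc _ ≤ ‖∫ x, (fourier (-ξ i) x : ℂ) ∂(arcMeasure h)‖ :=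
        mul_le_of_le_one_right (norm_nonneg _)
          (Finset.prod_le_one (fun _ _ => norm_nonneg _) fun _ _ => norm_integral_fourier_le_one _)
    _ ≤ (h * |((-ξ i : ℤ) : ℝ)|)⁻¹ := norm_integral_fourier_arcMeasure_le hh (neg_ne_zero.2 hi)
    _ ≤ √d / (h * freqNorm ξ) := by
        rw [Int.cast_neg, abs_neg, inv_eq_one_div, div_le_div_iff₀ (by positivity) (by positivity)]
        nlinarith

end CubeMeasure

section Mollifier

variable {d : ℕ}

lemma exists_iterated_conv_cubeMeasure (p : ℕ) {h : ℝ} (hh : 0 < h) (h1 : h ≤ 1) :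
    ∃ ψ : Measure (Torus (Fin d)), IsProbabilityMeasure ψ ∧
      (∀ᵐ x ∂ψ, ‖x‖ ≤ (p + 1) * (√d * h)) ∧
      (∀ ξ : Fin d → ℤ, ξ ≠ 0 → ‖fourierCoeff ψ ξ‖ ≤ (√d / (h * freqNorm ξ)) ^ (p + 1)) ∧
      ψ ≤ (ENNReal.ofReal h)⁻¹ ^ d • lebesgue (Fin d) := by
  have := isProbabilityMeasure_cubeMeasure (ι := Fin d) hh
  have cube_le : cubeMeasure (Fin d) h ≤ (ENNReal.ofReal h)⁻¹ ^ d • lebesgue (Fin d) := by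
    simpa using cubeMeasure_le (ι := Fin d) hh h1
  have cube_small : ∀ᵐ x ∂(cubeMeasure (Fin d) h), ‖x‖ ≤ √d * h := by
    simpa using ae_norm_le_cubeMeasure (ι := Fin d) hh
  induction p with
  | zero =>
    refine ⟨cubeMeasure (Fin d) h, inferInstance, by simpa using cube_small, fun ξ hξ => ?_,
      cube_le⟩
    simpa using norm_fourierCoeff_cubeMeasure_le hh hξ
  | succ p ih =>
    obtain ⟨ψ, hψ, ψ_small, ψ_decay, -⟩ := ih
    refine ⟨ψ ∗ cubeMeasure (Fin d) h, inferInstance, ?_, fun ξ hξ => ?_,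
      conv_le_smul_lebesgue cube_le⟩
    · filter_upwards [ae_norm_le_conv ψ_small cube_small] with x hx
      refine hx.trans_eq ?_
      push_cast
      ring
    · rw [fourierCoeff_conv, norm_mul, pow_succ]
      have := freqNorm_nonneg ξ
      exact mul_le_mul (ψ_decay ξ hξ) (norm_fourierCoeff_cubeMeasure_le hh hξ) (norm_nonneg _)
        (by positivity)

/-- `ψ` is a mollifier at scale `r` with decay constant `C`: a probability measure with bounded
density, carried by the ball of radius `r` around `0`, whose Fourier coefficients decay to order
`d + 1` beyond the frequency `1 / r`. -/
structure IsMollifier (ψ : Measure (Torus (Fin d))) (C r : ℝ) : Prop where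
  isProbabilityMeasure : IsProbabilityMeasure ψ
  ae_norm_le : ∀ᵐ x ∂ψ, ‖x‖ ≤ r
  norm_fourierCoeff_le : ∀ ξ : Fin d → ℤ, ξ ≠ 0 →
    ‖fourierCoeff ψ ξ‖ ≤ C / (r * freqNorm ξ) ^ (d + 1)
  exists_le_smul_lebesgue : ∃ K : ℝ≥0∞, K ≠ ∞ ∧ ψ ≤ K • lebesgue (Fin d)

lemma exists_isMollifier (d : ℕ) : ∃ C : ℝ, 0 < C ∧ ∀ r : ℝ, 0 < r → r ≤ 1 →
    ∃ ψ : Measure (Torus (Fin d)), IsMollifier ψ C r := by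
  let a : ℝ := (d + 1) * (√d + 1)
  have one_le_a : 1 ≤ a := by
    have := Real.sqrt_nonneg (d : ℝ)
    exact one_le_mul_of_one_le_of_one_le (by simp) (by simp)
  refine ⟨(a * (√d + 1)) ^ (d + 1), by positivity, fun r hr hr1 => ?_⟩
  have hh : 0 < r / a := by positivity
  obtain ⟨ψ, hψ, small, decay, density⟩ := exists_iterated_conv_cubeMeasure (d := d) d hh
    ((div_le_one (by positivity)).2 (hr1.trans one_le_a))
  refine ⟨ψ, hψ, ?_, fun ξ hξ => ?_, _, by simp [hh], density⟩
  · filter_upwards [small] with x hx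
    calc ‖x‖ ≤ (d + 1) * (√d * (r / a)) := hx
      _ = r * ((d + 1) * √d / a) := by ring
      _ ≤ r * 1 := by
          gcongr
          refine (div_le_one (by positivity)).2 ?_
          simp only [a]
          gcongr
          linarith
      _ = r := mul_one r
  · have hξ_pos := freqNorm_pos hξ
    calc ‖fourierCoeff ψ ξ‖ ≤ (√d / (r / a * freqNorm ξ)) ^ (d + 1) := decay ξ hξ
      _ = (a * √d / (r * freqNorm ξ)) ^ (d + 1) := by
          congr 1
          field_simp
      _ ≤ (a * (√d + 1) / (r * freqNorm ξ)) ^ (d + 1) := by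
          gcongr
          linarith
      _ = (a * (√d + 1)) ^ (d + 1) / (r * freqNorm ξ) ^ (d + 1) := div_pow ..

end Mollifier

section FastDecay

variable {d : ℕ} {μ ψ : Measure (Torus (Fin d))} {C r s : ℝ}

/-- The Fourier coefficients of `μ` decay to order `d + 1` with constant `C`. This replaces the
smoothness of a density, and makes `‖μ‖_{M(s)}` finite for all `s ∈ [0, d]`. -/
def HasFastDecay (μ : Measure (Torus (Fin d))) (C : ℝ) : Prop :=
  ∀ ξ : Fin d → ℤ, ξ ≠ 0 → ‖fourierCoeff μ ξ‖ ≤ C / freqNorm ξ ^ (d + 1)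

lemma IsMollifier.hasFastDecay (hψ : IsMollifier ψ C r) : HasFastDecay ψ (C / r ^ (d + 1)) :=
  fun ξ hξ => by simpa only [mul_pow, div_div] using hψ.norm_fourierCoeff_le ξ hξ

lemma HasFastDecay.conv [IsProbabilityMeasure μ] [IsFiniteMeasure ψ] (hψ : HasFastDecay ψ C) :
    HasFastDecay (μ ∗ ψ) C := fun ξ hξ => by
  rw [fourierCoeff_conv, norm_mul]
  exact (mul_le_of_le_one_left (norm_nonneg _) (norm_fourierCoeff_le_one μ ξ)).trans (hψ ξ hξ)

lemma freqNorm_rpow_le_pow (hsd : s ≤ d) {ξ : Fin d → ℤ} (hξ : ξ ≠ 0) :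
    freqNorm ξ ^ (s / 2) ≤ freqNorm ξ ^ d := by
  rw [← Real.rpow_natCast]
  have : (0 : ℝ) ≤ d := Nat.cast_nonneg d
  exact Real.rpow_le_rpow_of_exponent_le (one_le_freqNorm hξ) (by linarith)

lemma HasFastDecay.norm_mul_rpow_le (hμ : HasFastDecay μ C) (hsd : s ≤ d) {ξ : Fin d → ℤ}
    (hξ : ξ ≠ 0) : ‖fourierCoeff μ ξ‖ * freqNorm ξ ^ (s / 2) ≤ C := by
  have hξ_pos := freqNorm_pos hξ
  calc ‖fourierCoeff μ ξ‖ * freqNorm ξ ^ (s / 2)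
      ≤ ‖fourierCoeff μ ξ‖ * freqNorm ξ ^ (d + 1) := by
        gcongr
        exact (freqNorm_rpow_le_pow hsd hξ).trans
          (pow_le_pow_right₀ (one_le_freqNorm hξ) d.le_succ)
    _ ≤ C := (le_div_iff₀ (by positivity)).1 (hμ ξ hξ)

lemma HasFastDecay.decayNorm_lt_top [IsProbabilityMeasure μ] (hμ : HasFastDecay μ C) (hs : 0 ≤ s)
    (hsd : s ≤ d) : decayNorm s (fourierCoeff μ) < ∞ := by
  refine (iSup_le fun ξ => ENNReal.ofReal_le_ofReal (q := max 1 C) ?_).trans_lt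
    ENNReal.ofReal_lt_top
  by_cases hξ : ξ = 0
  · rw [hξ, freqNorm_zero]
    exact le_max_of_le_left <| mul_le_one₀ (norm_fourierCoeff_le_one _ _)
      (Real.rpow_nonneg le_rfl _) (Real.rpow_le_one le_rfl zero_le_one (by positivity))
  · exact le_max_of_le_right (hμ.norm_mul_rpow_le hsd hξ)

end FastDecay

section Empirical

variable {d : ℕ} {κ : Type*}

/-- The uniform distribution on the points `x i`, `i ∈ G`, counted with multiplicity. -/
def empirical (G : Finset κ) (x : κ → Torus (Fin d)) : Measure (Torus (Fin d)) :=
  (G.card : ℝ≥0∞)⁻¹ • ∑ i ∈ G, Measure.dirac (x i)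

lemma isProbabilityMeasure_empirical {G : Finset κ} (hG : G.Nonempty) (x : κ → Torus (Fin d)) :
    IsProbabilityMeasure (empirical G x) := by
  refine ⟨?_⟩
  simp only [empirical, Measure.smul_apply, Measure.finsetSum_apply, measure_univ,
    Finset.sum_const, nsmul_eq_mul, mul_one, smul_eq_mul]
  exact ENNReal.inv_mul_cancel (by simpa using hG.ne_empty) (ENNReal.natCast_ne_top _)

lemma ae_empirical {G : Finset κ} {x : κ → Torus (Fin d)} {p : Torus (Fin d) → Prop}
    (h : ∀ i ∈ G, p (x i)) : ∀ᵐ y ∂(empirical G x), p y := by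
  refine Measure.ae_smul_measure ?_ _
  rw [ae_iff, Measure.finsetSum_apply]
  refine Finset.sum_eq_zero fun i hi => ?_
  rw [← ae_iff, ae_dirac_eq]
  exact h i hi

lemma empirical_singleton_ne_zero {G : Finset κ} (x : κ → Torus (Fin d)) {i : κ} (hi : i ∈ G) :
    empirical G x {x i} ≠ 0 := by
  rw [empirical, Measure.smul_apply, Measure.finsetSum_apply, smul_eq_mul]
  refine mul_ne_zero (by simp) fun h => ?_
  rw [Finset.sum_eq_zero_iff] at h
  simpa using h i hi

lemma card_mul_fourierCoeff_empirical (G : Finset κ) (x : κ → Torus (Fin d)) (ξ : Fin d → ℤ) :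
    (G.card : ℂ) * fourierCoeff (empirical G x) ξ = ∑ i ∈ G, char (-ξ) (x i) := by
  rcases G.eq_empty_or_nonempty with rfl | hG
  · simp
  · have : (G.card : ℂ) ≠ 0 := by simpa using hG.ne_empty
    rw [empirical, fourierCoeff_smul, fourierCoeff_eq,
      integral_finsetSum_measure fun i _ => integrable_char _ _]
    simp [this]

lemma norm_fourierCoeff_empirical_sub_le [Fintype κ] [DecidableEq κ] {G : Finset κ}
    (hG : G.Nonempty) (x : κ → Torus (Fin d)) {τ : ℝ} (hτ : (Gᶜ.card : ℝ) ≤ Fintype.card κ * τ)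
    (ξ : Fin d → ℤ) :
    ‖fourierCoeff (empirical G x) ξ - fourierCoeff (empirical Finset.univ x) ξ‖ ≤ 2 * τ := by
  have := isProbabilityMeasure_empirical hG x
  have card_pos : 0 < (Fintype.card κ : ℝ) :=
    Nat.cast_pos.2 (Fintype.card_pos_iff.2 ⟨hG.choose⟩)
  have card_add : (G.card : ℂ) + Gᶜ.card = Fintype.card κ := by
    exact_mod_cast Finset.card_add_card_compl G
  have card_mul_sub : Fintype.card κ *
      (fourierCoeff (empirical G x) ξ - fourierCoeff (empirical Finset.univ x) ξ) =
      Gᶜ.card * fourierCoeff (empirical G x) ξ - ∑ i ∈ Gᶜ, char (-ξ) (x i) := by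
    have sum_univ := card_mul_fourierCoeff_empirical Finset.univ x ξ
    rw [Finset.card_univ, ← Finset.sum_add_sum_compl G,
      ← card_mul_fourierCoeff_empirical G] at sum_univ
    rw [mul_sub, sum_univ, ← card_add]
    ring
  refine le_of_mul_le_mul_left ?_ card_pos
  calc Fintype.card κ *
        ‖fourierCoeff (empirical G x) ξ - fourierCoeff (empirical Finset.univ x) ξ‖
      = ‖Gᶜ.card * fourierCoeff (empirical G x) ξ - ∑ i ∈ Gᶜ, char (-ξ) (x i)‖ := by
        rw [← card_mul_sub, norm_mul, Complex.norm_natCast]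
    _ ≤ Gᶜ.card * ‖fourierCoeff (empirical G x) ξ‖ + ∑ i ∈ Gᶜ, ‖char (-ξ) (x i)‖ := by
        refine (norm_sub_le _ _).trans (add_le_add ?_ (norm_sum_le _ _))
        rw [norm_mul, Complex.norm_natCast]
    _ ≤ Gᶜ.card * 1 + Gᶜ.card := by
        gcongr
        · exact norm_fourierCoeff_le_one _ _
        · simp [norm_char]
    _ ≤ Fintype.card κ * (2 * τ) := by linarith

end Empirical

section Smoothing

variable {d : ℕ} {μ ν ψ : Measure (Torus (Fin d))} {s t ε : ℝ}

lemma ae_of_support_subset {E : Set (Torus (Fin d))} (h : μ.support ⊆ E) : ∀ᵐ x ∂μ, x ∈ E :=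
  Filter.mem_of_superset Measure.support_mem_ae h

lemma norm_fourierCoeff_sub_le_two (μ ν : Measure (Torus (Fin d))) [IsProbabilityMeasure μ]
    [IsProbabilityMeasure ν] (ξ : Fin d → ℤ) : ‖fourierCoeff μ ξ - fourierCoeff ν ξ‖ ≤ 2 :=
  calc ‖fourierCoeff μ ξ - fourierCoeff ν ξ‖ ≤ ‖fourierCoeff μ ξ‖ + ‖fourierCoeff ν ξ‖ :=
        norm_sub_le _ _
    _ ≤ 1 + 1 := add_le_add (norm_fourierCoeff_le_one μ ξ) (norm_fourierCoeff_le_one ν ξ)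
    _ = 2 := one_add_one_eq_two

lemma conv_ball_pos [IsProbabilityMeasure μ] [IsProbabilityMeasure ψ] {x y : Torus (Fin d)}
    (hx : μ {x} ≠ 0) {r : ℝ} (hψ : ∀ᵐ z ∂ψ, ‖z‖ ≤ r) (hd : dist x y + r < ε) :
    0 < (μ ∗ ψ) (Metric.ball y ε) := by
  rw [pos_iff_ne_zero]
  intro ball_eq_zero
  have ae_notMem : ∀ᵐ z ∂(μ ∗ ψ), z ∉ Metric.ball y ε :=
    measure_eq_zero_iff_ae_notMem.1 ball_eq_zero
  rw [Measure.conv, ae_map_iff (p := (· ∉ Metric.ball y ε)) (by fun_prop)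
    Metric.isOpen_ball.measurableSet.compl] at ae_notMem
  have ae_add_notMem : ∀ᵐ z ∂ψ, x + z ∉ Metric.ball y ε := by
    by_contra hcon
    refine hx (measure_mono_null ?_ (ae_iff.1 (Measure.ae_ae_of_ae_prod ae_notMem)))
    rintro _ rfl
    exact hcon
  obtain ⟨z, hz_notMem, hz⟩ := (ae_add_notMem.and hψ).exists
  refine hz_notMem (Metric.mem_ball.2 ?_)
  calc dist (x + z) y ≤ dist (x + z) x + dist x y := dist_triangle _ _ _
    _ = ‖z‖ + dist x y := by rw [dist_eq_norm, add_sub_cancel_left]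
    _ < ε := by linarith

lemma mul_freqNorm_rpow_le_of_le {a B M : ℝ} (ha : 0 ≤ a) (hst : s ≤ t) (hM : 0 < M)
    {ξ : Fin d → ℤ} (hξ : M ≤ freqNorm ξ) (h : a * freqNorm ξ ^ (t / 2) ≤ B) :
    a * freqNorm ξ ^ (s / 2) ≤ B * M ^ (-((t - s) / 2)) := by
  have rpow_split :
      freqNorm ξ ^ (s / 2) = freqNorm ξ ^ (t / 2) * freqNorm ξ ^ (-((t - s) / 2)) := by
    rw [← Real.rpow_add (hM.trans_le hξ)]
    ring_nf
  have hB : 0 ≤ B := h.trans' (mul_nonneg ha (Real.rpow_nonneg (freqNorm_nonneg ξ) _))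
  rw [rpow_split, ← mul_assoc]
  exact mul_le_mul h (Real.rpow_le_rpow_of_nonpos hM hξ (by linarith))
    (Real.rpow_nonneg (freqNorm_nonneg ξ) _) hB

-- Frequencies above `M` are controlled by the stronger norm `‖μ‖_{M(t)}`; below `M` only the
-- smallness of the support of `ψ` matters.
lemma exists_decayNorm_conv_sub_le [IsProbabilityMeasure μ] (hs : 0 ≤ s) (hst : s < t)
    (ht : decayNorm t (fourierCoeff μ) < ∞) (hε : 0 < ε) :
    ∃ r₀ : ℝ, 0 < r₀ ∧ ∀ ψ : Measure (Torus (Fin d)), IsProbabilityMeasure ψ →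
      (∀ᵐ x ∂ψ, ‖x‖ ≤ r₀) →
      decayNorm s (fourierCoeff (μ ∗ ψ) - fourierCoeff μ) ≤ ENNReal.ofReal ε := by
  obtain ⟨B, hB_nonneg, hB⟩ := exists_bound_of_decayNorm_lt_top ht
  obtain ⟨M, one_le_M, hM⟩ : ∃ M : ℝ, 1 ≤ M ∧ B * M ^ (-((t - s) / 2)) * 2 ≤ ε := by
    have tendsto_zero :=
      ((tendsto_rpow_neg_atTop (y := (t - s) / 2) (by linarith)).const_mul B).mul_const 2
    rw [mul_zero, zero_mul] at tendsto_zero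
    exact ((Filter.eventually_ge_atTop 1).and (tendsto_zero.eventually_le_const hε)).exists
  have hM_pos : 0 < M := zero_lt_one.trans_le one_le_M
  refine ⟨ε / (2 * Real.pi * M * M ^ (s / 2)), by positivity, fun ψ hψ hψ_small => ?_⟩
  refine decayNorm_le_ofReal (by simp [fourierCoeff_zero]) fun ξ hξ => ?_
  have hξ_pos := freqNorm_pos hξ
  have norm_sub_eq : ‖(fourierCoeff (μ ∗ ψ) - fourierCoeff μ) ξ‖ =
      ‖fourierCoeff μ ξ‖ * ‖fourierCoeff ψ ξ - 1‖ := by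
    rw [Pi.sub_apply, fourierCoeff_conv, ← norm_mul, mul_sub, mul_one]
  rw [norm_sub_eq]
  rcases le_total (freqNorm ξ) M with hle | hle
  · calc ‖fourierCoeff μ ξ‖ * ‖fourierCoeff ψ ξ - 1‖ * freqNorm ξ ^ (s / 2)
        ≤ 1 * (2 * Real.pi * M * (ε / (2 * Real.pi * M * M ^ (s / 2)))) * M ^ (s / 2) := by
          gcongr
          · exact norm_fourierCoeff_le_one μ ξ
          · refine (norm_fourierCoeff_sub_one_le hψ_small ξ).trans ?_
            gcongr
      _ = ε := by field_simp
  · have norm_sub_one_le : ‖fourierCoeff ψ ξ - 1‖ ≤ 2 := by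
      refine (norm_sub_le _ _).trans ?_
      rw [norm_one]
      linarith [norm_fourierCoeff_le_one ψ ξ]
    calc ‖fourierCoeff μ ξ‖ * ‖fourierCoeff ψ ξ - 1‖ * freqNorm ξ ^ (s / 2)
        = (‖fourierCoeff μ ξ‖ * freqNorm ξ ^ (s / 2)) * ‖fourierCoeff ψ ξ - 1‖ := by ring
      _ ≤ B * M ^ (-((t - s) / 2)) * 2 := by
          refine mul_le_mul ?_ norm_sub_one_le (norm_nonneg _) (by positivity)
          exact mul_freqNorm_rpow_le_of_le (norm_nonneg _) hst.le hM_pos hle (hB ξ)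
      _ ≤ ε := hM

/-- The convex combination `(1 - w) μ + w ν`, meant for `w ∈ [0, 1]`. -/
def mix (w : ℝ) (μ ν : Measure (Torus (Fin d))) : Measure (Torus (Fin d)) :=
  ENNReal.ofReal (1 - w) • μ + ENNReal.ofReal w • ν

lemma isProbabilityMeasure_mix [IsProbabilityMeasure μ] [IsProbabilityMeasure ν] {w : ℝ}
    (hw0 : 0 ≤ w) (hw1 : w ≤ 1) : IsProbabilityMeasure (mix w μ ν) := by
  refine ⟨?_⟩
  simp only [mix, Measure.add_apply, Measure.smul_apply, measure_univ, smul_eq_mul, mul_one]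
  rw [← ENNReal.ofReal_add (by linarith) hw0, sub_add_cancel, ENNReal.ofReal_one]

lemma ae_mix {w : ℝ} {p : Torus (Fin d) → Prop} (hμ : ∀ᵐ x ∂μ, p x) (hν : ∀ᵐ x ∂ν, p x) :
    ∀ᵐ x ∂(mix w μ ν), p x :=
  ae_add_measure_iff.2 ⟨Measure.ae_smul_measure hμ _, Measure.ae_smul_measure hν _⟩

lemma fourierCoeff_mix [IsFiniteMeasure μ] [IsFiniteMeasure ν] {w : ℝ} (hw0 : 0 ≤ w) (hw1 : w ≤ 1)
    (ξ : Fin d → ℤ) :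
    fourierCoeff (mix w μ ν) ξ = fourierCoeff μ ξ + w * (fourierCoeff ν ξ - fourierCoeff μ ξ) := by
  have := Measure.smul_finite μ (c := ENNReal.ofReal (1 - w)) ENNReal.ofReal_ne_top
  have := Measure.smul_finite ν (c := ENNReal.ofReal w) ENNReal.ofReal_ne_top
  rw [mix, fourierCoeff_add, fourierCoeff_smul, fourierCoeff_smul,
    ENNReal.toReal_ofReal (by linarith), ENNReal.toReal_ofReal hw0]
  push_cast
  ring

lemma exists_decayNorm_mix_conv_sub_le [IsProbabilityMeasure μ] [IsProbabilityMeasure ν]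
    [IsProbabilityMeasure ψ] {C : ℝ} (hψ : HasFastDecay ψ C) (hsd : s ≤ d) (hε : 0 < ε) :
    ∃ w : ℝ, 0 < w ∧ w < 1 ∧
      decayNorm s (fourierCoeff (mix w μ ν ∗ ψ) - fourierCoeff (μ ∗ ψ)) ≤ ENNReal.ofReal ε := by
  obtain ⟨w, hw0, hw1, hw⟩ : ∃ w : ℝ, 0 < w ∧ w < 1 ∧ w * 2 * |C| ≤ ε := by
    refine ⟨min (1 / 2) (ε / (2 * |C| + 1)), by positivity,
      (min_le_left _ _).trans_lt one_half_lt_one, ?_⟩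
    have hw := (le_div_iff₀ (by positivity)).1 (min_le_right (1 / 2) (ε / (2 * |C| + 1)))
    have hw_pos : 0 ≤ min (1 / 2) (ε / (2 * |C| + 1)) := by positivity
    linarith
  have := isProbabilityMeasure_mix (μ := μ) (ν := ν) hw0.le hw1.le
  refine ⟨w, hw0, hw1, decayNorm_le_ofReal (by simp [fourierCoeff_zero]) fun ξ hξ => ?_⟩
  have sub_eq : (fourierCoeff (mix w μ ν ∗ ψ) - fourierCoeff (μ ∗ ψ)) ξ =
      w * (fourierCoeff ν ξ - fourierCoeff μ ξ) * fourierCoeff ψ ξ := by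
    rw [Pi.sub_apply, fourierCoeff_conv, fourierCoeff_conv, fourierCoeff_mix hw0.le hw1.le]
    ring
  calc ‖(fourierCoeff (mix w μ ν ∗ ψ) - fourierCoeff (μ ∗ ψ)) ξ‖ * freqNorm ξ ^ (s / 2)
      = w * ‖fourierCoeff ν ξ - fourierCoeff μ ξ‖ *
          (‖fourierCoeff ψ ξ‖ * freqNorm ξ ^ (s / 2)) := by
        rw [sub_eq, norm_mul, norm_mul, Complex.norm_real, Real.norm_eq_abs, abs_of_pos hw0,
          mul_assoc]
    _ ≤ w * 2 * |C| := by
        gcongr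
        · exact mul_nonneg (norm_nonneg _) (Real.rpow_nonneg (freqNorm_nonneg ξ) _)
        · exact norm_fourierCoeff_sub_le_two ν μ ξ
        · exact (hψ.norm_mul_rpow_le hsd hξ).trans (le_abs_self C)
    _ ≤ ε := hw

/-- `μ₁` is a smooth perturbation of `μ₀` at scale `ε`, in the `M(s)` norm, which is spread over
the whole of `E₀` and not only over the support of `μ₀`. -/
structure IsSmoothApprox (μ₀ : Measure (Torus (Fin d))) (E₀ : Set (Torus (Fin d))) (s ε : ℝ)
    (μ₁ : Measure (Torus (Fin d))) : Prop where
  isProbabilityMeasure : IsProbabilityMeasure μ₁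
  exists_le_smul_lebesgue : ∃ K : ℝ≥0∞, K ≠ ∞ ∧ μ₁ ≤ K • lebesgue (Fin d)
  exists_hasFastDecay : ∃ C : ℝ, HasFastDecay μ₁ C
  decayNorm_sub_le : decayNorm s (fourierCoeff μ₁ - fourierCoeff μ₀) ≤ ENNReal.ofReal ε
  ae_mem_thickening : ∀ᵐ x ∂μ₁, x ∈ Metric.thickening ε E₀
  measure_ball_pos : ∀ y ∈ E₀, 0 < μ₁ (Metric.ball y ε)

lemma exists_isSmoothApprox [IsProbabilityMeasure μ] {E : Set (Torus (Fin d))} (hE : IsCompact E)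
    (hμE : μ.support ⊆ E) (hs : 0 ≤ s) (hst : s < t) (hsd : s ≤ d)
    (ht : decayNorm t (fourierCoeff μ) < ∞) (hε : 0 < ε) :
    ∃ μ₁ : Measure (Torus (Fin d)), IsSmoothApprox μ E s ε μ₁ := by
  obtain ⟨r₀, hr₀, conv_sub_le⟩ := exists_decayNorm_conv_sub_le hs hst ht (half_pos hε)
  obtain ⟨C, -, hmol⟩ := exists_isMollifier d
  obtain ⟨ψ, hψ⟩ := hmol (min (min 1 r₀) (ε / 4)) (by positivity)
    ((min_le_left _ _).trans (min_le_left _ _))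
  have := hψ.isProbabilityMeasure
  have norm_le_r₀ : ∀ᵐ x ∂ψ, ‖x‖ ≤ r₀ := hψ.ae_norm_le.mono fun x hx =>
    hx.trans ((min_le_left _ _).trans (min_le_right _ _))
  have norm_le_ε : ∀ᵐ x ∂ψ, ‖x‖ ≤ ε / 4 := hψ.ae_norm_le.mono fun x hx =>
    hx.trans (min_le_right _ _)
  obtain ⟨F, hF, hcov⟩ := hE.elim_nhds_subcover (fun y => Metric.ball y (ε / 2))
    (fun y _ => Metric.ball_mem_nhds y (half_pos hε))
  have F_nonempty : F.Nonempty := by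
    obtain ⟨y, hy⟩ := (Measure.nonempty_support (IsProbabilityMeasure.ne_zero μ)).mono hμE
    obtain ⟨i, hi, -⟩ := Set.mem_iUnion₂.1 (hcov hy)
    exact ⟨i, hi⟩
  have := isProbabilityMeasure_empirical F_nonempty (id : Torus (Fin d) → Torus (Fin d))
  obtain ⟨w, hw0, hw1, mix_sub_le⟩ := exists_decayNorm_mix_conv_sub_le (μ := μ)
    (ν := empirical F id) hψ.hasFastDecay hsd (half_pos hε)
  have := isProbabilityMeasure_mix (μ := μ) (ν := empirical F id) hw0.le hw1.le
  obtain ⟨K, hK, hψK⟩ := hψ.exists_le_smul_lebesgue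
  refine ⟨mix w μ (empirical F id) ∗ ψ, inferInstance, ⟨K, hK, conv_le_smul_lebesgue hψK⟩,
    ⟨_, hψ.hasFastDecay.conv⟩, ?_, ?_, fun y hy => ?_⟩
  · rw [← sub_add_sub_cancel _ (fourierCoeff (μ ∗ ψ)), ← add_halves ε,
      ENNReal.ofReal_add (half_pos hε).le (half_pos hε).le]
    exact (decayNorm_add_le _ _ _).trans
      (add_le_add mix_sub_le (conv_sub_le ψ inferInstance norm_le_r₀))
  · refine ae_conv_of_ae_of_ae Metric.isOpen_thickening.measurableSet
      (ae_mix (ae_of_support_subset hμE) (ae_empirical hF)) norm_le_ε fun x y hx hy => ?_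
    refine Metric.mem_thickening_iff.2 ⟨x, hx, ?_⟩
    rw [dist_eq_norm, add_sub_cancel_left]
    linarith
  · obtain ⟨i, hi, hyi⟩ := Set.mem_iUnion₂.1 (hcov hy)
    rw [Metric.mem_ball, dist_comm] at hyi
    have singleton_ne_zero : mix w μ (empirical F id) {i} ≠ 0 := by
      have := empirical_singleton_ne_zero (id : Torus (Fin d) → Torus (Fin d)) hi
      simp only [mix, Measure.add_apply, Measure.smul_apply, smul_eq_mul]
      exact fun h => mul_ne_zero (by simpa using hw0) this (add_eq_zero.1 h).2
    exact conv_ball_pos singleton_ne_zero norm_le_ε (by linarith)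

end Smoothing

section Concentration

variable {X : Type*} [MeasurableSpace X] {μ : Measure X} [IsProbabilityMeasure μ] {t : ℝ}

lemma integral_comp_eval_pi {N : ℕ} {g : X → ℝ} (hg : Measurable g) (i : Fin N) :
    ∫ x, g (x i) ∂(Measure.pi fun _ : Fin N => μ) = ∫ y, g y ∂μ := by
  have map_eq := (measurePreserving_eval (fun _ : Fin N => μ) i).map_eq
  conv_rhs => rw [← map_eq]
  exact (integral_map (measurable_pi_apply i).aemeasurable hg.aestronglyMeasurable).symm

lemma measureReal_sum_sub_integral_ge_le (N : ℕ) {g : X → ℝ} (hg : Measurable g)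
    (hg1 : ∀ x, |g x| ≤ 1) (ht : 0 ≤ t) :
    (Measure.pi fun _ : Fin N => μ).real {x | N * t ≤ ∑ i, (g (x i) - ∫ y, g y ∂μ)} ≤
      Real.exp (-(N * t ^ 2) / 2) := by
  have indep : ProbabilityTheory.iIndepFun
      (fun (i : Fin N) (x : Fin N → X) => g (x i) - ∫ y, g y ∂μ)
      (Measure.pi fun _ : Fin N => μ) :=
    ProbabilityTheory.iIndepFun_pi (μ := fun _ : Fin N => μ)
      (X := fun _ y => g y - ∫ y, g y ∂μ) fun _ => (hg.sub_const _).aemeasurable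
  have subgaussian (i : Fin N) : ProbabilityTheory.HasSubgaussianMGF
      (fun x : Fin N → X => g (x i) - ∫ y, g y ∂μ) 1 (Measure.pi fun _ : Fin N => μ) := by
    convert ProbabilityTheory.hasSubgaussianMGF_of_mem_Icc (μ := Measure.pi fun _ : Fin N => μ)
      (X := fun x => g (x i)) (a := -1) (b := 1) (hg.comp (measurable_pi_apply i)).aemeasurable
      (.of_forall fun x => abs_le.1 (hg1 (x i))) using 1
    · simp only [integral_comp_eval_pi hg]
    · ext
      norm_num
  refine (ProbabilityTheory.HasSubgaussianMGF.measure_sum_ge_le_of_iIndepFun indep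
    (s := Finset.univ) (c := fun _ => 1) (fun i _ => subgaussian i) (ε := N * t)
    (by positivity)).trans_eq ?_
  rcases Nat.eq_zero_or_pos N with rfl | hN
  · simp
  · simp
    field_simp

lemma measureReal_abs_sum_sub_integral_ge_le (N : ℕ) {g : X → ℝ} (hg : Measurable g)
    (hg1 : ∀ x, |g x| ≤ 1) (ht : 0 ≤ t) :
    (Measure.pi fun _ : Fin N => μ).real {x | N * t ≤ |∑ i, (g (x i) - ∫ y, g y ∂μ)|} ≤
      2 * Real.exp (-(N * t ^ 2) / 2) := by
  have upper := measureReal_sum_sub_integral_ge_le (μ := μ) N hg hg1 ht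
  have lower := measureReal_sum_sub_integral_ge_le (μ := μ) N hg.neg (by simpa using hg1) ht
  have sum_neg (x : Fin N → X) : ∑ i, ((-g) (x i) - ∫ y, (-g) y ∂μ) =
      -∑ i, (g (x i) - ∫ y, g y ∂μ) := by
    simp only [Pi.neg_apply, integral_neg, ← Finset.sum_neg_distrib, neg_sub', sub_neg_eq_add]
  simp only [sum_neg] at lower
  simp only [le_abs, Set.ofPred_or, two_mul]
  exact (measureReal_union_le _ _).trans (add_le_add upper lower)

lemma measureReal_norm_sum_sub_integral_gt_le (N : ℕ) {f : X → ℂ} (hf : Measurable f)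
    (hf1 : ∀ x, ‖f x‖ ≤ 1) (ht : 0 ≤ t) :
    (Measure.pi fun _ : Fin N => μ).real {x | N * t < ‖∑ i, (f (x i) - ∫ y, f y ∂μ)‖} ≤
      4 * Real.exp (-(N * t ^ 2) / 8) := by
  have integrable_f : Integrable f μ := .of_bound hf.aestronglyMeasurable 1 (.of_forall hf1)
  have re_dev := measureReal_abs_sum_sub_integral_ge_le (μ := μ) N (t := t / 2)
    (Complex.measurable_re.comp hf) (fun x => (Complex.abs_re_le_norm _).trans (hf1 x))
    (by positivity)
  have im_dev := measureReal_abs_sum_sub_integral_ge_le (μ := μ) N (t := t / 2)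
    (Complex.measurable_im.comp hf) (fun x => (Complex.abs_im_le_norm _).trans (hf1 x))
    (by positivity)
  have re_eq (x : Fin N → X) : (∑ i, (f (x i) - ∫ y, f y ∂μ)).re =
      ∑ i, ((f (x i)).re - ∫ y, (f y).re ∂μ) := by
    simp only [Complex.re_sum, Complex.sub_re]
    rw [show ∫ y, (f y).re ∂μ = (∫ y, f y ∂μ).re from integral_re integrable_f]
  have im_eq (x : Fin N → X) : (∑ i, (f (x i) - ∫ y, f y ∂μ)).im =
      ∑ i, ((f (x i)).im - ∫ y, (f y).im ∂μ) := by
    simp only [Complex.im_sum, Complex.sub_im]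
    rw [show ∫ y, (f y).im ∂μ = (∫ y, f y ∂μ).im from integral_im integrable_f]
  simp only [Function.comp_apply, ← re_eq] at re_dev
  simp only [Function.comp_apply, ← im_eq] at im_dev
  calc (Measure.pi fun _ : Fin N => μ).real {x | N * t < ‖∑ i, (f (x i) - ∫ y, f y ∂μ)‖}
      ≤ (Measure.pi fun _ : Fin N => μ).real
          ({x | N * (t / 2) ≤ |(∑ i, (f (x i) - ∫ y, f y ∂μ)).re|} ∪
            {x | N * (t / 2) ≤ |(∑ i, (f (x i) - ∫ y, f y ∂μ)).im|}) := by
        refine measureReal_mono (fun x hx => ?_) (measure_ne_top _ _)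
        by_contra hcon
        simp only [Set.mem_union, Set.mem_ofPred_eq, not_or, not_le] at hcon hx
        linarith [Complex.norm_le_abs_re_add_abs_im (∑ i, (f (x i) - ∫ y, f y ∂μ))]
    _ ≤ 2 * Real.exp (-(N * (t / 2) ^ 2) / 2) + 2 * Real.exp (-(N * (t / 2) ^ 2) / 2) :=
        (measureReal_union_le _ _).trans (add_le_add re_dev im_dev)
    _ = 4 * Real.exp (-(N * t ^ 2) / 8) := by ring_nf

end Concentration

section CountingTuples

variable {X : Type*} {n N : ℕ}

open Classical in
/-- The tuples of distinct indices at which the sample `x` takes values in `A`. -/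
def tuplesIn (A : Set (Fin n → X)) (x : Fin N → X) : Finset (Fin n ↪ Fin N) :=
  Finset.univ.filter fun f => (fun i => x (f i)) ∈ A

lemma mem_tuplesIn {A : Set (Fin n → X)} {x : Fin N → X} {f : Fin n ↪ Fin N} :
    f ∈ tuplesIn A x ↔ (fun i => x (f i)) ∈ A := by
  simp [tuplesIn]

lemma card_tuplesIn (A : Set (Fin n → X)) (x : Fin N → X) :
    ((tuplesIn A x).card : ℝ≥0∞) = ∑ f : Fin n ↪ Fin N, A.indicator 1 (fun i => x (f i)) := by
  classical
  simp only [tuplesIn, Set.indicator_apply, Pi.one_apply, Finset.sum_boole]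

variable [MeasurableSpace X] {μ : Measure X} [IsProbabilityMeasure μ]

lemma map_comp_embedding_pi (f : Fin n ↪ Fin N) :
    (Measure.pi fun _ : Fin N => μ).map (fun x i => x (f i)) = Measure.pi fun _ : Fin n => μ := by
  have indep : ProbabilityTheory.iIndepFun (fun (i : Fin N) (x : Fin N → X) => x i)
      (Measure.pi fun _ : Fin N => μ) :=
    ProbabilityTheory.iIndepFun_pi (μ := fun _ : Fin N => μ) (X := fun _ y => y)
      fun _ => aemeasurable_id
  have map_eq := indep.precomp f.injective
  rw [ProbabilityTheory.iIndepFun_iff_map_fun_eq_pi_map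
    (fun i => (measurable_pi_apply (f i)).aemeasurable)] at map_eq
  refine map_eq.trans (congrArg Measure.pi (funext fun i => ?_))
  exact (measurePreserving_eval (fun _ : Fin N => μ) (f i)).map_eq

lemma measurable_indicator_comp_embedding {A : Set (Fin n → X)} (hA : MeasurableSet A)
    (f : Fin n ↪ Fin N) :
    Measurable fun x : Fin N → X => A.indicator (1 : (Fin n → X) → ℝ≥0∞) (fun i => x (f i)) :=
  (measurable_one.indicator hA).comp (measurable_pi_lambda _ fun i => measurable_pi_apply (f i))

lemma lintegral_card_tuplesIn_le {A : Set (Fin n → X)} (hA : MeasurableSet A) :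
    ∫⁻ x, ((tuplesIn A x).card : ℝ≥0∞) ∂(Measure.pi fun _ : Fin N => μ) ≤
      N ^ n * (Measure.pi fun _ : Fin n => μ) A := by
  have lintegral_eq (f : Fin n ↪ Fin N) :
      ∫⁻ x, A.indicator 1 (fun i => x (f i)) ∂(Measure.pi fun _ : Fin N => μ) =
        (Measure.pi fun _ : Fin n => μ) A := by
    rw [← map_comp_embedding_pi f, ← lintegral_indicator_one hA,
      lintegral_map (measurable_one.indicator hA)
        (measurable_pi_lambda _ fun i => measurable_pi_apply (f i))]
  simp only [card_tuplesIn]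
  rw [lintegral_finsetSum _ fun f _ => measurable_indicator_comp_embedding hA f]
  simp only [lintegral_eq, Finset.sum_const, nsmul_eq_mul, Finset.card_univ,
    Fintype.card_embedding_eq, Fintype.card_fin]
  gcongr
  exact_mod_cast Nat.descFactorial_le_pow N n

lemma measure_le_card_tuplesIn_le_half {A : Set (Fin n → X)} (hA : MeasurableSet A) {T : ℝ}
    (hT : 0 < T)
    (hAT : (N : ℝ≥0∞) ^ n * (Measure.pi fun _ : Fin n => μ) A ≤ ENNReal.ofReal (T / 2)) :
    (Measure.pi fun _ : Fin N => μ) {x | ENNReal.ofReal T ≤ (tuplesIn A x).card} ≤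
      ENNReal.ofReal (1 / 2) := by
  have measurable_card : Measurable fun x : Fin N → X => ((tuplesIn A x).card : ℝ≥0∞) := by
    simp only [card_tuplesIn]
    exact Finset.measurable_sum _ fun f _ => measurable_indicator_comp_embedding hA f
  have markov := ((mul_meas_ge_le_lintegral (μ := Measure.pi fun _ : Fin N => μ) measurable_card
    (ENNReal.ofReal T)).trans (lintegral_card_tuplesIn_le hA)).trans hAT
  rw [← mul_one_div T, ENNReal.ofReal_mul hT.le] at markov
  exact (ENNReal.mul_le_mul_iff_right (by simpa using hT) ENNReal.ofReal_ne_top).1 markov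

end CountingTuples

section Sampling

variable {d n N : ℕ} {μ : Measure (Torus (Fin d))} [IsProbabilityMeasure μ] {t : ℝ}

lemma measureReal_empirical_deviation_le (hN : 0 < N) (ξ : Fin d → ℤ) (ht : 0 ≤ t) :
    (Measure.pi fun _ : Fin N => μ).real
      {x | t < ‖fourierCoeff (empirical Finset.univ x) ξ - fourierCoeff μ ξ‖} ≤
      4 * Real.exp (-(N * t ^ 2) / 8) := by
  have norm_eq (x : Fin N → Torus (Fin d)) : ‖∑ i, (char (-ξ) (x i) - ∫ y, char (-ξ) y ∂μ)‖ =
      N * ‖fourierCoeff (empirical Finset.univ x) ξ - fourierCoeff μ ξ‖ := by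
    have card_mul := card_mul_fourierCoeff_empirical Finset.univ x ξ
    rw [Finset.card_fin] at card_mul
    rw [Finset.sum_sub_distrib, ← card_mul, ← fourierCoeff_eq, Finset.sum_const,
      Finset.card_fin, nsmul_eq_mul, ← mul_sub, norm_mul, Complex.norm_natCast]
  have deviation := measureReal_norm_sum_sub_integral_gt_le (μ := μ) N
    (continuous_char (-ξ)).measurable (fun x => (norm_char _ x).le) ht
  have hN' : (0 : ℝ) < N := Nat.cast_pos.2 hN
  simpa only [norm_eq, mul_lt_mul_iff_right₀ hN'] using deviation

lemma measureReal_exists_empirical_deviation_lt_half (hN : 0 < N) (Ξ : Finset (Fin d → ℤ))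
    (ht : 0 ≤ t) (hΞ : 4 * Ξ.card * Real.exp (-(N * t ^ 2) / 8) < 1 / 2) :
    (Measure.pi fun _ : Fin N => μ).real
      (⋃ ξ ∈ Ξ, {x | t < ‖fourierCoeff (empirical Finset.univ x) ξ - fourierCoeff μ ξ‖}) <
      1 / 2 :=
  calc (Measure.pi fun _ : Fin N => μ).real
        (⋃ ξ ∈ Ξ, {x | t < ‖fourierCoeff (empirical Finset.univ x) ξ - fourierCoeff μ ξ‖})
      ≤ ∑ _ξ ∈ Ξ, 4 * Real.exp (-(N * t ^ 2) / 8) :=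
        (measureReal_biUnion_finset_le _ _).trans
          (Finset.sum_le_sum fun ξ _ => measureReal_empirical_deviation_le hN ξ ht)
    _ = 4 * Ξ.card * Real.exp (-(N * t ^ 2) / 8) := by
        rw [Finset.sum_const, nsmul_eq_mul]
        ring
    _ < 1 / 2 := hΞ

lemma exists_sample (hN : 0 < N) {S : Set (Torus (Fin d))} (hS : ∀ᵐ y ∂μ, y ∈ S)
    {A : Set (Fin n → Torus (Fin d))} (hA : MeasurableSet A) (Ξ : Finset (Fin d → ℤ)) {T : ℝ}
    (ht : 0 ≤ t) (hT : 0 < T) (hΞ : 4 * Ξ.card * Real.exp (-(N * t ^ 2) / 8) < 1 / 2)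
    (hAT : (N : ℝ≥0∞) ^ n * (Measure.pi fun _ : Fin n => μ) A ≤ ENNReal.ofReal (T / 2)) :
    ∃ x : Fin N → Torus (Fin d), (∀ i, x i ∈ S) ∧
      (∀ ξ ∈ Ξ, ‖fourierCoeff (empirical Finset.univ x) ξ - fourierCoeff μ ξ‖ ≤ t) ∧
      ((tuplesIn A x).card : ℝ) ≤ T := by
  let P := Measure.pi fun _ : Fin N => μ
  let U : Set (Fin N → Torus (Fin d)) := {x | ENNReal.ofReal T ≤ (tuplesIn A x).card} ∪
    ⋃ ξ ∈ Ξ, {x | t < ‖fourierCoeff (empirical Finset.univ x) ξ - fourierCoeff μ ξ‖}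
  have measure_U_lt : P U < 1 := by
    have deviation := measureReal_exists_empirical_deviation_lt_half (μ := μ) hN Ξ ht hΞ
    rw [measureReal_def, ← ENNReal.lt_ofReal_iff_toReal_lt (measure_ne_top _ _)] at deviation
    calc P U < ENNReal.ofReal (1 / 2) + ENNReal.ofReal (1 / 2) :=
          (measure_union_le _ _).trans_lt <| ENNReal.add_lt_add_of_le_of_lt (measure_ne_top _ _)
            (measure_le_card_tuplesIn_le_half hA hT hAT) deviation
      _ = 1 := by
          rw [← ENNReal.ofReal_add one_half_pos.le one_half_pos.le, add_halves, ENNReal.ofReal_one]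
  have ae_mem : ∀ᵐ x ∂P, ∀ i, x i ∈ S := ae_all_iff.2 fun i =>
    (measurePreserving_eval (fun _ : Fin N => μ) i).quasiMeasurePreserving.ae hS
  obtain ⟨x, hxS, hxU⟩ : ∃ x, (∀ i, x i ∈ S) ∧ x ∉ U := by
    by_contra! hcon
    have : P Set.univ ≤ P U := measure_mono_ae (ae_mem.mono fun x hx _ => hcon x hx)
    exact measure_U_lt.not_ge (by rwa [measure_univ] at this)
  simp only [U, Set.mem_union, Set.mem_ofPred_eq, Set.mem_iUnion, not_or, not_exists, not_le,
    not_lt] at hxU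
  refine ⟨x, hxS, hxU.2, ?_⟩
  have card_lt := hxU.1
  rw [← ENNReal.ofReal_natCast] at card_lt
  exact ((ENNReal.ofReal_lt_ofReal_iff hT).1 card_lt).le

end Sampling

section Tuples

variable {d n : ℕ}

lemma measurable_uncurry_torus :
    Measurable fun (x : Fin n → Torus (Fin d)) (p : Fin n × Fin d) => x p.1 p.2 :=
  measurable_pi_lambda _ fun p =>
    (measurable_pi_apply p.2).comp ((WithLp.measurable_ofLp 2 _).comp (measurable_pi_apply p.1))

lemma measurable_tuple : Measurable (tuple : (Fin n → Torus (Fin d)) → Torus (Fin n × Fin d)) :=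
  (WithLp.measurable_toLp 2 _).comp measurable_uncurry_torus

lemma map_uncurry_pi_lebesgue :
    (Measure.pi fun _ : Fin n => lebesgue (Fin d)).map (fun x p => x p.1 p.2) =
      (volume : Measure (Fin n × Fin d → UnitAddCircle)) := by
  refine (Measure.pi_eq fun s hs => ?_).symm
  have preimage_eq : (fun (x : Fin n → Torus (Fin d)) (p : Fin n × Fin d) => x p.1 p.2) ⁻¹'
      Set.univ.pi s = Set.univ.pi fun i => WithLp.ofLp ⁻¹' Set.univ.pi fun j => s (i, j) := by
    ext x
    simp [Set.mem_pi]
  rw [Measure.map_apply measurable_uncurry_torus (MeasurableSet.univ_pi hs), preimage_eq,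
    Measure.pi_pi, Fintype.prod_prod_type]
  refine Finset.prod_congr rfl fun i _ => ?_
  have measurable_slice : MeasurableSet (Set.univ.pi fun j => s (i, j)) :=
    MeasurableSet.univ_pi fun j => hs (i, j)
  rw [lebesgue, Measure.map_apply (WithLp.measurable_toLp 2 _)
    (WithLp.measurable_ofLp 2 _ measurable_slice)]
  exact Measure.pi_pi _ _

lemma map_tuple_pi_lebesgue :
    (Measure.pi fun _ : Fin n => lebesgue (Fin d)).map tuple = lebesgue (Fin n × Fin d) := by
  conv_rhs => rw [lebesgue, ← map_uncurry_pi_lebesgue,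
    Measure.map_map (WithLp.measurable_toLp 2 _) measurable_uncurry_torus]
  rfl

lemma pi_preimage_tuple_le {μ : Measure (Torus (Fin d))} [IsFiniteMeasure μ] {K : ℝ≥0∞}
    (hK : K ≠ ∞) (h : μ ≤ K • lebesgue (Fin d)) {S : Set (Torus (Fin n × Fin d))}
    (hS : MeasurableSet S) :
    (Measure.pi fun _ : Fin n => μ) (tuple ⁻¹' S) ≤ K ^ n * lebesgue (Fin n × Fin d) S := by
  have pi_le := pi_le_pow_smul_pi (κ := Fin n) hK h (tuple ⁻¹' S)
  rw [Fintype.card_fin, Measure.smul_apply, smul_eq_mul] at pi_le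
  rwa [← map_tuple_pi_lebesgue, Measure.map_apply measurable_tuple hS]

end Tuples

section Support

variable {d : ℕ} (μ₁ : Measure (Torus (Fin d)))

lemma integrable_continuous {V : Type*} [NormedAddCommGroup V] (μ : Measure (Torus (Fin d)))
    [IsFiniteMeasure μ] {g : Torus (Fin d) → V} (hg : Continuous g) : Integrable g μ :=
  hg.integrable_of_hasCompactSupport (HasCompactSupport.of_compactSpace _)

lemma exists_norm_integral_trigPolynomial_sub_le [IsFiniteMeasure μ₁]
    {p : C(UnitAddTorus (Fin d), ℂ)}
    (hp : p ∈ Submodule.span ℂ (Set.range (UnitAddTorus.mFourier (d := Fin d)))) :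
    ∃ C : ℝ, 0 ≤ C ∧ ∀ (δ : ℝ) (μ : Measure (Torus (Fin d))) [IsFiniteMeasure μ],
      (∀ ξ, ‖fourierCoeff μ ξ - fourierCoeff μ₁ ξ‖ ≤ δ) →
      ‖∫ x, p (WithLp.ofLp x) ∂μ - ∫ x, p (WithLp.ofLp x) ∂μ₁‖ ≤ C * δ := by
  have integrable_comp (q : C(UnitAddTorus (Fin d), ℂ)) (μ : Measure (Torus (Fin d)))
      [IsFiniteMeasure μ] : Integrable (fun x : Torus (Fin d) => q (WithLp.ofLp x)) μ :=
    integrable_continuous μ (q.continuous.comp (PiLp.continuous_ofLp 2 _))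
  induction hp using Submodule.span_induction with
  | mem q hq =>
    obtain ⟨ξ, rfl⟩ := hq
    refine ⟨1, zero_le_one, fun δ μ _ h => ?_⟩
    simpa only [fourierCoeff, neg_neg, one_mul] using h (-ξ)
  | zero => exact ⟨0, le_rfl, fun δ μ _ _ => by simp⟩
  | add p q _ _ hp hq =>
    obtain ⟨C₁, hC₁, hp⟩ := hp
    obtain ⟨C₂, hC₂, hq⟩ := hq
    refine ⟨C₁ + C₂, by positivity, fun δ μ _ h => ?_⟩
    simp only [ContinuousMap.add_apply]
    rw [integral_add (integrable_comp p μ) (integrable_comp q μ),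
      integral_add (integrable_comp p μ₁) (integrable_comp q μ₁), add_sub_add_comm, add_mul]
    exact (norm_add_le _ _).trans (add_le_add (hp δ μ h) (hq δ μ h))
  | smul a p _ hp =>
    obtain ⟨C, hC, hp⟩ := hp
    refine ⟨‖a‖ * C, by positivity, fun δ μ _ h => ?_⟩
    simp only [ContinuousMap.smul_apply]
    rw [integral_smul, integral_smul, ← smul_sub, norm_smul, mul_assoc]
    exact mul_le_mul_of_nonneg_left (hp δ μ h) (norm_nonneg _)

variable [IsProbabilityMeasure μ₁] {ε : ℝ}

lemma norm_integral_comp_ofLp_sub_le {p q : C(UnitAddTorus (Fin d), ℂ)} (h : dist p q ≤ ε) :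
    ‖∫ x, p (WithLp.ofLp x) ∂μ₁ - ∫ x, q (WithLp.ofLp x) ∂μ₁‖ ≤ ε := by
  have integrable_comp (q : C(UnitAddTorus (Fin d), ℂ)) :
      Integrable (fun x : Torus (Fin d) => q (WithLp.ofLp x)) μ₁ :=
    integrable_continuous μ₁ (q.continuous.comp (PiLp.continuous_ofLp 2 _))
  rw [← integral_sub (integrable_comp p) (integrable_comp q)]
  have norm_sub_le (x : Torus (Fin d)) : ‖p (WithLp.ofLp x) - q (WithLp.ofLp x)‖ ≤ ε := by
    rw [← dist_eq_norm]
    exact (ContinuousMap.dist_apply_le_dist _).trans h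
  simpa using norm_integral_le_of_norm_le_const (μ := μ₁) (.of_forall norm_sub_le)

lemma exists_norm_integral_sub_le_of_fourierCoeff (g : C(UnitAddTorus (Fin d), ℂ)) (hε : 0 < ε) :
    ∃ δ : ℝ, 0 < δ ∧ ∀ (μ : Measure (Torus (Fin d))) [IsProbabilityMeasure μ],
      (∀ ξ, ‖fourierCoeff μ ξ - fourierCoeff μ₁ ξ‖ ≤ δ) →
      ‖∫ x, g (WithLp.ofLp x) ∂μ - ∫ x, g (WithLp.ofLp x) ∂μ₁‖ ≤ ε := by
  have mem_closure : g ∈ closure (Submodule.span ℂ (Set.range (UnitAddTorus.mFourier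
      (d := Fin d))) : Set C(UnitAddTorus (Fin d), ℂ)) := by
    rw [← Submodule.topologicalClosure_coe, UnitAddTorus.span_mFourier_closure_eq_top]
    trivial
  obtain ⟨p, hp, hgp⟩ := Metric.mem_closure_iff.1 mem_closure (ε / 3) (by positivity)
  obtain ⟨C, hC, integral_sub_le⟩ := exists_norm_integral_trigPolynomial_sub_le μ₁ hp
  refine ⟨ε / (3 * (C + 1)), by positivity, fun μ _ hμ => ?_⟩
  have C_mul_le : C * (ε / (3 * (C + 1))) ≤ ε / 3 := by
    rw [← mul_div_assoc, div_le_div_iff₀ (by positivity) (by positivity)]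
    nlinarith
  calc ‖∫ x, g (WithLp.ofLp x) ∂μ - ∫ x, g (WithLp.ofLp x) ∂μ₁‖
      ≤ ‖∫ x, g (WithLp.ofLp x) ∂μ - ∫ x, p (WithLp.ofLp x) ∂μ‖ +
          ‖∫ x, p (WithLp.ofLp x) ∂μ - ∫ x, p (WithLp.ofLp x) ∂μ₁‖ +
          ‖∫ x, p (WithLp.ofLp x) ∂μ₁ - ∫ x, g (WithLp.ofLp x) ∂μ₁‖ := by
        simpa only [dist_eq_norm] using dist_triangle4 (∫ x, g (WithLp.ofLp x) ∂μ)
          (∫ x, p (WithLp.ofLp x) ∂μ) (∫ x, p (WithLp.ofLp x) ∂μ₁) (∫ x, g (WithLp.ofLp x) ∂μ₁)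
    _ ≤ ε / 3 + C * (ε / (3 * (C + 1))) + ε / 3 :=
        add_le_add_three (norm_integral_comp_ofLp_sub_le μ hgp.le) (integral_sub_le _ μ hμ)
          (norm_integral_comp_ofLp_sub_le μ₁ (dist_comm g p ▸ hgp.le))
    _ ≤ ε := by linarith

lemma exists_tolerance_ball (y : Torus (Fin d)) (hε : 0 < ε) (h : 0 < μ₁ (Metric.ball y ε)) :
    ∃ δ : ℝ, 0 < δ ∧ ∀ (μ : Measure (Torus (Fin d))) [IsProbabilityMeasure μ],
      (∀ ξ, ‖fourierCoeff μ ξ - fourierCoeff μ₁ ξ‖ ≤ δ) → 0 < μ (Metric.ball y (2 * ε)) := by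
  let tent : Torus (Fin d) → ℝ := fun x => max 0 (2 * ε - dist x y)
  have continuous_tent : Continuous tent := by fun_prop
  have integral_tent_pos : 0 < ∫ x, tent x ∂μ₁ := by
    refine (integral_pos_iff_support_of_nonneg (f := tent) (fun x => le_max_left _ _)
      (integrable_continuous μ₁ continuous_tent)).2 (h.trans_le (measure_mono fun x hx => ?_))
    have := Metric.mem_ball.1 hx
    exact (lt_max_of_lt_right (by linarith)).ne'
  let tentC : C(UnitAddTorus (Fin d), ℂ) :=
    ⟨fun x => (tent (WithLp.toLp 2 x) : ℂ),
      Complex.continuous_ofReal.comp (continuous_tent.comp (PiLp.continuous_toLp 2 _))⟩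
  have integral_tentC (μ : Measure (Torus (Fin d))) :
      ∫ x, tentC (WithLp.ofLp x) ∂μ = ((∫ x, tent x ∂μ : ℝ) : ℂ) :=
    integral_complex_ofReal (f := tent)
  obtain ⟨δ, hδ, hμ₁⟩ :=
    exists_norm_integral_sub_le_of_fourierCoeff μ₁ tentC (half_pos integral_tent_pos)
  refine ⟨δ, hδ, fun μ _ hμ => ?_⟩
  rw [pos_iff_ne_zero]
  intro ball_eq_zero
  have integral_tent_eq_zero : ∫ x, tent x ∂μ = 0 := by
    refine integral_eq_zero_of_ae ?_
    filter_upwards [measure_eq_zero_iff_ae_notMem.1 ball_eq_zero] with x hx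
    rw [Metric.mem_ball, not_lt] at hx
    exact max_eq_left (by linarith)
  have norm_le := hμ₁ μ hμ
  rw [integral_tentC, integral_tentC, integral_tent_eq_zero, ← Complex.ofReal_sub,
    Complex.norm_real, zero_sub, norm_neg, Real.norm_of_nonneg integral_tent_pos.le] at norm_le
  linarith

lemma exists_tolerance_support {E : Set (Torus (Fin d))} (hE : IsCompact E) (hε : 0 < ε)
    (h : ∀ y ∈ E, 0 < μ₁ (Metric.ball y ε)) :
    ∃ δ : ℝ, 0 < δ ∧ ∀ (μ : Measure (Torus (Fin d))) [IsProbabilityMeasure μ],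
      (∀ ξ, ‖fourierCoeff μ ξ - fourierCoeff μ₁ ξ‖ ≤ δ) →
      ∀ y ∈ E, ∃ z ∈ μ.support, dist y z < 3 * ε := by
  choose! δ hδ0 hδ using fun y (hy : y ∈ E) => exists_tolerance_ball μ₁ y hε (h y hy)
  obtain ⟨F, hF, hcov⟩ := hE.elim_nhds_subcover (fun y => Metric.ball y ε)
    (fun y _ => Metric.ball_mem_nhds y hε)
  obtain ⟨δ₀, hδ₀, hδ₀F⟩ : ∃ δ₀ : ℝ, 0 < δ₀ ∧ ∀ y ∈ F, δ₀ ≤ δ y := by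
    rcases F.eq_empty_or_nonempty with rfl | hne
    · exact ⟨1, one_pos, by simp⟩
    · obtain ⟨y, hy, hmin⟩ := F.exists_min_image δ hne
      exact ⟨δ y, hδ0 y (hF y hy), hmin⟩
  refine ⟨δ₀, hδ₀, fun μ _ hμ y hy => ?_⟩
  obtain ⟨i, hi, hyi⟩ := Set.mem_iUnion₂.1 (hcov hy)
  obtain ⟨z, hz, hzs⟩ := Measure.nonempty_inter_support_of_pos <|
    hδ i (hF i hi) μ fun ξ => (hμ ξ).trans (hδ₀F i hi)
  refine ⟨z, hzs, ?_⟩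
  calc dist y z ≤ dist y i + dist i z := dist_triangle y i z
    _ < ε + 2 * ε := add_lt_add (Metric.mem_ball.1 hyi) (Metric.mem_ball'.1 hz)
    _ = 3 * ε := by ring

end Support

section Estimates

variable {d : ℕ}

lemma IsMollifier.norm_mul_rpow_le {ψ : Measure (Torus (Fin d))} {C r s : ℝ}
    (h : IsMollifier ψ C r) (hr : 0 < r) (hC : 0 ≤ C) (hs : 0 ≤ s) (hsd : s ≤ d)
    {ξ : Fin d → ℤ} (hξ : ξ ≠ 0) :
    ‖fourierCoeff ψ ξ‖ * (r * freqNorm ξ) ^ (s / 2) ≤ 1 + C := by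
  have := h.isProbabilityMeasure
  have freq_pos := freqNorm_pos hξ
  rcases le_or_gt (r * freqNorm ξ) 1 with low | high
  · have rpow_le : (r * freqNorm ξ) ^ (s / 2) ≤ 1 :=
      Real.rpow_le_one (by positivity) low (by linarith)
    have := mul_le_one₀ (norm_fourierCoeff_le_one ψ ξ) (by positivity) rpow_le
    linarith
  · have rpow_le : (r * freqNorm ξ) ^ (s / 2) ≤ (r * freqNorm ξ) ^ (d + 1) := by
      rw [← Real.rpow_natCast]
      refine Real.rpow_le_rpow_of_exponent_le high.le ?_
      push_cast
      linarith
    calc ‖fourierCoeff ψ ξ‖ * (r * freqNorm ξ) ^ (s / 2)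
        ≤ C / (r * freqNorm ξ) ^ (d + 1) * (r * freqNorm ξ) ^ (d + 1) := by
          gcongr
          exact h.norm_fourierCoeff_le ξ hξ
      _ = C := by field_simp
      _ ≤ 1 + C := by linarith

lemma HasFastDecay.norm_mul_rpow_le_of_le {μ : Measure (Torus (Fin d))} {C s Q : ℝ}
    (hμ : HasFastDecay μ C) (hsd : s ≤ d) (hQ : 0 < Q) {ξ : Fin d → ℤ} (hξ : ξ ≠ 0)
    (hQξ : Q ≤ freqNorm ξ) :
    ‖fourierCoeff μ ξ‖ * freqNorm ξ ^ (s / 2) ≤ C * Q ^ (-(((d : ℝ) + 1) / 2)) := by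
  have freq_pos := freqNorm_pos hξ
  have C_nonneg : 0 ≤ C := by
    simpa [freq_pos.ne'] using mul_nonneg ((norm_nonneg _).trans (hμ ξ hξ))
      (pow_nonneg freq_pos.le (d + 1))
  have rpow_le : freqNorm ξ ^ (s / 2) / freqNorm ξ ^ (d + 1) ≤ Q ^ (-(((d : ℝ) + 1) / 2)) := by
    rw [← Real.rpow_natCast, ← Real.rpow_sub freq_pos]
    calc freqNorm ξ ^ (s / 2 - ((d + 1 : ℕ) : ℝ))
        ≤ freqNorm ξ ^ (-(((d : ℝ) + 1) / 2)) := by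
          refine Real.rpow_le_rpow_of_exponent_le (one_le_freqNorm hξ) ?_
          push_cast
          linarith
      _ ≤ Q ^ (-(((d : ℝ) + 1) / 2)) :=
          Real.rpow_le_rpow_of_nonpos hQ hQξ (neg_nonpos.2 (by positivity))
  calc ‖fourierCoeff μ ξ‖ * freqNorm ξ ^ (s / 2)
      ≤ C / freqNorm ξ ^ (d + 1) * freqNorm ξ ^ (s / 2) := by
        gcongr
        exact hμ ξ hξ
    _ = C * (freqNorm ξ ^ (s / 2) / freqNorm ξ ^ (d + 1)) := by ring
    _ ≤ C * Q ^ (-(((d : ℝ) + 1) / 2)) := by gcongr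

lemma norm_fourierCoeff_sub_one_mul_rpow_le {ψ μ : Measure (Torus (Fin d))}
    [IsProbabilityMeasure ψ] {r s C : ℝ} (hψ : ∀ᵐ x ∂ψ, ‖x‖ ≤ r) (hμ : HasFastDecay μ C)
    (hr : 0 ≤ r) (hsd : s ≤ d) {ξ : Fin d → ℤ} (hξ : ξ ≠ 0) :
    ‖fourierCoeff ψ ξ - 1‖ * ‖fourierCoeff μ ξ‖ * freqNorm ξ ^ (s / 2) ≤
      2 * Real.pi * C * r := by
  have freq_pos := freqNorm_pos hξ
  have := (norm_nonneg _).trans (hμ ξ hξ)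
  calc ‖fourierCoeff ψ ξ - 1‖ * ‖fourierCoeff μ ξ‖ * freqNorm ξ ^ (s / 2)
      ≤ (2 * Real.pi * freqNorm ξ * r) * (C / freqNorm ξ ^ (d + 1)) * freqNorm ξ ^ d := by
        gcongr
        · exact norm_fourierCoeff_sub_one_le hψ ξ
        · exact hμ ξ hξ
        · exact freqNorm_rpow_le_pow hsd hξ
    _ = 2 * Real.pi * C * r := by
        rw [pow_succ]
        field_simp

lemma IsMollifier.norm_mul_norm_sub_mul_rpow_le {μ₁ ν ψ : Measure (Torus (Fin d))}
    [IsProbabilityMeasure μ₁] [IsProbabilityMeasure ν] {r s τ Q C₀ : ℝ} (hψ : IsMollifier ψ C₀ r)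
    (hr : 0 < r) (hC₀ : 0 ≤ C₀) (hs : 0 ≤ s) (hsd : s ≤ d) (hτ : 0 ≤ τ) (hQ : 0 < Q)
    (hν : ∀ ξ, freqNorm ξ ≤ Q → ‖fourierCoeff ν ξ - fourierCoeff μ₁ ξ‖ ≤ τ)
    {ξ : Fin d → ℤ} (hξ : ξ ≠ 0) :
    ‖fourierCoeff ψ ξ‖ * ‖fourierCoeff ν ξ - fourierCoeff μ₁ ξ‖ * freqNorm ξ ^ (s / 2) ≤
      τ * (1 + C₀) * r ^ (-(s / 2)) +
        2 * (C₀ / r ^ (d + 1)) * Q ^ (-(((d : ℝ) + 1) / 2)) := by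
  have := hψ.isProbabilityMeasure
  have freq_pos := freqNorm_pos hξ
  rcases le_or_gt (freqNorm ξ) Q with low | high
  · have rpow_eq : freqNorm ξ ^ (s / 2) = (r * freqNorm ξ) ^ (s / 2) * r ^ (-(s / 2)) := by
      rw [Real.mul_rpow hr.le freq_pos.le, Real.rpow_neg hr.le]
      field_simp
    refine le_add_of_le_of_nonneg ?_ (by positivity)
    calc ‖fourierCoeff ψ ξ‖ * ‖fourierCoeff ν ξ - fourierCoeff μ₁ ξ‖ * freqNorm ξ ^ (s / 2)
        = ‖fourierCoeff ν ξ - fourierCoeff μ₁ ξ‖ *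
            (‖fourierCoeff ψ ξ‖ * (r * freqNorm ξ) ^ (s / 2)) * r ^ (-(s / 2)) := by
          rw [rpow_eq]
          ring
      _ ≤ τ * (1 + C₀) * r ^ (-(s / 2)) := by
          gcongr
          · exact hν ξ low
          · exact hψ.norm_mul_rpow_le hr hC₀ hs hsd hξ
  · refine le_add_of_nonneg_of_le (by positivity) ?_
    calc ‖fourierCoeff ψ ξ‖ * ‖fourierCoeff ν ξ - fourierCoeff μ₁ ξ‖ * freqNorm ξ ^ (s / 2)
        = ‖fourierCoeff ν ξ - fourierCoeff μ₁ ξ‖ *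
            (‖fourierCoeff ψ ξ‖ * freqNorm ξ ^ (s / 2)) := by ring
      _ ≤ 2 * (C₀ / r ^ (d + 1) * Q ^ (-(((d : ℝ) + 1) / 2))) := by
          exact mul_le_mul (norm_fourierCoeff_sub_le_two ν μ₁ ξ)
            (hψ.hasFastDecay.norm_mul_rpow_le_of_le hsd hQ hξ high.le) (by positivity)
            two_pos.le
      _ = 2 * (C₀ / r ^ (d + 1)) * Q ^ (-(((d : ℝ) + 1) / 2)) := by ring

/-- A bound for `‖ν ∗ ψ - μ₁‖_{M(s)}` when `ψ` is a mollifier of scale `r` with constant `C₀`, `μ₁`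
decays fast with constant `C₁`, and the Fourier coefficients of `ν` and `μ₁` differ by at most `τ`
at the frequencies of length at most `Q`. The three terms account for the frequencies below `Q`,
for those above `Q`, and for the smoothing of `μ₁`. -/
def mollifiedError (d : ℕ) (s C₀ C₁ τ Q r : ℝ) : ℝ :=
  τ * (1 + C₀) * r ^ (-(s / 2)) + 2 * (C₀ / r ^ (d + 1)) * Q ^ (-(((d : ℝ) + 1) / 2)) +
    2 * Real.pi * C₁ * r

lemma IsMollifier.decayNorm_conv_sub_le {μ₁ ν ψ : Measure (Torus (Fin d))}
    [IsProbabilityMeasure μ₁] [IsProbabilityMeasure ν] {r s τ Q C₀ C₁ : ℝ}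
    (hψ : IsMollifier ψ C₀ r) (hr : 0 < r) (hC₀ : 0 ≤ C₀) (hs : 0 ≤ s) (hsd : s ≤ d)
    (hτ : 0 ≤ τ) (hQ : 0 < Q) (hμ₁ : HasFastDecay μ₁ C₁)
    (hν : ∀ ξ, freqNorm ξ ≤ Q → ‖fourierCoeff ν ξ - fourierCoeff μ₁ ξ‖ ≤ τ) :
    decayNorm s (fourierCoeff (ν ∗ ψ) - fourierCoeff μ₁) ≤
      ENNReal.ofReal (mollifiedError d s C₀ C₁ τ Q r) := by
  have := hψ.isProbabilityMeasure
  refine decayNorm_le_ofReal (by simp [fourierCoeff_zero]) fun ξ hξ => ?_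
  have freq_pos := freqNorm_pos hξ
  have main_term := hψ.norm_mul_norm_sub_mul_rpow_le hr hC₀ hs hsd hτ hQ hν hξ
  have smoothing_term := norm_fourierCoeff_sub_one_mul_rpow_le hψ.ae_norm_le hμ₁ hr.le hsd hξ
  have split : (fourierCoeff (ν ∗ ψ) - fourierCoeff μ₁) ξ =
      fourierCoeff ψ ξ * (fourierCoeff ν ξ - fourierCoeff μ₁ ξ) +
        (fourierCoeff ψ ξ - 1) * fourierCoeff μ₁ ξ := by
    rw [Pi.sub_apply, fourierCoeff_conv]
    ring
  calc ‖(fourierCoeff (ν ∗ ψ) - fourierCoeff μ₁) ξ‖ * freqNorm ξ ^ (s / 2)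
      ≤ (‖fourierCoeff ψ ξ‖ * ‖fourierCoeff ν ξ - fourierCoeff μ₁ ξ‖ +
          ‖fourierCoeff ψ ξ - 1‖ * ‖fourierCoeff μ₁ ξ‖) * freqNorm ξ ^ (s / 2) := by
        gcongr
        rw [split, ← norm_mul, ← norm_mul]
        exact norm_add_le _ _
    _ ≤ mollifiedError d s C₀ C₁ τ Q r := by
        rw [add_mul, mollifiedError]
        exact add_le_add main_term smoothing_term

lemma dist_tuple_sq {n : ℕ} (z w : Fin n → Torus (Fin d)) :
    dist (tuple z) (tuple w) ^ 2 = ∑ i, dist (z i) (w i) ^ 2 := by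
  rw [PiLp.dist_eq_of_L2, Real.sq_sqrt (Finset.sum_nonneg fun _ _ => sq_nonneg _),
    Fintype.sum_prod_type]
  refine Finset.sum_congr rfl fun i _ => ?_
  rw [PiLp.dist_eq_of_L2, Real.sq_sqrt (Finset.sum_nonneg fun _ _ => sq_nonneg _)]
  rfl

lemma dist_tuple_le {n : ℕ} {z w : Fin n → Torus (Fin d)} {δ : ℝ} (hδ : 0 ≤ δ)
    (h : ∀ i, dist (z i) (w i) ≤ δ) : dist (tuple z) (tuple w) ≤ n * δ := by
  refine le_of_sq_le_sq ?_ (by positivity)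
  calc dist (tuple z) (tuple w) ^ 2 = ∑ i, dist (z i) (w i) ^ 2 := dist_tuple_sq z w
    _ ≤ (∑ i, dist (z i) (w i)) ^ 2 :=
        Finset.sum_sq_le_sq_sum_of_nonneg fun i _ => dist_nonneg
    _ ≤ (n * δ) ^ 2 := by
        gcongr
        simpa using Finset.sum_le_sum fun i (_ : i ∈ Finset.univ) => h i

end Estimates

section Minkowski

lemma frequently_lebesgue_thickening_le {ι : Type} [Fintype ι] {Z : Set (Torus ι)} {α ε : ℝ}
    (hZ : lowerMinkowskiDim Z ≤ (α : EReal)) (hε : 0 < ε) :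
    ∃ᶠ ρ in 𝓝[>] (0 : ℝ), lebesgue ι (Metric.thickening ρ Z) ≤
      ENNReal.ofReal (ρ ^ ((Fintype.card ι : ℝ) - α - ε)) := by
  have dim_lt : lowerMinkowskiDim Z < ((α + ε : ℝ) : EReal) :=
    hZ.trans_lt (by exact_mod_cast lt_add_of_pos_right α hε)
  have frequently_lt := Filter.frequently_lt_of_liminf_lt (by isBoundedDefault) dim_lt
  refine (frequently_lt.and_eventually (Ioo_mem_nhdsGT one_pos)).mono fun ρ ⟨hρ, hρ0, hρ1⟩ => ?_
  by_cases null : lebesgue ι (Metric.thickening ρ Z) = 0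
  · simp [null]
  obtain ⟨v, v_pos, hv⟩ :
      ∃ v : ℝ, 0 < v ∧ lebesgue ι (Metric.thickening ρ Z) = ENNReal.ofReal v :=
    ⟨_, ENNReal.toReal_pos null (measure_ne_top _ _), (ENNReal.ofReal_toReal
      (measure_ne_top _ _)).symm⟩
  rw [hv, ENNReal.log_ofReal_of_pos v_pos, ← EReal.coe_div, ← EReal.coe_sub,
    EReal.coe_lt_coe_iff] at hρ
  have exponent_lt : (Fintype.card ι : ℝ) - α - ε < Real.log v / Real.log ρ := by linarith
  rw [lt_div_iff_of_neg (Real.log_neg hρ0 hρ1)] at exponent_lt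
  rw [hv]
  refine ENNReal.ofReal_le_ofReal ?_
  rw [← Real.log_le_log_iff v_pos (Real.rpow_pos_of_pos hρ0 _), Real.log_rpow hρ0]
  exact exponent_lt.le

end Minkowski

section Parameters

lemma tendsto_const_mul_rpow_nhdsGT (c : ℝ) {e : ℝ} (he : 0 < e) :
    Filter.Tendsto (fun ρ : ℝ => c * ρ ^ e) (𝓝[>] 0) (𝓝 0) := by
  have continuousAt_rpow := (Real.continuousAt_rpow_const 0 e (Or.inr he.le)).tendsto
  rw [Real.zero_rpow he.ne'] at continuousAt_rpow
  simpa using (continuousAt_rpow.mono_left nhdsWithin_le_nhds).const_mul c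

lemma tendsto_const_mul_rpow_neg_mul_exp_nhdsGT (c k : ℝ) {g : ℝ} (hg : 0 < g) :
    Filter.Tendsto (fun ρ : ℝ => c * ρ ^ (-k) * Real.exp (-ρ ^ (-g) / 8)) (𝓝[>] 0) (𝓝 0) := by
  have decay := ((tendsto_rpow_mul_exp_neg_mul_atTop_nhds_zero (k / g) (1 / 8) (by norm_num)).comp
    (tendsto_rpow_neg_nhdsGT_zero (neg_neg_of_pos hg))).const_mul c
  rw [mul_zero] at decay
  refine decay.congr' ?_
  filter_upwards [self_mem_nhdsWithin] with ρ hρ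
  simp only [Function.comp_apply]
  rw [← Real.rpow_mul (Set.mem_Ioi.1 hρ).le, mul_assoc]
  congr 3
  · field_simp
  · ring_nf

lemma ceil_rpow_neg_le {ρ b : ℝ} (hρ : ρ ∈ Set.Ioo (0 : ℝ) 1) (hb : 0 ≤ b) :
    (⌈ρ ^ (-b)⌉₊ : ℝ) ≤ 2 * ρ ^ (-b) := by
  have one_le_rpow : 1 ≤ ρ ^ (-b) :=
    Real.one_le_rpow_of_pos_of_le_one_of_nonpos hρ.1 hρ.2.le (neg_nonpos.2 hb)
  have := Nat.ceil_lt_add_one (zero_le_one.trans one_le_rpow)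
  linarith

lemma eventually_ceil_mul_rpow_le {b t γ : ℝ} (hb : 0 ≤ b) (hbt : b < t) (hγ : 0 < γ) :
    ∀ᶠ ρ : ℝ in 𝓝[>] 0, ⌈ρ ^ (-b)⌉₊ * ρ ^ t ≤ γ := by
  filter_upwards [(tendsto_const_mul_rpow_nhdsGT 2 (sub_pos.2 hbt)).eventually_le_const hγ,
    Ioo_mem_nhdsGT one_pos] with ρ small hρ
  have rpow_nonneg := Real.rpow_nonneg hρ.1.le t
  calc ⌈ρ ^ (-b)⌉₊ * ρ ^ t ≤ 2 * ρ ^ (-b) * ρ ^ t := by gcongr; exact ceil_rpow_neg_le hρ hb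
    _ = 2 * ρ ^ (t - b) := by rw [mul_assoc, ← Real.rpow_add hρ.1, neg_add_eq_sub]
    _ ≤ γ := small

lemma eventually_ceil_pow_mul_le {n : ℕ} {b κ e K : ℝ} (hb : 0 ≤ b) (hK : 0 ≤ K)
    (he : b * (n - 1) + κ < e) :
    ∀ᶠ ρ : ℝ in 𝓝[>] 0, (⌈ρ ^ (-b)⌉₊ : ℝ) ^ n * (K * ρ ^ e) ≤ ⌈ρ ^ (-b)⌉₊ * ρ ^ κ / 2 := by
  filter_upwards [(tendsto_const_mul_rpow_nhdsGT (2 ^ n * K) (sub_pos.2 he)).eventually_le_const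
    one_half_pos, Ioo_mem_nhdsGT one_pos] with ρ small hρ
  have rpow_e := Real.rpow_nonneg hρ.1.le e
  have rpow_κ := Real.rpow_nonneg hρ.1.le κ
  have rpow_b := Real.rpow_nonneg hρ.1.le (-b)
  have rpow_eq : (ρ ^ (-b)) ^ n * ρ ^ e = ρ ^ (e - (b * (n - 1) + κ)) * (ρ ^ (-b) * ρ ^ κ) := by
    rw [← Real.rpow_natCast, ← Real.rpow_mul hρ.1.le, ← Real.rpow_add hρ.1, ← Real.rpow_add hρ.1,
      ← Real.rpow_add hρ.1]
    congr 1
    ring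
  calc (⌈ρ ^ (-b)⌉₊ : ℝ) ^ n * (K * ρ ^ e) ≤ (2 * ρ ^ (-b)) ^ n * (K * ρ ^ e) := by
        gcongr
        exact ceil_rpow_neg_le hρ hb
    _ = 2 ^ n * K * ((ρ ^ (-b)) ^ n * ρ ^ e) := by ring
    _ = 2 ^ n * K * ρ ^ (e - (b * (n - 1) + κ)) * (ρ ^ (-b) * ρ ^ κ) := by
        rw [rpow_eq, mul_assoc (2 ^ n * K)]
    _ ≤ 1 / 2 * (⌈ρ ^ (-b)⌉₊ * ρ ^ κ) := by
        gcongr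
        exact Nat.le_ceil _
    _ = ⌈ρ ^ (-b)⌉₊ * ρ ^ κ / 2 := by ring

lemma eventually_exp_lt_half (d : ℕ) {b κ : ℝ} (h : 2 * κ < b) :
    ∀ᶠ ρ : ℝ in 𝓝[>] 0, 4 * (2 * (⌈ρ ^ (-4 : ℝ)⌉₊ : ℝ) + 1) ^ d *
      Real.exp (-(⌈ρ ^ (-b)⌉₊ * (ρ ^ κ) ^ 2) / 8) < 1 / 2 := by
  filter_upwards [(tendsto_const_mul_rpow_neg_mul_exp_nhdsGT (4 * 5 ^ d) (4 * d)
    (sub_pos.2 h)).eventually_lt_const one_half_pos, Ioo_mem_nhdsGT one_pos] with ρ small hρ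
  have rpow_nonneg := Real.rpow_nonneg hρ.1.le (-(4 * (d : ℝ)))
  refine lt_of_le_of_lt ?_ small
  have one_le_rpow : 1 ≤ ρ ^ (-4 : ℝ) :=
    Real.one_le_rpow_of_pos_of_le_one_of_nonpos hρ.1 hρ.2.le (by norm_num)
  have count_le : (2 * (⌈ρ ^ (-4 : ℝ)⌉₊ : ℝ) + 1) ^ d ≤ 5 ^ d * ρ ^ (-(4 * (d : ℝ))) := by
    calc (2 * (⌈ρ ^ (-4 : ℝ)⌉₊ : ℝ) + 1) ^ d ≤ (5 * ρ ^ (-4 : ℝ)) ^ d := by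
          gcongr
          linarith [ceil_rpow_neg_le hρ (b := 4) (by norm_num)]
      _ = 5 ^ d * ρ ^ (-(4 * (d : ℝ))) := by
          rw [mul_pow, ← Real.rpow_natCast (ρ ^ (-4 : ℝ)), ← Real.rpow_mul hρ.1.le, neg_mul]
  have le_exponent : ρ ^ (-(b - 2 * κ)) ≤ ⌈ρ ^ (-b)⌉₊ * (ρ ^ κ) ^ 2 := by
    calc ρ ^ (-(b - 2 * κ)) = ρ ^ (-b) * (ρ ^ κ) ^ 2 := by
          rw [← Real.rpow_natCast (ρ ^ κ), ← Real.rpow_mul hρ.1.le, ← Real.rpow_add hρ.1]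
          congr 1
          push_cast
          ring
      _ ≤ ⌈ρ ^ (-b)⌉₊ * (ρ ^ κ) ^ 2 := by
          gcongr
          exact Nat.le_ceil _
  calc 4 * (2 * (⌈ρ ^ (-4 : ℝ)⌉₊ : ℝ) + 1) ^ d *
        Real.exp (-(⌈ρ ^ (-b)⌉₊ * (ρ ^ κ) ^ 2) / 8)
      ≤ 4 * (5 ^ d * ρ ^ (-(4 * (d : ℝ)))) * Real.exp (-ρ ^ (-(b - 2 * κ)) / 8) := by gcongr
    _ = 4 * 5 ^ d * ρ ^ (-(4 * (d : ℝ))) * Real.exp (-ρ ^ (-(b - 2 * κ)) / 8) := by ring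

lemma mollifiedError_le {d : ℕ} {s κ C₀ C₁ ρ a : ℝ} (hC₀ : 0 ≤ C₀) (hρ : 0 < ρ) (ha : 0 < a) :
    mollifiedError d s C₀ C₁ (3 * ρ ^ κ) ⌈ρ ^ (-4 : ℝ)⌉₊ (ρ / a) ≤
      3 * (1 + C₀) * a ^ (s / 2) * ρ ^ (κ - s / 2) +
        2 * C₀ * a ^ (d + 1) * ρ ^ ((d : ℝ) + 1) + 2 * Real.pi * C₁ / a * ρ ^ (1 : ℝ) := by
  have low : 3 * ρ ^ κ * (1 + C₀) * (ρ / a) ^ (-(s / 2)) =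
      3 * (1 + C₀) * a ^ (s / 2) * ρ ^ (κ - s / 2) := by
    rw [Real.div_rpow hρ.le ha.le, Real.rpow_neg ha.le, div_inv_eq_mul, sub_eq_add_neg,
      Real.rpow_add hρ]
    ring
  have cutoff_le : (⌈ρ ^ (-4 : ℝ)⌉₊ : ℝ) ^ (-(((d : ℝ) + 1) / 2)) ≤
      ρ ^ (d + 1) * ρ ^ ((d : ℝ) + 1) := by
    calc (⌈ρ ^ (-4 : ℝ)⌉₊ : ℝ) ^ (-(((d : ℝ) + 1) / 2))
        ≤ (ρ ^ (-4 : ℝ)) ^ (-(((d : ℝ) + 1) / 2)) := by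
          refine Real.rpow_le_rpow_of_nonpos (Real.rpow_pos_of_pos hρ _) (Nat.le_ceil _) ?_
          exact neg_nonpos.2 (by positivity)
      _ = ρ ^ (d + 1) * ρ ^ ((d : ℝ) + 1) := by
          rw [← Real.rpow_natCast, ← Real.rpow_mul hρ.le, ← Real.rpow_add hρ]
          congr 1
          push_cast
          ring
  have high : 2 * (C₀ / (ρ / a) ^ (d + 1)) * (⌈ρ ^ (-4 : ℝ)⌉₊ : ℝ) ^ (-(((d : ℝ) + 1) / 2)) ≤
      2 * C₀ * a ^ (d + 1) * ρ ^ ((d : ℝ) + 1) := by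
    calc 2 * (C₀ / (ρ / a) ^ (d + 1)) * (⌈ρ ^ (-4 : ℝ)⌉₊ : ℝ) ^ (-(((d : ℝ) + 1) / 2))
        ≤ 2 * (C₀ / (ρ / a) ^ (d + 1)) * (ρ ^ (d + 1) * ρ ^ ((d : ℝ) + 1)) := by gcongr
      _ = 2 * C₀ * a ^ (d + 1) * ρ ^ ((d : ℝ) + 1) := by
          rw [div_pow]
          field_simp
  have smoothing : 2 * Real.pi * C₁ * (ρ / a) = 2 * Real.pi * C₁ / a * ρ ^ (1 : ℝ) := by
    rw [Real.rpow_one]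
    ring
  rw [mollifiedError, low, smoothing]
  gcongr

lemma eventually_mollifiedError_le (d : ℕ) {s κ C₀ a ε : ℝ} (C₁ : ℝ) (hsκ : s / 2 < κ)
    (hC₀ : 0 ≤ C₀) (ha : 0 < a) (hε : 0 < ε) :
    ∀ᶠ ρ : ℝ in 𝓝[>] 0,
      mollifiedError d s C₀ C₁ (3 * ρ ^ κ) ⌈ρ ^ (-4 : ℝ)⌉₊ (ρ / a) ≤ ε := by
  have bound_tendsto := ((tendsto_const_mul_rpow_nhdsGT (3 * (1 + C₀) * a ^ (s / 2))
    (sub_pos.2 hsκ)).add (tendsto_const_mul_rpow_nhdsGT (2 * C₀ * a ^ (d + 1))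
      (e := (d : ℝ) + 1) (by positivity))).add
    (tendsto_const_mul_rpow_nhdsGT (2 * Real.pi * C₁ / a) one_pos)
  filter_upwards [bound_tendsto.eventually_le_const (by simpa using hε), self_mem_nhdsWithin]
    with ρ bound_le hρ
  exact (mollifiedError_le hC₀ hρ ha).trans bound_le

lemma exists_sampling_exponents {n s β D : ℝ} (hn : 1 ≤ n) (hs : s < β)
    (hβ : β * (n - 1 / 2) ≤ D) :
    ∃ b κ e : ℝ, s < b ∧ b < β ∧ s / 2 < κ ∧ 2 * κ < b ∧ b * (n - 1) + κ < e ∧ e < D := by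
  obtain ⟨b, hsb, hbβ⟩ := exists_between hs
  obtain ⟨κ, hsκ, hκb⟩ := exists_between (div_lt_div_of_pos_right hsb two_pos)
  have lt_D : b * (n - 1) + κ < D := by nlinarith
  obtain ⟨e, he, heD⟩ := exists_between lt_D
  exact ⟨b, κ, e, hsb, hbβ, hsκ, by linarith, he, heD⟩

end Parameters

section Discretization

variable {d n : ℕ}

/-- The cube of frequencies with entries in `[-R, R]`; it contains those of length at most `R`. -/
def freqCube (d R : ℕ) : Finset (Fin d → ℤ) :=
  Fintype.piFinset fun _ => Finset.Icc (-(R : ℤ)) R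

lemma card_freqCube (d R : ℕ) : (freqCube d R).card = (2 * R + 1) ^ d := by
  rw [freqCube, Fintype.card_piFinset]
  simp only [Int.card_Icc, Finset.prod_const, Finset.card_univ, Fintype.card_fin]
  congr 1
  omega

lemma mem_freqCube_of_freqNorm_le {R : ℕ} {ξ : Fin d → ℤ} (h : freqNorm ξ ≤ R) :
    ξ ∈ freqCube d R := by
  refine Fintype.mem_piFinset.2 fun i => ?_
  rw [Finset.mem_Icc, ← abs_le]
  exact_mod_cast (abs_le_freqNorm ξ i).trans h

lemma exists_pruned_sample {N R : ℕ} (hN : 0 < N) (hn : 0 < n) {μ : Measure (Torus (Fin d))}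
    [IsProbabilityMeasure μ] {S : Set (Torus (Fin d))} (hS : ∀ᵐ y ∂μ, y ∈ S)
    {A : Set (Fin n → Torus (Fin d))} (hA : MeasurableSet A) {τ : ℝ} (hτ0 : 0 < τ) (hτ1 : τ < 1)
    (hexp : 4 * (2 * (R : ℝ) + 1) ^ d * Real.exp (-(N * τ ^ 2) / 8) < 1 / 2)
    (hAτ : (N : ℝ≥0∞) ^ n * (Measure.pi fun _ : Fin n => μ) A ≤ ENNReal.ofReal (N * τ / 2)) :
    ∃ (x : Fin N → Torus (Fin d)) (G : Finset (Fin N)), G.Nonempty ∧ (∀ i, x i ∈ S) ∧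
      (∀ ξ, freqNorm ξ ≤ R → ‖fourierCoeff (empirical G x) ξ - fourierCoeff μ ξ‖ ≤ 3 * τ) ∧
      ∀ f ∈ tuplesIn A x, ∃ i, f i ∉ G := by
  have N_pos : (0 : ℝ) < N := by exact_mod_cast hN
  obtain ⟨x, hxS, deviation, card_tuples⟩ := exists_sample hN hS hA (freqCube d R) hτ0.le
    (T := N * τ) (by positivity) (by rw [card_freqCube]; push_cast; exact hexp) hAτ
  let B : Finset (Fin N) := (tuplesIn A x).image fun f => f ⟨0, hn⟩
  have card_bad : (Bᶜᶜ.card : ℝ) ≤ N * τ := by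
    rw [compl_compl]
    exact (Nat.cast_le.2 Finset.card_image_le).trans card_tuples
  have nonempty : Bᶜ.Nonempty := by
    rw [Finset.nonempty_iff_ne_empty]
    intro h
    rw [h, Finset.compl_empty, Finset.card_univ, Fintype.card_fin] at card_bad
    exact (mul_lt_of_lt_one_right N_pos hτ1).not_ge card_bad
  refine ⟨x, Bᶜ, nonempty, hxS, fun ξ hξ => ?_, fun f hf => ⟨⟨0, hn⟩, ?_⟩⟩
  · have pruning := norm_fourierCoeff_empirical_sub_le nonempty x (τ := τ)
      (by rwa [Fintype.card_fin]) ξ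
    calc ‖fourierCoeff (empirical Bᶜ x) ξ - fourierCoeff μ ξ‖
        ≤ ‖fourierCoeff (empirical Bᶜ x) ξ - fourierCoeff (empirical Finset.univ x) ξ‖ +
            ‖fourierCoeff (empirical Finset.univ x) ξ - fourierCoeff μ ξ‖ :=
          norm_sub_le_norm_sub_add_norm_sub _ _ _
      _ ≤ 2 * τ + τ := add_le_add pruning (deviation ξ (mem_freqCube_of_freqNorm_le hξ))
      _ = 3 * τ := by ring
  · rw [Finset.notMem_compl]
    exact Finset.mem_image.2 ⟨f, hf, rfl⟩

/-- `S` avoids the pattern `Z` at scale `η`: no tuple of `η`-separated points of `S` lies in `Z`. -/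
def AvoidsAtScale (η : ℝ) (S : Set (Torus (Fin d))) (Z : Set (Torus (Fin n × Fin d))) : Prop :=
  ∀ z : Fin n → Torus (Fin d), (∀ i j, i ≠ j → η ≤ dist (z i) (z j)) → (∀ i, z i ∈ S) →
    tuple z ∉ Z

lemma AvoidsAtScale.mono {η η' : ℝ} {S T : Set (Torus (Fin d))} {Z : Set (Torus (Fin n × Fin d))}
    (h : AvoidsAtScale η T Z) (hη : η ≤ η') (hST : S ⊆ T) : AvoidsAtScale η' S Z :=
  fun z hz hzS => h z (fun i j hij => hη.trans (hz i j hij)) fun i => hST (hzS i)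

lemma avoidsAtScale_thickening_image {N : ℕ} {x : Fin N → Torus (Fin d)} {G : Finset (Fin N)}
    {Z : Set (Torus (Fin n × Fin d))} {δ ρ : ℝ} (hδ : 0 ≤ δ) (hρ : n * δ < ρ)
    (hG : ∀ f ∈ tuplesIn (tuple ⁻¹' Metric.thickening ρ Z) x, ∃ i, f i ∉ G) :
    AvoidsAtScale (2 * δ) (Metric.thickening δ (x '' G)) Z := by
  intro z separated hz hzZ
  have exists_index (i : Fin n) : ∃ j ∈ G, dist (z i) (x j) < δ := by
    simpa [Metric.mem_thickening_iff] using hz i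
  choose f hfG hfz using exists_index
  have injective_f : Function.Injective f := by
    intro i j hij
    by_contra hne
    have dist_lt : dist (z i) (z j) < δ + δ :=
      (dist_triangle_right _ _ (x (f i))).trans_lt (add_lt_add (hfz i) (hij ▸ hfz j))
    linarith [separated i j hne]
  have mem_tuples : (⟨f, injective_f⟩ : Fin n ↪ Fin N) ∈
      tuplesIn (tuple ⁻¹' Metric.thickening ρ Z) x := by
    refine mem_tuplesIn.2 (Metric.mem_thickening_iff.2 ⟨tuple z, hzZ, ?_⟩)
    rw [dist_comm]
    exact (dist_tuple_le hδ fun i => (hfz i).le).trans_lt hρ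
  obtain ⟨i, hi⟩ := hG _ mem_tuples
  exact hi (hfG i)

/-- `μ` approximates `μ₁` to within `ε` in the `M(s)` norm, and is smooth at scale `r` around a
finite set `F` which avoids the pattern `Z` at scale `4 * r`, even after thickening. -/
structure IsDiscretization (Z : Set (Torus (Fin n × Fin d))) (μ₁ : Measure (Torus (Fin d)))
    (s ε r : ℝ) (F : Finset (Torus (Fin d))) (μ : Measure (Torus (Fin d))) : Prop where
  isProbabilityMeasure : IsProbabilityMeasure μ
  ae_mem_cthickening : ∀ᵐ y ∂μ, y ∈ Metric.cthickening r (F : Set (Torus (Fin d)))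
  exists_hasFastDecay : ∃ C : ℝ, HasFastDecay μ C
  decayNorm_sub_le : decayNorm s (fourierCoeff μ - fourierCoeff μ₁) ≤ ENNReal.ofReal ε
  avoidsAtScale : AvoidsAtScale (4 * r) (Metric.thickening (2 * r) (F : Set (Torus (Fin d)))) Z

variable {μ₁ : Measure (Torus (Fin d))} [IsProbabilityMeasure μ₁] {S : Set (Torus (Fin d))}
  {C₁ : ℝ} {K : ℝ≥0∞} {Z : Set (Torus (Fin n × Fin d))} {s : ℝ}

lemma exists_isDiscretization_of_sample {N R : ℕ} (hN : 0 < N) (hR : 0 < R) (hn : 0 < n)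
    (hS : ∀ᵐ y ∂μ₁, y ∈ S) (hμ₁ : HasFastDecay μ₁ C₁) (hK : K ≠ ∞)
    (hμK : μ₁ ≤ K • lebesgue (Fin d)) {ψ : Measure (Torus (Fin d))} {C₀ r τ ρ V : ℝ}
    (hψ : IsMollifier ψ C₀ r) (hC₀ : 0 ≤ C₀) (hs : 0 ≤ s) (hsd : s ≤ d) (hr : 0 < r)
    (hrρ : n * (2 * r) < ρ) (hτ0 : 0 < τ) (hτ1 : τ < 1)
    (hZ : lebesgue _ (Metric.thickening ρ Z) ≤ ENNReal.ofReal V)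
    (hV : (N : ℝ) ^ n * (K.toReal ^ n * V) ≤ N * τ / 2)
    (hexp : 4 * (2 * (R : ℝ) + 1) ^ d * Real.exp (-(N * τ ^ 2) / 8) < 1 / 2) :
    ∃ (F : Finset (Torus (Fin d))) (μ : Measure (Torus (Fin d))), F.card ≤ N ∧ (∀ y ∈ F, y ∈ S) ∧
      IsDiscretization Z μ₁ s (mollifiedError d s C₀ C₁ (3 * τ) R r) r F μ := by
  classical
  have := hψ.isProbabilityMeasure
  have measurableSet_thickening : MeasurableSet (Metric.thickening ρ Z) :=
    Metric.isOpen_thickening.measurableSet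
  have pattern_measure_le : (N : ℝ≥0∞) ^ n *
      (Measure.pi fun _ : Fin n => μ₁) (tuple ⁻¹' Metric.thickening ρ Z) ≤
        ENNReal.ofReal (N * τ / 2) := by
    calc (N : ℝ≥0∞) ^ n * (Measure.pi fun _ : Fin n => μ₁) (tuple ⁻¹' Metric.thickening ρ Z)
        ≤ (N : ℝ≥0∞) ^ n * (K ^ n * ENNReal.ofReal V) := by
          gcongr
          exact (pi_preimage_tuple_le hK hμK measurableSet_thickening).trans (by gcongr)
      _ = ENNReal.ofReal ((N : ℝ) ^ n * (K.toReal ^ n * V)) := by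
          rw [ENNReal.ofReal_mul (by positivity), ENNReal.ofReal_mul (by positivity),
            ENNReal.ofReal_pow (by positivity), ENNReal.ofReal_pow ENNReal.toReal_nonneg,
            ENNReal.ofReal_natCast, ENNReal.ofReal_toReal hK]
      _ ≤ ENNReal.ofReal (N * τ / 2) := ENNReal.ofReal_le_ofReal hV
  obtain ⟨x, G, hG, hxS, deviation, pruned⟩ := exists_pruned_sample hN hn hS
    (measurable_tuple measurableSet_thickening) hτ0 hτ1 hexp pattern_measure_le
  have := isProbabilityMeasure_empirical hG x
  refine ⟨G.image x, empirical G x ∗ ψ, ?_, ?_,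
    ⟨inferInstance, ?_, ⟨_, hψ.hasFastDecay.conv⟩, ?_, ?_⟩⟩
  · exact Finset.card_image_le.trans ((Finset.card_le_univ G).trans_eq (Fintype.card_fin N))
  · exact Finset.forall_mem_image.2 fun i _ => hxS i
  · refine ae_conv_of_ae_of_ae Metric.isClosed_cthickening.measurableSet
      (ae_empirical fun i hi => Finset.mem_image_of_mem x hi) hψ.ae_norm_le fun a y ha hy => ?_
    exact Metric.mem_cthickening_of_dist_le (a + y) a r _ ha (by simpa using hy)
  · exact hψ.decayNorm_conv_sub_le hr hC₀ hs hsd (by positivity) (by exact_mod_cast hR) hμ₁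
      deviation
  · rw [Finset.coe_image, show 4 * r = 2 * (2 * r) by ring]
    exact avoidsAtScale_thickening_image (by positivity) hrρ pruned

lemma exists_isDiscretization (hS : ∀ᵐ y ∂μ₁, y ∈ S) (hμ₁ : HasFastDecay μ₁ C₁) (hK : K ≠ ∞)
    (hμK : μ₁ ≤ K • lebesgue (Fin d)) {α β : ℝ} (hn : 0 < n) (hs : 0 ≤ s) (hsβ : s < β)
    (hβd : β ≤ d) (hβ : β * ((n : ℝ) - 1 / 2) ≤ d * n - α)
    (hZ : lowerMinkowskiDim Z ≤ (α : EReal)) {ε γ : ℝ} (hε : 0 < ε) (hγ : 0 < γ) :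
    ∃ (r : ℝ) (F : Finset (Torus (Fin d))) (μ : Measure (Torus (Fin d))), 0 < r ∧ r < ε ∧
      F.card * (2 * r) ^ (β + γ) ≤ γ ∧ (∀ y ∈ F, y ∈ S) ∧ IsDiscretization Z μ₁ s ε r F μ := by
  obtain ⟨C₀, hC₀, exists_mollifier⟩ := exists_isMollifier d
  obtain ⟨b, κ, e, hsb, hbβ, hsκ, hκb, he, heα⟩ :=
    exists_sampling_exponents (by exact_mod_cast hn) hsβ hβ
  have b_nonneg : 0 ≤ b := hs.trans hsb.le
  have small_volume := frequently_lebesgue_thickening_le hZ (sub_pos.2 heα)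
  simp only [Fintype.card_prod, Fintype.card_fin, Nat.cast_mul, mul_comm (n : ℝ) d,
    sub_sub_cancel] at small_volume
  -- Moving each of `n` points by less than `2 * r` moves the tuple by less than `n * (2 * r)`,
  -- which has to stay below the scale `ρ` at which the volume of `Z` is controlled.
  let a : ℝ := 2 * n + 1
  have a_pos : 0 < a := by positivity
  have small : ∀ᶠ ρ in 𝓝[>] (0 : ℝ), ρ ∈ Set.Ioo 0 (min 1 ε) :=
    Ioo_mem_nhdsGT (lt_min one_pos hε)
  obtain ⟨ρ, volume_le, ⟨hρ, hρ_lt⟩, few, few_patterns, deviation_unlikely, error_le⟩ :=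
    (small_volume.and_eventually <| small.and <|
      (eventually_ceil_mul_rpow_le b_nonneg (by linarith : b < β + γ) hγ).and <|
      (eventually_ceil_pow_mul_le b_nonneg (by positivity : 0 ≤ K.toReal ^ n) he).and <|
      (eventually_exp_lt_half d hκb).and <|
      eventually_mollifiedError_le d C₁ hsκ hC₀.le a_pos hε).exists
  obtain ⟨hρ1, hρε⟩ := lt_min_iff.1 hρ_lt
  let r : ℝ := ρ / a
  have r_pos : 0 < r := by positivity
  have r_mul_a : (2 * n + 1) * r = ρ := mul_div_cancel₀ ρ a_pos.ne'
  have two_r_le : 2 * r ≤ ρ := by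
    have : (1 : ℝ) ≤ n := by exact_mod_cast hn
    nlinarith
  obtain ⟨ψ, hψ⟩ := exists_mollifier r r_pos (by linarith)
  obtain ⟨F, μ, card_le, hFS, hμ⟩ := exists_isDiscretization_of_sample
    (N := ⌈ρ ^ (-b)⌉₊) (R := ⌈ρ ^ (-4 : ℝ)⌉₊) (Nat.ceil_pos.2 (Real.rpow_pos_of_pos hρ _))
    (Nat.ceil_pos.2 (Real.rpow_pos_of_pos hρ _)) hn hS hμ₁ hK hμK hψ hC₀.le hs (hsβ.le.trans hβd)
    r_pos (by linarith) (Real.rpow_pos_of_pos hρ κ) (Real.rpow_lt_one hρ.le hρ1 (by linarith))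
    volume_le few_patterns deviation_unlikely
  refine ⟨r, F, μ, r_pos, by linarith, ?_, hFS,
    { hμ with decayNorm_sub_le := hμ.decayNorm_sub_le.trans (ENNReal.ofReal_le_ofReal error_le) }⟩
  calc (F.card : ℝ) * (2 * r) ^ (β + γ) ≤ ⌈ρ ^ (-b)⌉₊ * ρ ^ (β + γ) := by
        gcongr
        linarith
    _ ≤ γ := few

end Discretization

section Neighbourhoods

variable {d : ℕ} {β : ℝ}

lemma decayNorm_sub_mono {s t : ℝ} (hst : s ≤ t) (μ ν : ProbabilityMeasure (Torus (Fin d))) :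
    decayNorm s (fourierCoeff (μ : Measure (Torus (Fin d))) - fourierCoeff (ν : Measure _)) ≤
      decayNorm t (fourierCoeff (μ : Measure (Torus (Fin d))) - fourierCoeff (ν : Measure _)) :=
  decayNorm_mono hst (by simp [fourierCoeff_zero])

/-- The filter of sets that contain all `q` close to `p` in the Hausdorff metric and in a single
one of the seminorms. -/
def XSpace.basicFilter (hβ : 0 < β) (p : XSpace d β) : Filter (XSpace d β) where
  sets := {V | ∃ s ε : ℝ, 0 ≤ s ∧ s < β ∧ 0 < ε ∧ ∀ q : XSpace d β, dist q.E p.E < ε →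
    decayNorm s (fourierCoeff (q.μ : Measure (Torus (Fin d))) - fourierCoeff (p.μ : Measure _)) <
      ENNReal.ofReal ε → q ∈ V}
  univ_sets := ⟨0, 1, le_rfl, hβ, one_pos, fun _ _ _ => trivial⟩
  sets_of_superset := by
    rintro V W ⟨s, ε, hs, hsβ, hε, h⟩ hVW
    exact ⟨s, ε, hs, hsβ, hε, fun q hE hμ => hVW (h q hE hμ)⟩
  inter_sets := by
    rintro V W ⟨s, ε, hs, hsβ, hε, h⟩ ⟨s', ε', -, hsβ', hε', h'⟩
    refine ⟨max s s', min ε ε', le_max_of_le_left hs, max_lt hsβ hsβ', lt_min hε hε',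
      fun q hE hμ => ⟨h q (hE.trans_le (min_le_left _ _)) ?_,
        h' q (hE.trans_le (min_le_right _ _)) ?_⟩⟩
    · exact (decayNorm_sub_mono (le_max_left _ _) _ _).trans_lt
        (hμ.trans_le (ENNReal.ofReal_le_ofReal (min_le_left _ _)))
    · exact (decayNorm_sub_mono (le_max_right _ _) _ _).trans_lt
        (hμ.trans_le (ENNReal.ofReal_le_ofReal (min_le_right _ _)))

lemma XSpace.le_nhds {p : XSpace d β} {L : Filter (XSpace d β)}
    (hE : Filter.Tendsto XSpace.E L (𝓝 p.E))
    (hμ : ∀ s, 0 ≤ s → s < β → ∀ ε : ℝ≥0∞, 0 < ε → ∀ᶠ q : XSpace d β in L,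
      decayNorm s (fourierCoeff (q.μ : Measure (Torus (Fin d))) - fourierCoeff (p.μ : Measure _)) <
        ε) : L ≤ 𝓝 p := by
  refine le_of_le_of_eq (le_inf ?_ ?_) (nhds_inf (t₁ := TopologicalSpace.induced XSpace.E
    (inferInstance : TopologicalSpace (NonemptyCompacts (Torus (Fin d)))))
    (t₂ := ⨅ s : Set.Ico (0 : ℝ) β, TopologicalSpace.induced XSpace.μ
      (decayPseudoEMetric d s).toUniformSpace.toTopologicalSpace)).symm
  · rwa [nhds_induced, ← Filter.tendsto_iff_comap]
  · rw [nhds_iInf]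
    refine le_iInf fun s => ?_
    refine le_of_le_of_eq (Filter.tendsto_iff_comap.1 ?_) (@nhds_induced _ _
      (decayPseudoEMetric d s).toUniformSpace.toTopologicalSpace XSpace.μ p).symm
    exact (@EMetric.tendsto_nhds _ _ (decayPseudoEMetric d s) _ _ _).2 (hμ s s.2.1 s.2.2)

lemma XSpace.basicFilter_le_nhds (hβ : 0 < β) (p : XSpace d β) :
    XSpace.basicFilter hβ p ≤ 𝓝 p := by
  refine XSpace.le_nhds (Metric.tendsto_nhds.2 fun ε hε =>
    ⟨0, ε, le_rfl, hβ, hε, fun _ hE _ => hE⟩) fun s hs hsβ ε hε => ?_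
  obtain ⟨δ, δ_pos, hδε⟩ : ∃ δ : ℝ, 0 < δ ∧ ENNReal.ofReal δ ≤ ε := by
    rcases eq_or_ne ε ∞ with rfl | hne
    · exact ⟨1, one_pos, le_top⟩
    · exact ⟨ε.toReal, ENNReal.toReal_pos hε.ne' hne, ENNReal.ofReal_toReal_le⟩
  exact ⟨s, δ, hs, hsβ, δ_pos, fun _ _ hμ => hμ.trans_le hδε⟩

lemma XSpace.exists_of_mem_nhds (hβ : 0 < β) {p : XSpace d β} {V : Set (XSpace d β)}
    (hV : V ∈ 𝓝 p) : ∃ s ε : ℝ, 0 ≤ s ∧ s < β ∧ 0 < ε ∧ ∀ q : XSpace d β, dist q.E p.E < ε →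
    decayNorm s (fourierCoeff (q.μ : Measure (Torus (Fin d))) - fourierCoeff (p.μ : Measure _)) <
      ENNReal.ofReal ε → q ∈ V :=
  XSpace.basicFilter_le_nhds hβ p hV

lemma XSpace.continuous_E : Continuous (XSpace.E : XSpace d β → NonemptyCompacts _) :=
  continuous_iff_le_induced.2 inf_le_left

end Neighbourhoods

section Generic

lemma isOpen_setOf_exists_thickening {X : Type*} [MetricSpace X] {P : Set X → Prop}
    (hP : Antitone P) :
    IsOpen {E : NonemptyCompacts X | ∃ ε : ℝ, 0 < ε ∧ P (Metric.thickening ε E)} := by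
  rw [Metric.isOpen_iff]
  rintro E ⟨ε, hε, hE⟩
  refine ⟨ε / 2, half_pos hε, fun E' hE' => ⟨ε / 2, half_pos hε, hP ?_ hE⟩⟩
  have subset_thickening : (E' : Set X) ⊆ Metric.thickening (ε / 2) E := by
    intro y hy
    rw [Metric.mem_ball, Metric.NonemptyCompacts.dist_eq] at hE'
    exact Metric.mem_thickening_iff.2 <| Metric.exists_dist_lt_of_hausdorffDist_lt hy hE'
      (Metric.hausdorffEDist_ne_top_of_nonempty_of_bounded E'.nonempty E.nonempty
        E'.isCompact.isBounded E.isCompact.isBounded)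
  calc Metric.thickening (ε / 2) (E' : Set X)
      ⊆ Metric.thickening (ε / 2) (Metric.thickening (ε / 2) E) :=
        Metric.thickening_subset_of_subset _ subset_thickening
    _ ⊆ Metric.thickening (ε / 2 + ε / 2) E := Metric.thickening_thickening_subset _ _ _
    _ = Metric.thickening ε E := by rw [add_halves]

lemma hausdorffDist_cthickening_le {X : Type*} [PseudoMetricSpace X] {E F : Set X} {r ε : ℝ}
    (hr : 0 < r) (hrε : 2 * r ≤ ε) (hF : F ⊆ Metric.thickening ε E)
    (hE : ∀ y ∈ E, ∃ z ∈ Metric.cthickening r F, dist y z < 3 * ε) :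
    Metric.hausdorffDist (Metric.cthickening r F) E ≤ 3 * ε := by
  have cthickening_subset : Metric.cthickening r F ⊆ Metric.thickening (2 * r + ε) E :=
    calc Metric.cthickening r F ⊆ Metric.thickening (2 * r) F :=
          Metric.cthickening_subset_thickening' (by linarith) (by linarith) F
      _ ⊆ Metric.thickening (2 * r) (Metric.thickening ε E) :=
          Metric.thickening_subset_of_subset _ hF
      _ ⊆ Metric.thickening (2 * r + ε) E := Metric.thickening_thickening_subset _ _ _
  refine Metric.hausdorffDist_le_of_mem_dist (by linarith) (fun x hx => ?_) fun y hy => ?_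
  · obtain ⟨y, hy, hxy⟩ := Metric.mem_thickening_iff.1 (cthickening_subset hx)
    exact ⟨y, hy, by linarith⟩
  · obtain ⟨z, hz, hyz⟩ := hE y hy
    exact ⟨z, hz, hyz.le⟩

variable {d n : ℕ} {β γ : ℝ} {Z : Set (Torus (Fin n × Fin d))}

/-- `S` is covered by balls of a radius `ρ < γ` whose number is at most `γ * ρ ^ (-(β + γ))`. If
this holds for arbitrarily small `γ`, then `S` has Hausdorff dimension at most `β`. -/
def HasEfficientCover (β γ : ℝ) (S : Set (Torus (Fin d))) : Prop :=
  ∃ (F : Finset (Torus (Fin d))) (ρ : ℝ), 0 < ρ ∧ ρ < γ ∧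
    S ⊆ Metric.thickening ρ (F : Set (Torus (Fin d))) ∧ F.card * ρ ^ (β + γ) ≤ γ

/-- The part at scale `γ` of the two requirements that `S` avoid `Z` and that it have Hausdorff
dimension at most `β`. -/
def IsGoodAt (Z : Set (Torus (Fin n × Fin d))) (β γ : ℝ) (S : Set (Torus (Fin d))) : Prop :=
  AvoidsAtScale γ S Z ∧ HasEfficientCover β γ S

lemma antitone_isGoodAt : Antitone (IsGoodAt Z β γ) := by
  rintro S T hST ⟨avoids, F, ρ, hρ, hργ, cover, card_le⟩
  exact ⟨avoids.mono le_rfl hST, F, ρ, hρ, hργ, hST.trans cover, card_le⟩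

/-- The pairs `(E, μ)` such that some neighbourhood of `E` is good at scale `γ`. -/
def goodPairs (Z : Set (Torus (Fin n × Fin d))) (β γ : ℝ) : Set (XSpace d β) :=
  {p | ∃ ε : ℝ, 0 < ε ∧ IsGoodAt Z β γ (Metric.thickening ε (p.E : Set (Torus (Fin d))))}

lemma isOpen_goodPairs : IsOpen (goodPairs Z β γ) :=
  (isOpen_setOf_exists_thickening antitone_isGoodAt).preimage XSpace.continuous_E

lemma norm_sub_le_of_decayNorm_le {μ ν : Measure (Torus (Fin d))} [IsProbabilityMeasure μ]
    [IsProbabilityMeasure ν] {s ε : ℝ} (hs : 0 ≤ s) (hε : 0 ≤ ε)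
    (h : decayNorm s (fourierCoeff μ - fourierCoeff ν) ≤ ENNReal.ofReal ε) (ξ : Fin d → ℤ) :
    ‖fourierCoeff μ ξ - fourierCoeff ν ξ‖ ≤ ε := by
  rcases eq_or_ne ξ 0 with rfl | hξ
  · simpa [fourierCoeff_zero] using hε
  · calc ‖fourierCoeff μ ξ - fourierCoeff ν ξ‖
        ≤ ‖fourierCoeff μ ξ - fourierCoeff ν ξ‖ * freqNorm ξ ^ (s / 2) :=
          le_mul_of_one_le_right (norm_nonneg _)
            (Real.one_le_rpow (one_le_freqNorm hξ) (by linarith))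
      _ ≤ ε := (ENNReal.ofReal_le_ofReal_iff hε).1 ((ofReal_le_decayNorm _ _ ξ).trans h)

lemma HasFastDecay.exists_xSpace {μ : Measure (Torus (Fin d))} [hμ : IsProbabilityMeasure μ]
    {C : ℝ} (decay : HasFastDecay μ C) (hβd : β ≤ d) {S : Set (Torus (Fin d))} (hS : IsClosed S)
    (hμS : ∀ᵐ y ∂μ, y ∈ S) :
    ∃ p : XSpace d β, (p.E : Set (Torus (Fin d))) = S ∧ (p.μ : Measure (Torus (Fin d))) = μ := by
  have support_subset : μ.support ⊆ S := Measure.support_subset_of_isClosed hS hμS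
  have nonempty : S.Nonempty :=
    (Measure.nonempty_support (IsProbabilityMeasure.ne_zero μ)).mono support_subset
  exact ⟨{ E := ⟨⟨S, hS.isCompact⟩, nonempty⟩
           μ := ⟨μ, hμ⟩
           support_subset := support_subset
           decay := fun t ht htβ =>
            HasFastDecay.decayNorm_lt_top (μ := μ) decay ht (htβ.le.trans hβd) }, rfl, rfl⟩

lemma IsDiscretization.isGoodAt {μ μ₁ : Measure (Torus (Fin d))} {s ε r : ℝ}
    {F : Finset (Torus (Fin d))} (h : IsDiscretization Z μ₁ s ε r F μ) (hr : 0 < r)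
    (hrγ : 4 * r ≤ γ) (hF : F.card * (2 * r) ^ (β + γ) ≤ γ) :
    IsGoodAt Z β γ (Metric.thickening r (Metric.cthickening r (F : Set (Torus (Fin d))))) := by
  have thickening_subset := Metric.thickening_cthickening_subset r hr.le (F : Set (Torus (Fin d)))
  rw [← two_mul] at thickening_subset
  exact ⟨h.avoidsAtScale.mono hrγ thickening_subset,
    F, 2 * r, by linarith, by linarith, thickening_subset, hF⟩

lemma IsSmoothApprox.exists_mem_goodPairs {α s ε : ℝ} {μ₀ μ₁ : Measure (Torus (Fin d))}
    {E : Set (Torus (Fin d))} (hμ₁ : IsSmoothApprox μ₀ E s ε μ₁) (hE : IsCompact E) (hε : 0 < ε)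
    (hn : 0 < n) (hs : 0 ≤ s) (hsβ : s < β) (hβd : β ≤ d)
    (hβ : β * ((n : ℝ) - 1 / 2) ≤ d * n - α) (hZ : lowerMinkowskiDim Z ≤ (α : EReal))
    (hγ : 0 < γ) :
    ∃ q ∈ goodPairs Z β γ, Metric.hausdorffDist (q.E : Set (Torus (Fin d))) E < 4 * ε ∧
      decayNorm s (fourierCoeff (q.μ : Measure (Torus (Fin d))) - fourierCoeff μ₀) <
        ENNReal.ofReal (4 * ε) := by
  have := hμ₁.isProbabilityMeasure
  obtain ⟨K, hK, hμ₁K⟩ := hμ₁.exists_le_smul_lebesgue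
  obtain ⟨C₁, decay_μ₁⟩ := hμ₁.exists_hasFastDecay
  obtain ⟨δ, hδ, support_close⟩ := exists_tolerance_support μ₁ hE hε hμ₁.measure_ball_pos
  obtain ⟨η, hη, hη_lt⟩ : ∃ η, 0 < η ∧ η < min (min (ε / 2) δ) (γ / 4) :=
    exists_between (by positivity)
  simp only [lt_min_iff] at hη_lt
  obtain ⟨⟨hηε, hηδ⟩, hηγ⟩ := hη_lt
  obtain ⟨r, F, μ, hr, hrη, card_le, F_subset, hμ⟩ := exists_isDiscretization
    hμ₁.ae_mem_thickening decay_μ₁ hK hμ₁K hn hs hsβ hβd hβ hZ hη hγ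
  have := hμ.isProbabilityMeasure
  obtain ⟨C, decay_μ⟩ := hμ.exists_hasFastDecay
  have decay_lt : decayNorm s (fourierCoeff μ - fourierCoeff μ₀) < ENNReal.ofReal (4 * ε) :=
    calc decayNorm s (fourierCoeff μ - fourierCoeff μ₀)
        ≤ decayNorm s (fourierCoeff μ - fourierCoeff μ₁) +
            decayNorm s (fourierCoeff μ₁ - fourierCoeff μ₀) := by
          rw [← sub_add_sub_cancel (fourierCoeff μ) (fourierCoeff μ₁)]
          exact decayNorm_add_le s _ _
      _ ≤ ENNReal.ofReal η + ENNReal.ofReal ε :=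
          add_le_add hμ.decayNorm_sub_le hμ₁.decayNorm_sub_le
      _ < ENNReal.ofReal (4 * ε) := by
          rw [← ENNReal.ofReal_add hη.le hε.le]
          exact (ENNReal.ofReal_lt_ofReal_iff (by positivity)).2 (by linarith)
  obtain ⟨q, hqE, hqμ⟩ := decay_μ.exists_xSpace hβd Metric.isClosed_cthickening
    hμ.ae_mem_cthickening
  have support_subset := q.support_subset
  rw [hqE, hqμ] at support_subset
  refine ⟨q, ⟨r, hr, hqE ▸ hμ.isGoodAt hr (by linarith) card_le⟩, ?_, hqμ.symm ▸ decay_lt⟩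
  rw [hqE]
  refine (hausdorffDist_cthickening_le hr (by linarith) F_subset fun y hy => ?_).trans_lt
    (by linarith)
  obtain ⟨z, hz, hyz⟩ := support_close μ
    (fun ξ => (norm_sub_le_of_decayNorm_le hs hη.le hμ.decayNorm_sub_le ξ).trans hηδ.le) y hy
  exact ⟨z, support_subset hz, hyz⟩

lemma dense_goodPairs {α : ℝ} (hn : 0 < n) (hβ0 : 0 < β) (hβd : β ≤ d)
    (hβ : β * ((n : ℝ) - 1 / 2) ≤ d * n - α) (hZ : lowerMinkowskiDim Z ≤ (α : EReal))
    (hγ : 0 < γ) : Dense (goodPairs Z β γ) := by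
  intro p
  rw [mem_closure_iff_nhds]
  intro V hV
  obtain ⟨s, ε, hs, hsβ, hε, mem_V⟩ := XSpace.exists_of_mem_nhds hβ0 hV
  obtain ⟨t, hst, htβ⟩ := exists_between hsβ
  obtain ⟨μ₁, hμ₁⟩ := exists_isSmoothApprox p.E.isCompact p.support_subset hs hst
    (hsβ.le.trans hβd) (p.decay t (hs.trans hst.le) htβ) (by positivity : 0 < ε / 4)
  obtain ⟨q, q_good, q_dist, q_decay⟩ :=
    hμ₁.exists_mem_goodPairs p.E.isCompact (by positivity) hn hs hsβ hβd hβ hZ hγ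
  rw [mul_div_cancel₀ ε four_ne_zero] at q_dist q_decay
  exact ⟨q, mem_V q (Metric.NonemptyCompacts.dist_eq.trans_lt q_dist) q_decay, q_good⟩

lemma avoids_of_forall_avoidsAtScale {E : Set (Torus (Fin d))} {u : ℕ → ℝ}
    (hu : Filter.Tendsto u Filter.atTop (𝓝 0)) (h : ∀ k, AvoidsAtScale (u k) E Z) :
    Avoids E Z := by
  intro x injective_x hxE
  have separated : ∀ᶠ k in Filter.atTop, ∀ i j, i ≠ j → u k ≤ dist (x i) (x j) :=
    Filter.eventually_all.2 fun i => Filter.eventually_all.2 fun j =>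
      Filter.eventually_imp_distrib_left.2 fun hij =>
        hu.eventually_le_const (dist_pos.2 (injective_x.ne hij))
  obtain ⟨k, hk⟩ := separated.exists
  exact h k x hk hxE

lemma ediam_ball_le {X : Type*} [PseudoMetricSpace X] (g : X) (ρ : ℝ) :
    Metric.ediam (Metric.ball g ρ) ≤ ENNReal.ofReal (2 * ρ) := by
  rw [← Metric.eball_ofReal, ENNReal.ofReal_mul zero_le_two, ENNReal.ofReal_ofNat]
  exact Metric.ediam_eball_le

lemma sum_ediam_ball_rpow_le {X : Type*} [PseudoMetricSpace X] (F : Finset X) {ρ t : ℝ}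
    (hρ : 0 ≤ ρ) (ht : 0 ≤ t) :
    ∑ g : F, Metric.ediam (Metric.ball (g : X) ρ) ^ t ≤
      ENNReal.ofReal (2 ^ t * (F.card * ρ ^ t)) :=
  calc ∑ g : F, Metric.ediam (Metric.ball (g : X) ρ) ^ t
      ≤ ∑ _g : F, ENNReal.ofReal (2 ^ t * ρ ^ t) := by
        refine Finset.sum_le_sum fun g _ => ?_
        rw [← Real.mul_rpow zero_le_two hρ, ← ENNReal.ofReal_rpow_of_nonneg (by positivity) ht]
        exact ENNReal.rpow_le_rpow (ediam_ball_le _ ρ) ht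
    _ = ENNReal.ofReal (2 ^ t * (F.card * ρ ^ t)) := by
        rw [Finset.sum_const, nsmul_eq_mul, Finset.card_univ, Fintype.card_coe,
          ← ENNReal.ofReal_natCast, ← ENNReal.ofReal_mul (by positivity), mul_left_comm]

lemma hausdorffMeasure_lt_top_of_forall_hasEfficientCover {E : Set (Torus (Fin d))} {u : ℕ → ℝ}
    (hu : Filter.Tendsto u Filter.atTop (𝓝 0)) (h : ∀ k, HasEfficientCover β (u k) E) {t : ℝ}
    (ht : 0 ≤ t) (hβt : β < t) : μH[t] E < ∞ := by
  choose F ρ ρ_pos hρu cover card_le using h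
  have diam_tendsto : Filter.Tendsto (fun k => ENNReal.ofReal (2 * u k)) Filter.atTop (𝓝 0) := by
    simpa using ENNReal.tendsto_ofReal (hu.const_mul 2)
  have hausdorffMeasure_le := Measure.hausdorffMeasure_le_liminf_sum t E
    (l := Filter.atTop) (ι := fun k => F k) _ diam_tendsto
    (fun k (g : F k) => Metric.ball (g : Torus (Fin d)) (ρ k))
    (Filter.Eventually.of_forall fun k g => (ediam_ball_le _ (ρ k)).trans
      (ENNReal.ofReal_le_ofReal (by linarith [hρu k])))
    (Filter.Eventually.of_forall fun k => by
      simpa only [Metric.thickening_eq_biUnion_ball, Finset.mem_coe, Set.iUnion_subtype]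
        using cover k)
  refine (hausdorffMeasure_le.trans (Filter.liminf_le_of_frequently_le'
    (Filter.Eventually.frequently ?_))).trans_lt (ENNReal.ofReal_lt_top (r := 2 ^ t))
  filter_upwards [hu.eventually_le_const one_pos, hu.eventually_le_const (sub_pos.2 hβt)]
    with k u_le_one u_le_sub
  refine (sum_ediam_ball_rpow_le (F k) (ρ_pos k).le ht).trans (ENNReal.ofReal_le_ofReal ?_)
  refine mul_le_of_le_one_right (by positivity) ?_
  calc (F k).card * ρ k ^ t ≤ (F k).card * ρ k ^ (β + u k) := by
        gcongr ?_ * ?_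
        exact Real.rpow_le_rpow_of_exponent_ge (ρ_pos k) ((hρu k).le.trans u_le_one) (by linarith)
    _ ≤ 1 := (card_le k).trans u_le_one

lemma dimH_le_of_forall_hasEfficientCover {E : Set (Torus (Fin d))} {u : ℕ → ℝ}
    (hu : Filter.Tendsto u Filter.atTop (𝓝 0)) (h : ∀ k, HasEfficientCover β (u k) E) :
    dimH E ≤ ENNReal.ofReal β := by
  refine le_of_forall_gt fun b hb => ?_
  obtain ⟨t, hβt, htb⟩ := ENNReal.lt_iff_exists_nnreal_btwn.1 hb
  refine (dimH_le_of_hausdorffMeasure_ne_top ?_).trans_lt htb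
  have : β < t := lt_of_not_ge fun h => hβt.not_ge (by simpa using ENNReal.ofReal_le_ofReal h)
  exact (hausdorffMeasure_lt_top_of_forall_hasEfficientCover hu h t.coe_nonneg this).ne

lemma residual_dimH_le_and_avoids {α : ℝ} (hn : 0 < n) (hβ0 : 0 < β) (hβd : β ≤ d)
    (hβ : β * ((n : ℝ) - 1 / 2) ≤ d * n - α) (hZ : lowerMinkowskiDim Z ≤ (α : EReal)) :
    {p : XSpace d β | dimH (p.E : Set (Torus (Fin d))) ≤ ENNReal.ofReal β ∧
      Avoids (p.E : Set (Torus (Fin d))) Z} ∈ residual (XSpace d β) := by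
  let u : ℕ → ℝ := fun k => 1 / ((k : ℝ) + 1)
  have tendsto_u : Filter.Tendsto u Filter.atTop (𝓝 0) := tendsto_one_div_add_atTop_nhds_zero_nat
  have residual_good (k : ℕ) : ∀ᶠ p in residual (XSpace d β), p ∈ goodPairs Z β (u k) :=
    residual_of_dense_open isOpen_goodPairs (dense_goodPairs hn hβ0 hβd hβ hZ (by positivity))
  filter_upwards [eventually_countable_forall.2 residual_good] with p hp
  have good (k : ℕ) : IsGoodAt Z β (u k) (p.E : Set (Torus (Fin d))) := by
    obtain ⟨ε, hε, h⟩ := hp k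
    exact antitone_isGoodAt (Metric.self_subset_thickening hε _) h
  exact ⟨dimH_le_of_forall_hasEfficientCover tendsto_u fun k => (good k).2,
    avoids_of_forall_avoidsAtScale tendsto_u fun k => (good k).1⟩

end Generic

section MassDistribution

lemma exists_nat_measure_setOf_le_inter_ne_zero {Y : Type*} [MeasurableSpace Y] {ν : Measure Y}
    {f : Y → ℝ≥0∞} {E : Set Y} (hf : ∀ᵐ x ∂ν, f x < ∞) (hE : ν E ≠ 0) :
    ∃ M : ℕ, ν ({x | f x ≤ M} ∩ E) ≠ 0 := by
  by_contra! null
  refine hE (measure_mono_null_ae ?_ (measure_iUnion_null null))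
  filter_upwards [hf] with x hx hxE
  obtain ⟨M, hM⟩ := ENNReal.exists_nat_gt hx.ne
  exact Set.mem_iUnion.2 ⟨M, hM.le, hxE⟩

variable {X : Type*} [MetricSpace X] [MeasurableSpace X] {μ : Measure X} {A E : Set X}

lemma measure_inter_le_ediam_rpow {s : Set X} {t c M : ℝ} (ht : 0 ≤ t) (hM : 0 ≤ M)
    (h : ∀ x ∈ A, ∀ r, 0 < r → r ≤ c → μ (Metric.closedBall x r) ≤ ENNReal.ofReal (M * r ^ t))
    (hs : Metric.ediam s < ENNReal.ofReal c) :
    μ (s ∩ A) ≤ ENNReal.ofReal M * Metric.ediam s ^ t := by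
  rcases (s ∩ A).eq_empty_or_nonempty with empty | ⟨x, hxs, hxA⟩
  · simp [empty]
  have finite : Metric.ediam s ≠ ∞ := (hs.trans ENNReal.ofReal_lt_top).ne
  have diam_lt : Metric.diam s < c := by
    rwa [Metric.diam, ← ENNReal.lt_ofReal_iff_toReal_lt finite]
  have bound : ∀ᶠ r in 𝓝[>] Metric.diam s, μ (s ∩ A) ≤ ENNReal.ofReal (M * r ^ t) := by
    filter_upwards [Ioo_mem_nhdsGT diam_lt] with r hr
    refine (measure_mono fun y hy => ?_).trans
      (h x hxA r (Metric.diam_nonneg.trans_lt hr.1) hr.2.le)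
    exact (Metric.dist_le_diam_of_mem' finite hy.1 hxs).trans hr.1.le
  have limit : Filter.Tendsto (fun r : ℝ => ENNReal.ofReal (M * r ^ t)) (𝓝[>] Metric.diam s)
      (𝓝 (ENNReal.ofReal (M * Metric.diam s ^ t))) :=
    (ENNReal.tendsto_ofReal
      ((Real.continuousAt_rpow_const _ t (Or.inr ht)).tendsto.const_mul M)).mono_left inf_le_left
  refine (ge_of_tendsto limit bound).trans_eq ?_
  rw [ENNReal.ofReal_mul hM, ← ENNReal.ofReal_rpow_of_nonneg Metric.diam_nonneg ht, Metric.diam,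
    ENNReal.ofReal_toReal finite]

lemma le_dimH_of_measure_closedBall_le [BorelSpace X] (hA : MeasurableSet A) (hμA : μ A ≠ 0)
    {t : NNReal} {c M : ℝ} (hc : 0 < c) (hM : 0 < M)
    (h : ∀ x ∈ A, ∀ r, 0 < r → r ≤ c →
      μ (Metric.closedBall x r) ≤ ENNReal.ofReal (M * r ^ (t : ℝ))) :
    (t : ℝ≥0∞) ≤ dimH A := by
  have le_hausdorff : (ENNReal.ofReal M)⁻¹ • μ.restrict A ≤ μH[(t : ℝ)] := by
    refine Measure.le_hausdorffMeasure _ _ (ENNReal.ofReal (c / 2)) (by simpa using hc)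
      fun s hs => ?_
    have hs' : Metric.ediam s < ENNReal.ofReal c :=
      hs.trans_lt ((ENNReal.ofReal_lt_ofReal_iff hc).2 (half_lt_self hc))
    rw [Measure.smul_apply, smul_eq_mul, mul_comm, ← div_eq_mul_inv, Measure.restrict_apply' hA]
    refine ENNReal.div_le_of_le_mul ?_
    rw [mul_comm]
    exact measure_inter_le_ediam_rpow t.2 hM.le h hs'
  refine le_dimH_of_hausdorffMeasure_ne_zero fun hausdorff_zero => hμA ?_
  have := (le_hausdorff A).trans hausdorff_zero.le
  rw [Measure.smul_apply, smul_eq_mul, Measure.restrict_apply_self, nonpos_iff_eq_zero,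
    mul_eq_zero] at this
  exact this.resolve_left (by simp)

lemma measure_closedBall_le_of_dyadic {x : X} {t c M r : ℝ} (ht : 0 ≤ t) (hM : 0 ≤ M)
    (h : ∀ m : ℕ, μ (Metric.closedBall x (c / 2 ^ m)) ≤ ENNReal.ofReal (M * ((2 : ℝ) ^ m) ^ (-t)))
    (hr : 0 < r) (hrc : r ≤ c) :
    μ (Metric.closedBall x r) ≤ ENNReal.ofReal (M * (2 / c) ^ t * r ^ t) := by
  have hc : 0 < c := hr.trans_le hrc
  obtain ⟨m, lower, upper⟩ := exists_nat_pow_near ((one_le_div hr).2 hrc) one_lt_two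
  have radius : r ≤ c / 2 ^ m := (le_div_comm₀ (by positivity) hr).1 lower
  have scale : ((2 : ℝ) ^ m)⁻¹ ≤ 2 / c * r := by
    rw [inv_le_iff_one_le_mul₀ (by positivity)]
    rw [div_lt_iff₀ hr, pow_succ] at upper
    field_simp
    linarith
  refine (measure_mono (Metric.closedBall_subset_closedBall radius)).trans ((h m).trans
    (ENNReal.ofReal_le_ofReal ?_))
  calc M * ((2 : ℝ) ^ m) ^ (-t) = M * (((2 : ℝ) ^ m)⁻¹) ^ t := by
        rw [Real.rpow_neg (by positivity), Real.inv_rpow (by positivity)]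
    _ ≤ M * (2 / c * r) ^ t := by gcongr
    _ = M * (2 / c) ^ t * r ^ t := by rw [Real.mul_rpow (by positivity) hr.le, mul_assoc]

/-- The dyadic `t`-potential of `μ` at `x`, comparable to `∫ dist x y ^ (-t) ∂μ(y)`. -/
def dyadicPotential (μ : Measure X) (t c : ℝ) (x : X) : ℝ≥0∞ :=
  ∑' m : ℕ, ENNReal.ofReal (((2 : ℝ) ^ m) ^ t) * μ (Metric.closedBall x (c / 2 ^ m))

lemma measure_closedBall_le_of_dyadicPotential_le {t c M : ℝ} {x : X}
    (h : dyadicPotential μ t c x ≤ ENNReal.ofReal M) (m : ℕ) :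
    μ (Metric.closedBall x (c / 2 ^ m)) ≤ ENNReal.ofReal (M * ((2 : ℝ) ^ m) ^ (-t)) := by
  have positive : 0 < ((2 : ℝ) ^ m) ^ t := by positivity
  have term := (ENNReal.le_tsum m).trans h
  rw [Real.rpow_neg (by positivity), ← div_eq_mul_inv, ENNReal.ofReal_div_of_pos positive,
    ENNReal.le_div_iff_mul_le (Or.inl (by simpa using positive)) (Or.inl ENNReal.ofReal_ne_top),
    mul_comm]
  exact term

variable [BorelSpace X] [SecondCountableTopology X] [SFinite μ]

lemma measurable_measure_closedBall (r : ℝ) :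
    Measurable fun x => μ (Metric.closedBall x r) := by
  simp only [Metric.closedBall, dist_comm]
  exact measurable_measure_prodMk_left
    (isClosed_le (continuous_fst.dist continuous_snd) continuous_const).measurableSet

lemma lintegral_measure_closedBall (r : ℝ) :
    ∫⁻ x, μ (Metric.closedBall x r) ∂μ = (μ.prod μ) {z | dist z.1 z.2 ≤ r} := by
  rw [Measure.prod_apply
    (isClosed_le (continuous_fst.dist continuous_snd) continuous_const).measurableSet]
  simp only [Metric.closedBall, dist_comm, Set.preimage_ofPred_eq]

lemma measurable_dyadicPotential (t c : ℝ) : Measurable (dyadicPotential μ t c) :=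
  Measurable.tsum fun _ => (measurable_measure_closedBall _).const_mul _

lemma lintegral_dyadicPotential_lt_top {t u c C : ℝ} (htu : t < u)
    (h : ∀ m : ℕ, (μ.prod μ) {z | dist z.1 z.2 ≤ c / 2 ^ m} ≤
      ENNReal.ofReal (C * ((2 : ℝ) ^ m) ^ (-u))) :
    ∫⁻ x, dyadicPotential μ t c x ∂μ < ∞ := by
  have term : ∀ m : ℕ, ∫⁻ x, ENNReal.ofReal (((2 : ℝ) ^ m) ^ t) *
      μ (Metric.closedBall x (c / 2 ^ m)) ∂μ ≤
        ENNReal.ofReal C * ENNReal.ofReal ((2 : ℝ) ^ (t - u)) ^ m := by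
    intro m
    rw [lintegral_const_mul _ (measurable_measure_closedBall _), lintegral_measure_closedBall]
    refine (mul_le_mul_right (h m) _).trans_eq ?_
    have power : ((2 : ℝ) ^ m) ^ t * ((2 : ℝ) ^ m) ^ (-u) = ((2 : ℝ) ^ (t - u)) ^ m := by
      rw [← Real.rpow_add (by positivity), ← sub_eq_add_neg, ← Real.rpow_natCast_mul two_pos.le,
        mul_comm, Real.rpow_mul_natCast two_pos.le]
    rw [← ENNReal.ofReal_pow (by positivity), ← power, ENNReal.ofReal_mul' (by positivity),
      ENNReal.ofReal_mul (by positivity)]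
    ring
  have ratio : ENNReal.ofReal ((2 : ℝ) ^ (t - u)) < 1 :=
    ENNReal.ofReal_lt_one.2 (Real.rpow_lt_one_of_one_lt_of_neg one_lt_two (sub_neg.2 htu))
  calc ∫⁻ x, dyadicPotential μ t c x ∂μ
      = ∑' m : ℕ, ∫⁻ x, ENNReal.ofReal (((2 : ℝ) ^ m) ^ t) *
          μ (Metric.closedBall x (c / 2 ^ m)) ∂μ :=
        lintegral_tsum fun _ => ((measurable_measure_closedBall _).const_mul _).aemeasurable
    _ ≤ ∑' m : ℕ, ENNReal.ofReal C * ENNReal.ofReal ((2 : ℝ) ^ (t - u)) ^ m :=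
        ENNReal.tsum_le_tsum term
    _ < ∞ := by
        rw [ENNReal.tsum_mul_left, ENNReal.tsum_geometric]
        exact ENNReal.mul_lt_top ENNReal.ofReal_lt_top
          (ENNReal.inv_lt_top.2 (tsub_pos_of_lt ratio))

lemma le_dimH_of_prod_measure_dist_le (hE : MeasurableSet E) (hμE : μ E ≠ 0) {t : NNReal}
    {u c C : ℝ} (htu : t < u) (hc : 0 < c)
    (h : ∀ m : ℕ, (μ.prod μ) {z | dist z.1 z.2 ≤ c / 2 ^ m} ≤
      ENNReal.ofReal (C * ((2 : ℝ) ^ m) ^ (-u))) :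
    (t : ℝ≥0∞) ≤ dimH E := by
  have measurable := measurable_dyadicPotential (μ := μ) t c
  obtain ⟨M, not_null⟩ := exists_nat_measure_setOf_le_inter_ne_zero
    (ae_lt_top measurable (lintegral_dyadicPotential_lt_top htu h).ne) hμE
  refine le_trans (le_dimH_of_measure_closedBall_le
    ((measurableSet_le measurable measurable_const).inter hE) not_null hc
    (M := ((M : ℝ) + 1) * (2 / c) ^ (t : ℝ)) (by positivity) fun x hx r hr hrc => ?_)
    (dimH_mono Set.inter_subset_right)
  refine measure_closedBall_le_of_dyadic t.2 (by positivity) (fun m => ?_) hr hrc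
  refine measure_closedBall_le_of_dyadicPotential_le (hx.1.trans ?_) m
  rw [← ENNReal.ofReal_natCast]
  exact ENNReal.ofReal_le_ofReal (by linarith)

end MassDistribution

section FourierEnergy

variable {d : ℕ}

lemma fourierCoeff_neg (μ : Measure (Torus (Fin d))) (ξ : Fin d → ℤ) :
    fourierCoeff μ (-ξ) = starRingEnd ℂ (fourierCoeff μ ξ) := by
  simp_rw [fourierCoeff_eq, ← integral_conj, ← char_neg_left]

lemma freqNorm_eq_norm (ξ : Fin d → ℤ) :
    freqNorm ξ = ‖WithLp.toLp 2 (fun i => (ξ i : ℝ))‖ := by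
  simp [freqNorm, EuclideanSpace.norm_eq]

lemma summable_freqNorm_rpow {r : ℝ} (hr : r < -d) :
    Summable fun ξ : Fin d → ℤ => freqNorm ξ ^ r := by
  let L : Submodule ℤ (EuclideanSpace ℝ (Fin d)) :=
    Submodule.span ℤ (Set.range (EuclideanSpace.basisFun (Fin d) ℝ).toBasis)
  have rank : Module.finrank ℤ L = d := by
    rw [ZLattice.rank ℝ L, finrank_euclideanSpace, Fintype.card_fin]
  have summable := ZLattice.summable_norm_rpow L r (by rwa [rank])
  have mem (ξ : Fin d → ℤ) : WithLp.toLp 2 (fun i => (ξ i : ℝ)) ∈ L := by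
    rw [Module.Basis.mem_span_iff_repr_mem]
    exact fun i => ⟨ξ i, by simp⟩
  have injective : Function.Injective fun ξ : Fin d → ℤ => (⟨_, mem ξ⟩ : L) := by
    intro ξ η h
    ext i
    have : (ξ i : ℝ) = η i := congrArg (fun x : L => (x : EuclideanSpace ℝ (Fin d)) i) h
    exact_mod_cast this
  refine (summable.comp_injective injective).congr fun ξ => ?_
  rw [Function.comp_apply, Submodule.coe_norm, freqNorm_eq_norm]

lemma freqNorm_le_of_mem_freqCube {N : ℕ} {ξ : Fin d → ℤ} (hξ : ξ ∈ freqCube d N) :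
    freqNorm ξ ≤ √d * N := by
  refine freqNorm_le_of_forall_abs_le (Nat.cast_nonneg N) fun i => ?_
  have := Finset.mem_Icc.1 (Fintype.mem_piFinset.1 hξ i)
  exact_mod_cast abs_le.2 this

lemma exists_sum_norm_fourierCoeff_sq_le {μ : Measure (Torus (Fin d))} [IsProbabilityMeasure μ]
    {s u : ℝ} (hus : u < s) (hud : u ≤ d) (decay : decayNorm s (fourierCoeff μ) < ∞) :
    ∃ C : ℝ, ∀ N : ℕ, 0 < N →
      ∑ ξ ∈ freqCube d N, ‖fourierCoeff μ ξ‖ ^ 2 ≤ C * (N : ℝ) ^ (d - u) := by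
  obtain ⟨B, -, bound⟩ := exists_bound_of_decayNorm_lt_top decay
  have summable : Summable fun ξ : Fin d → ℤ => freqNorm ξ ^ (u - s - d) :=
    summable_freqNorm_rpow (by linarith)
  have rpow_nonneg (ξ : Fin d → ℤ) (r : ℝ) : 0 ≤ freqNorm ξ ^ r :=
    Real.rpow_nonneg (freqNorm_nonneg ξ) r
  set A := ∑' ξ : Fin d → ℤ, freqNorm ξ ^ (u - s - d)
  refine ⟨1 + B ^ 2 * √d ^ (d - u) * A, fun N hN => ?_⟩
  have one_le_N : (1 : ℝ) ≤ N := by exact_mod_cast hN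
  have term : ∀ ξ ∈ (freqCube d N).erase 0, ‖fourierCoeff μ ξ‖ ^ 2 ≤
      B ^ 2 * (√d * N) ^ (d - u) * freqNorm ξ ^ (u - s - d) := by
    intro ξ hξ
    have pos : 0 < freqNorm ξ := freqNorm_pos (Finset.ne_of_mem_erase hξ)
    have le : freqNorm ξ ≤ √d * N := freqNorm_le_of_mem_freqCube (Finset.mem_of_mem_erase hξ)
    have split : (freqNorm ξ ^ (s / 2)) ^ 2 * (freqNorm ξ ^ (d - u) * freqNorm ξ ^ (u - s - d))
        = 1 := by
      rw [← Real.rpow_mul_natCast pos.le, ← Real.rpow_add pos, ← Real.rpow_add pos,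
        ← Real.rpow_zero (freqNorm ξ)]
      congr 1
      push_cast
      ring
    calc ‖fourierCoeff μ ξ‖ ^ 2
        = (‖fourierCoeff μ ξ‖ * freqNorm ξ ^ (s / 2)) ^ 2 *
            freqNorm ξ ^ (d - u) * freqNorm ξ ^ (u - s - d) := by
          rw [mul_pow, mul_assoc, mul_assoc, split, mul_one]
      _ ≤ _ := by
          have := bound ξ
          have := sub_nonneg.2 hud
          gcongr
  have zero_mem : 0 ∈ freqCube d N :=
    mem_freqCube_of_freqNorm_le (freqNorm_zero.trans_le N.cast_nonneg)
  rw [← Finset.add_sum_erase _ _ zero_mem, add_mul]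
  refine add_le_add ?_ ?_
  · rw [fourierCoeff_zero, norm_one, one_pow, one_mul]
    exact Real.one_le_rpow one_le_N (sub_nonneg.2 hud)
  · calc ∑ ξ ∈ (freqCube d N).erase 0, ‖fourierCoeff μ ξ‖ ^ 2
        ≤ B ^ 2 * (√d * N) ^ (d - u) * ∑ ξ ∈ (freqCube d N).erase 0, freqNorm ξ ^ (u - s - d) := by
          rw [Finset.mul_sum]
          exact Finset.sum_le_sum term
      _ ≤ B ^ 2 * (√d * N) ^ (d - u) * A := by
          gcongr
          exact summable.sum_le_tsum _ fun ξ _ => rpow_nonneg ξ _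
      _ = B ^ 2 * √d ^ (d - u) * A * (N : ℝ) ^ (d - u) := by
          rw [Real.mul_rpow (Real.sqrt_nonneg _) (Nat.cast_nonneg N)]
          ring

/-- The frequencies with entries in `[0, N)`; their differences lie in `freqCube d N`. -/
def posCube (d N : ℕ) : Finset (Fin d → ℤ) := Fintype.piFinset fun _ => Finset.Ico (0 : ℤ) N

lemma card_posCube (d N : ℕ) : (posCube d N).card = N ^ d := by
  simp [posCube, Fintype.card_piFinset]

lemma posCube_subset_freqCube (d N : ℕ) : posCube d N ⊆ freqCube d N :=
  Fintype.piFinset_subset _ _ fun _ =>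
    Finset.Ico_subset_Icc_self.trans (Finset.Icc_subset_Icc_left (by simp))

lemma sub_mem_freqCube {N : ℕ} {k l : Fin d → ℤ} (hk : k ∈ posCube d N) (hl : l ∈ posCube d N) :
    k - l ∈ freqCube d N := by
  refine Fintype.mem_piFinset.2 fun i => ?_
  have := Finset.mem_Ico.1 (Fintype.mem_piFinset.1 hk i)
  have := Finset.mem_Ico.1 (Fintype.mem_piFinset.1 hl i)
  rw [Finset.mem_Icc, Pi.sub_apply]
  constructor <;> linarith

lemma sum_posCube_sub_le {N : ℕ} {f : (Fin d → ℤ) → ℝ} (hf : ∀ ξ, 0 ≤ f ξ) :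
    ∑ k ∈ posCube d N, ∑ l ∈ posCube d N, f (k - l) ≤ (N : ℝ) ^ d * ∑ ξ ∈ freqCube d N, f ξ := by
  have row : ∀ k ∈ posCube d N, ∑ l ∈ posCube d N, f (k - l) ≤ ∑ ξ ∈ freqCube d N, f ξ := by
    intro k hk
    rw [← Finset.sum_image (g := fun l => k - l) (f := f) sub_right_injective.injOn]
    refine Finset.sum_le_sum_of_subset_of_nonneg ?_ fun ξ _ _ => hf ξ
    exact Finset.image_subset_iff.2 fun l hl => sub_mem_freqCube hk hl
  refine (Finset.sum_le_card_nsmul _ _ _ row).trans_eq ?_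
  rw [card_posCube, nsmul_eq_mul, Nat.cast_pow]

/-- The Dirichlet kernel of `posCube`. Its square modulus dominates the indicator of a ball and has
a nonnegative Fourier expansion. -/
def dirichlet (d N : ℕ) (x : Torus (Fin d)) : ℂ := ∑ ξ ∈ posCube d N, char ξ x

lemma continuous_dirichlet (d N : ℕ) : Continuous (dirichlet d N) :=
  continuous_finsetSum _ fun ξ _ => continuous_char ξ

lemma le_norm_dirichlet {N : ℕ} {x : Torus (Fin d)}
    (hx : 2 * Real.pi * (√d * N) * ‖x‖ ≤ 1 / 2) : (N : ℝ) ^ d / 2 ≤ ‖dirichlet d N x‖ := by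
  have near : ‖(N : ℂ) ^ d - dirichlet d N x‖ ≤ (N : ℝ) ^ d * (1 / 2) := by
    have expand : dirichlet d N x - (N : ℂ) ^ d = ∑ ξ ∈ posCube d N, (char ξ x - 1) := by
      rw [Finset.sum_sub_distrib, Finset.sum_const, card_posCube, dirichlet]
      simp
    rw [norm_sub_rev, expand, ← Nat.cast_pow, ← card_posCube, ← nsmul_eq_mul]
    refine norm_sum_le_of_le _ (fun ξ hξ => ?_) |>.trans_eq (Finset.sum_const _)
    refine (norm_char_sub_one_le ξ x).trans (le_trans ?_ hx)
    gcongr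
    exact freqNorm_le_of_mem_freqCube (posCube_subset_freqCube d N hξ)
  have := norm_sub_norm_le ((N : ℂ) ^ d) ((N : ℂ) ^ d - dirichlet d N x)
  rw [sub_sub_cancel, norm_pow, Complex.norm_natCast] at this
  linarith

lemma norm_dirichlet_sub_sq (N : ℕ) (x y : Torus (Fin d)) :
    ((‖dirichlet d N (x - y)‖ ^ 2 : ℝ) : ℂ) =
      ∑ k ∈ posCube d N, ∑ l ∈ posCube d N, char (k - l) x * char (-(k - l)) y := by
  rw [← Complex.normSq_eq_norm_sq, ← Complex.mul_conj, dirichlet, map_sum, Finset.sum_mul_sum]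
  refine Finset.sum_congr rfl fun k _ => Finset.sum_congr rfl fun l _ => ?_
  rw [← char_neg_left, ← char_sub_left, sub_eq_add_neg x y, char_add, char_neg_right]

lemma integral_norm_dirichlet_sq (μ : Measure (Torus (Fin d))) [IsProbabilityMeasure μ] (N : ℕ) :
    ∫ z, ‖dirichlet d N (z.1 - z.2)‖ ^ 2 ∂(μ.prod μ) =
      ∑ k ∈ posCube d N, ∑ l ∈ posCube d N, ‖fourierCoeff μ (k - l)‖ ^ 2 := by
  have integrable (k l : Fin d → ℤ) : Integrable
      (fun z : Torus (Fin d) × Torus (Fin d) => char (k - l) z.1 * char (-(k - l)) z.2)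
      (μ.prod μ) := (integrable_char _ μ).mul_prod (integrable_char _ μ)
  have coefficient (ξ : Fin d → ℤ) :
      ∫ z, char ξ z.1 * char (-ξ) z.2 ∂(μ.prod μ) = ((‖fourierCoeff μ ξ‖ ^ 2 : ℝ) : ℂ) := by
    rw [integral_prod_mul, ← fourierCoeff_eq, ← neg_neg ξ, ← fourierCoeff_eq, neg_neg,
      fourierCoeff_neg, ← Complex.normSq_eq_norm_sq, ← Complex.mul_conj, mul_comm]
  rw [← Complex.ofReal_inj, ← integral_complex_ofReal]
  simp_rw [norm_dirichlet_sub_sq]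
  rw [integral_finsetSum _ fun k _ => integrable_finsetSum _ fun l _ => integrable k l]
  push_cast
  refine Finset.sum_congr rfl fun k _ => ?_
  rw [integral_finsetSum _ fun l _ => integrable k l]
  refine Finset.sum_congr rfl fun l _ => ?_
  rw [coefficient, Complex.ofReal_pow]

lemma prod_measure_dist_le_le (μ : Measure (Torus (Fin d))) [IsProbabilityMeasure μ] {N : ℕ}
    (hN : 0 < N) {r : ℝ} (hr : 2 * Real.pi * (√d * N) * r ≤ 1 / 2) :
    (μ.prod μ) {z | dist z.1 z.2 ≤ r} ≤
      ENNReal.ofReal (4 / (N : ℝ) ^ d * ∑ ξ ∈ freqCube d N, ‖fourierCoeff μ ξ‖ ^ 2) := by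
  have : (0 : ℝ) < N := by exact_mod_cast hN
  have integrable : Integrable (fun z : Torus (Fin d) × Torus (Fin d) =>
      ‖dirichlet d N (z.1 - z.2)‖ ^ 2) (μ.prod μ) :=
    (((continuous_dirichlet d N).comp (continuous_fst.sub continuous_snd)).norm.pow
      2).integrable_of_hasCompactSupport (HasCompactSupport.of_compactSpace _)
  have subset : {z : Torus (Fin d) × Torus (Fin d) | dist z.1 z.2 ≤ r} ⊆
      {z | ((N : ℝ) ^ d / 2) ^ 2 ≤ ‖dirichlet d N (z.1 - z.2)‖ ^ 2} := by
    intro z (hz : dist z.1 z.2 ≤ r)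
    have : (N : ℝ) ^ d / 2 ≤ ‖dirichlet d N (z.1 - z.2)‖ := by
      refine le_norm_dirichlet (le_trans ?_ hr)
      rw [← dist_eq_norm]
      gcongr
    exact pow_le_pow_left₀ (by positivity) this 2
  have markov := (mul_meas_ge_le_integral_of_nonneg
    (Filter.Eventually.of_forall fun z => sq_nonneg _) integrable (((N : ℝ) ^ d / 2) ^ 2)).trans
      ((integral_norm_dirichlet_sq μ N).trans_le
        (sum_posCube_sub_le (f := fun ξ => ‖fourierCoeff μ ξ‖ ^ 2) fun ξ => sq_nonneg _))
  refine (measure_mono subset).trans ?_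
  rw [← ofReal_measureReal]
  refine ENNReal.ofReal_le_ofReal ?_
  rw [div_mul_eq_mul_div, le_div_iff₀ (by positivity)]
  refine le_of_mul_le_mul_left (a := (N : ℝ) ^ d) ?_ (by positivity)
  linarith

lemma exists_prod_measure_dist_le_le {μ : Measure (Torus (Fin d))} [IsProbabilityMeasure μ]
    {s u : ℝ} (hus : u < s) (hud : u ≤ d) (decay : decayNorm s (fourierCoeff μ) < ∞) :
    ∃ c C : ℝ, 0 < c ∧ ∀ N : ℕ, 0 < N →
      (μ.prod μ) {z | dist z.1 z.2 ≤ c / N} ≤ ENNReal.ofReal (C * (N : ℝ) ^ (-u)) := by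
  obtain ⟨C, sum_le⟩ := exists_sum_norm_fourierCoeff_sq_le hus hud decay
  refine ⟨1 / (4 * Real.pi * (√d + 1)), 4 * C, by positivity, fun N hN => ?_⟩
  have N_pos : (0 : ℝ) < N := by exact_mod_cast hN
  refine (prod_measure_dist_le_le μ hN ?_).trans (ENNReal.ofReal_le_ofReal ?_)
  · calc 2 * Real.pi * (√d * N) * (1 / (4 * Real.pi * (√d + 1)) / N)
        = 1 / 2 * (√d / (√d + 1)) := by field_simp; ring
      _ ≤ 1 / 2 := mul_le_of_le_one_right (by norm_num)
          ((div_le_one (by positivity)).2 (by linarith))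
  · calc 4 / (N : ℝ) ^ d * ∑ ξ ∈ freqCube d N, ‖fourierCoeff μ ξ‖ ^ 2
        ≤ 4 / (N : ℝ) ^ d * (C * (N : ℝ) ^ (d - u)) := by
          gcongr
          exact sum_le N hN
      _ = 4 * C * (N : ℝ) ^ (-u) := by
          rw [sub_eq_add_neg, Real.rpow_add N_pos, Real.rpow_natCast]
          field_simp

lemma le_dimH_support_of_decayNorm_lt_top {μ : Measure (Torus (Fin d))} [IsProbabilityMeasure μ]
    {s : ℝ} (hsd : s ≤ d) (decay : decayNorm s (fourierCoeff μ) < ∞) {t : NNReal} (hts : t < s) :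
    (t : ℝ≥0∞) ≤ dimH μ.support := by
  obtain ⟨u, htu, hus⟩ := exists_between hts
  obtain ⟨c, C, hc, correlation⟩ := exists_prod_measure_dist_le_le hus (hus.le.trans hsd) decay
  have support_not_null : μ μ.support ≠ 0 := by
    rw [(prob_compl_eq_zero_iff Measure.isClosed_support.measurableSet).1
      Measure.measure_compl_support]
    exact one_ne_zero
  refine le_dimH_of_prod_measure_dist_le Measure.isClosed_support.measurableSet support_not_null
    htu hc (C := C) fun m => ?_
  have := correlation (2 ^ m) (by positivity)
  rwa [Nat.cast_pow, Nat.cast_ofNat] at this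

lemma fourierDim_le_dimH (E : Set (Torus (Fin d))) : fourierDim E ≤ dimH E := by
  refine iSup₂_le fun μ hμ => iSup₂_le fun s hs => ?_
  refine le_of_forall_lt fun a ha => ?_
  obtain ⟨t, hat, hts⟩ := ENNReal.lt_iff_exists_nnreal_btwn.1 ha
  refine hat.trans_le ?_
  exact (le_dimH_support_of_decayNorm_lt_top hs.2.1 hs.2.2
    (by simpa using (ENNReal.lt_ofReal_iff_toReal_lt ENNReal.coe_ne_top).1 hts)).trans
      (dimH_mono hμ)

end FourierEnergy

section Baire

variable {d : ℕ} {β : ℝ}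

lemma decayPseudoEMetric_mono {s t : ℝ} (hst : s ≤ t) :
    (decayPseudoEMetric d t).toUniformSpace ≤ (decayPseudoEMetric d s).toUniformSpace := by
  refine ((@uniformity_basis_edist _ (decayPseudoEMetric d t)).le_basis_iff
    (@uniformity_basis_edist _ (decayPseudoEMetric d s))).2 fun ε hε => ⟨ε, hε, ?_⟩
  rintro ⟨μ, ν⟩ h
  exact (decayNorm_sub_mono hst μ ν).trans_lt h

/-- A sequence of exponents in `[0, β)` increasing to `β`: countably many of the seminorms suffice
to define the topology of `XSpace d β`. -/
def exponentSeq (β : ℝ) (k : ℕ) : ℝ := β * (1 - 1 / ((k : ℝ) + 1))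

lemma exponentSeq_nonneg (hβ : 0 < β) (k : ℕ) : 0 ≤ exponentSeq β k := by
  refine mul_nonneg hβ.le (sub_nonneg.2 ?_)
  rw [div_le_one (by positivity)]
  linarith [(Nat.cast_nonneg k : (0 : ℝ) ≤ k)]

lemma exponentSeq_lt (hβ : 0 < β) (k : ℕ) : exponentSeq β k < β := by
  have : (0 : ℝ) < 1 / ((k : ℝ) + 1) := by positivity
  rw [exponentSeq]
  nlinarith

lemma exists_le_exponentSeq {s : ℝ} (hs : s < β) : ∃ k, s ≤ exponentSeq β k := by
  have limit : Filter.Tendsto (exponentSeq β) Filter.atTop (𝓝 β) := by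
    have := ((tendsto_one_div_add_atTop_nhds_zero_nat (𝕜 := ℝ)).const_sub 1).const_mul β
    rw [sub_zero, mul_one] at this
    exact this
  exact (limit.eventually_const_le hs).exists

/-- The uniform structure on `𝓧_β` induced by the Hausdorff metric and the seminorms with exponents
in `exponentSeq β`. Restricting to a sequence makes the uniformity countably generated. -/
abbrev XSpace.uniform (d : ℕ) (β : ℝ) : UniformSpace (XSpace d β) :=
  UniformSpace.comap XSpace.E inferInstance ⊓
    ⨅ k : ℕ, UniformSpace.comap XSpace.μ (decayPseudoEMetric d (exponentSeq β k)).toUniformSpace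

lemma XSpace.uniform_toTopologicalSpace (hβ : 0 < β) :
    (XSpace.uniform d β).toTopologicalSpace = XSpace.instTopologicalSpace d β := by
  rw [XSpace.uniform, UniformSpace.toTopologicalSpace_inf, UniformSpace.toTopologicalSpace_iInf]
  refine congrArg₂ (· ⊓ ·) rfl (le_antisymm ?_ ?_)
  · refine le_iInf fun s => ?_
    obtain ⟨k, hk⟩ := exists_le_exponentSeq s.2.2
    exact (iInf_le _ k).trans
      (induced_mono (UniformSpace.toTopologicalSpace_mono (decayPseudoEMetric_mono hk)))
  · exact le_iInf fun k =>
      iInf_le_of_le ⟨exponentSeq β k, exponentSeq_nonneg hβ k, exponentSeq_lt hβ k⟩ le_rfl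

lemma XSpace.isCountablyGenerated_uniformity :
    (@uniformity _ (XSpace.uniform d β)).IsCountablyGenerated := by
  rw [XSpace.uniform, inf_uniformity, iInf_uniformity]
  have countable_μ : ∀ k : ℕ, (@uniformity _ (UniformSpace.comap (XSpace.μ : XSpace d β → _)
      (decayPseudoEMetric d (exponentSeq β k)).toUniformSpace)).IsCountablyGenerated := by
    intro k
    have := @EMetric.instIsCountablyGeneratedUniformity _ (decayPseudoEMetric d (exponentSeq β k))
    exact Filter.comap.isCountablyGenerated _ _
  have countable_E : (@uniformity _ (UniformSpace.comap (XSpace.E : XSpace d β → _)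
      inferInstance)).IsCountablyGenerated := Filter.comap.isCountablyGenerated _ _
  infer_instance

lemma tendsto_fourierCoeff {ι : Type*} {L : Filter ι}
    {μs : ι → ProbabilityMeasure (Torus (Fin d))} {ν : ProbabilityMeasure (Torus (Fin d))}
    (h : Filter.Tendsto μs L (𝓝 ν)) (ξ : Fin d → ℤ) :
    Filter.Tendsto (fun i => fourierCoeff (μs i : Measure (Torus (Fin d))) ξ) L
      (𝓝 (fourierCoeff (ν : Measure (Torus (Fin d))) ξ)) :=
  (ProbabilityMeasure.tendsto_iff_forall_integral_rclike_tendsto ℂ).1 h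
    (BoundedContinuousFunction.mkOfCompact ⟨char (-ξ), continuous_char _⟩)

lemma support_subset_of_tendsto {ι : Type*} {L : Filter ι} [L.NeBot]
    {μs : ι → ProbabilityMeasure (Torus (Fin d))} {ν : ProbabilityMeasure (Torus (Fin d))}
    {Es : ι → NonemptyCompacts (Torus (Fin d))} {E : NonemptyCompacts (Torus (Fin d))}
    (hμ : Filter.Tendsto μs L (𝓝 ν)) (hE : Filter.Tendsto Es L (𝓝 E))
    (hs : ∀ i, (μs i : Measure (Torus (Fin d))).support ⊆ Es i) :
    (ν : Measure (Torus (Fin d))).support ⊆ E := by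
  rw [← E.isCompact.isClosed.closure_eq, Metric.closure_eq_iInter_cthickening]
  refine Set.subset_iInter₂ fun δ hδ => ?_
  refine Measure.support_subset_of_isClosed Metric.isClosed_cthickening ?_
  rw [mem_ae_iff_prob_eq_one Metric.isClosed_cthickening.measurableSet]
  refine le_antisymm prob_le_one (le_trans ?_
    (ProbabilityMeasure.limsup_measure_closed_le_of_tendsto hμ
      (Metric.isClosed_cthickening (δ := δ) (E := (E : Set (Torus (Fin d)))))))
  refine Filter.le_limsup_of_frequently_le' (Filter.Eventually.frequently ?_)
  filter_upwards [Metric.tendsto_nhds.1 hE δ hδ] with i hi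
  have ae_mem : ∀ᵐ x ∂(μs i : Measure (Torus (Fin d))),
      x ∈ Metric.cthickening δ (E : Set (Torus (Fin d))) := by
    filter_upwards [ae_of_support_subset (hs i)] with x hx
    rw [Metric.NonemptyCompacts.dist_eq] at hi
    obtain ⟨z, hz, hxz⟩ := Metric.exists_dist_lt_of_hausdorffDist_lt hx hi
      (Metric.hausdorffEDist_ne_top_of_nonempty_of_bounded (Es i).nonempty E.nonempty
        (Es i).isCompact.isBounded E.isCompact.isBounded)
    exact Metric.mem_cthickening_of_dist_le _ _ _ _ hz hxz.le
  exact ((mem_ae_iff_prob_eq_one Metric.isClosed_cthickening.measurableSet).1 ae_mem).ge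

lemma decayNorm_sub_le_of_tendsto {ι : Type*} {L : Filter ι} [L.NeBot]
    {νs : ι → ProbabilityMeasure (Torus (Fin d))} {ν : ProbabilityMeasure (Torus (Fin d))}
    (h : Filter.Tendsto νs L (𝓝 ν)) {s : ℝ} {c : (Fin d → ℤ) → ℂ} {ε : ℝ≥0∞}
    (hε : ∀ᶠ i in L, decayNorm s (c - fourierCoeff (νs i : Measure (Torus (Fin d)))) ≤ ε) :
    decayNorm s (c - fourierCoeff (ν : Measure (Torus (Fin d)))) ≤ ε := by
  refine iSup_le fun ξ => ?_
  have limit : Filter.Tendsto (fun i => ENNReal.ofReal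
      (‖(c - fourierCoeff (νs i : Measure (Torus (Fin d)))) ξ‖ * freqNorm ξ ^ (s / 2))) L
      (𝓝 (ENNReal.ofReal (‖(c - fourierCoeff (ν : Measure (Torus (Fin d)))) ξ‖ *
        freqNorm ξ ^ (s / 2)))) :=
    ENNReal.tendsto_ofReal (((tendsto_fourierCoeff h ξ).const_sub _).norm.mul_const _)
  refine le_of_tendsto limit ?_
  filter_upwards [hε] with i hi
  exact (ofReal_le_decayNorm _ _ ξ).trans hi

lemma decayNorm_lt_top_of_sub {s : ℝ} {b c : (Fin d → ℤ) → ℂ} (hbc : decayNorm s (b - c) < ∞)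
    (hb : decayNorm s b < ∞) : decayNorm s c < ∞ := by
  have := decayNorm_add_le s (-(b - c)) b
  rw [neg_sub, sub_add_cancel, ← neg_sub, decayNorm_neg] at this
  exact this.trans_lt (ENNReal.add_lt_top.2 ⟨hbc, hb⟩)

lemma exists_tendsto_decayNorm_sub_of_cauchy {u : ℕ → ProbabilityMeasure (Torus (Fin d))}
    (hu : ∀ (k : ℕ) (ε : ℝ≥0∞), 0 < ε → ∃ N, ∀ m, N ≤ m → ∀ n, N ≤ n →
      decayNorm (exponentSeq β k) (fourierCoeff (u m : Measure (Torus (Fin d))) -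
        fourierCoeff (u n : Measure _)) < ε) :
    ∃ (ν : ProbabilityMeasure (Torus (Fin d))),
      Filter.Tendsto u (Filter.hyperfilter ℕ : Ultrafilter ℕ) (𝓝 ν) ∧
      ∀ s < β, ∀ ε : ℝ≥0∞, 0 < ε → ∀ᶠ m in Filter.atTop,
        decayNorm s (fourierCoeff (u m : Measure (Torus (Fin d))) -
          fourierCoeff (ν : Measure _)) < ε := by
  obtain ⟨ν, -, hν⟩ := isCompact_univ.ultrafilter_le_nhds
    ((Filter.hyperfilter ℕ).map u) (by simp)
  have weak_limit : Filter.Tendsto u (Filter.hyperfilter ℕ : Ultrafilter ℕ) (𝓝 ν) := hν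
  refine ⟨ν, weak_limit, fun s hs ε hε => ?_⟩
  obtain ⟨k, hk⟩ := exists_le_exponentSeq hs
  obtain ⟨δ, δ_pos, hδε⟩ := exists_between hε
  obtain ⟨N, hN⟩ := hu k δ δ_pos
  filter_upwards [Filter.eventually_ge_atTop N] with m hm
  refine (decayNorm_sub_mono hk _ _).trans_lt (lt_of_le_of_lt ?_ hδε)
  refine decayNorm_sub_le_of_tendsto weak_limit ?_
  filter_upwards [Nat.hyperfilter_le_atTop (Filter.eventually_ge_atTop N)] with n hn
  exact (hN m hm n hn).le

lemma XSpace.exists_tendsto_of_cauchySeq {u : ℕ → XSpace d β} (hE : CauchySeq fun n => (u n).E)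
    (hμ : ∀ (k : ℕ) (ε : ℝ≥0∞), 0 < ε → ∃ N, ∀ m, N ≤ m → ∀ n, N ≤ n →
      decayNorm (exponentSeq β k) (fourierCoeff ((u m).μ : Measure (Torus (Fin d))) -
        fourierCoeff ((u n).μ : Measure _)) < ε) :
    ∃ p, Filter.Tendsto u Filter.atTop (𝓝 p) := by
  obtain ⟨E, limit_E⟩ := cauchySeq_tendsto_of_complete hE
  obtain ⟨ν, weak_limit, limit_μ⟩ := exists_tendsto_decayNorm_sub_of_cauchy hμ
  have support_subset : (ν : Measure (Torus (Fin d))).support ⊆ E :=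
    support_subset_of_tendsto weak_limit (limit_E.mono_left Nat.hyperfilter_le_atTop)
      fun n => (u n).support_subset
  have decay : ∀ s : ℝ, 0 ≤ s → s < β →
      decayNorm s (fourierCoeff (ν : Measure (Torus (Fin d)))) < ∞ := by
    intro s hs hsβ
    obtain ⟨m, hm⟩ := (limit_μ s hsβ 1 one_pos).exists
    exact decayNorm_lt_top_of_sub (hm.trans ENNReal.one_lt_top) ((u m).decay s hs hsβ)
  exact ⟨⟨E, ν, support_subset, decay⟩, XSpace.le_nhds (Filter.tendsto_map'_iff.2 limit_E)
    fun s _ hsβ ε hε => limit_μ s hsβ ε hε⟩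

lemma XSpace.completeSpace_uniform (hβ : 0 < β) :
    @CompleteSpace (XSpace d β) (XSpace.uniform d β) := by
  refine @UniformSpace.complete_of_cauchySeq_tendsto _ (XSpace.uniform d β)
    XSpace.isCountablyGenerated_uniformity fun u hu => ?_
  rw [XSpace.uniform_toTopologicalSpace hβ]
  refine XSpace.exists_tendsto_of_cauchySeq ?_ fun k => ?_
  · exact @UniformContinuous.comp_cauchySeq _ _ (XSpace.uniform d β) _ _ _ XSpace.E
      (uniformContinuous_iff_le_comap.2 inf_le_left) u hu
  · have cauchy : @CauchySeq _ _ (decayPseudoEMetric d (exponentSeq β k)).toUniformSpace _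
        (fun n => (u n).μ) :=
      @UniformContinuous.comp_cauchySeq _ _ (XSpace.uniform d β) _
        (decayPseudoEMetric d (exponentSeq β k)).toUniformSpace _ XSpace.μ
        ((@uniformContinuous_iff_le_comap _ _ (XSpace.uniform d β)
          (decayPseudoEMetric d (exponentSeq β k)).toUniformSpace XSpace.μ).2
          (inf_le_right.trans (iInf_le _ k))) u hu
    exact (@EMetric.cauchySeq_iff _ _ (decayPseudoEMetric d (exponentSeq β k)) _ _ _).1 cauchy

lemma XSpace.baireSpace (hβ : 0 < β) : BaireSpace (XSpace d β) := by
  let uniform := XSpace.uniform d β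
  have := XSpace.isCountablyGenerated_uniformity (d := d) (β := β)
  have := XSpace.completeSpace_uniform (d := d) hβ
  have baire : @BaireSpace (XSpace d β) uniform.toTopologicalSpace := inferInstance
  rwa [XSpace.uniform_toTopologicalSpace hβ] at baire

lemma XSpace.nonempty (hβ : β ≤ d) : Nonempty (XSpace d β) := by
  obtain ⟨C, -, mollifier⟩ := exists_isMollifier d
  obtain ⟨ψ, hψ⟩ := mollifier 1 one_pos le_rfl
  have := hψ.isProbabilityMeasure
  obtain ⟨p, -⟩ := hψ.hasFastDecay.exists_xSpace hβ isClosed_univ (by simp)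
  exact ⟨p⟩

lemma XSpace.ofReal_le_fourierDim (hβ : β ≤ d) (p : XSpace d β) :
    ENNReal.ofReal β ≤ fourierDim (p.E : Set (Torus (Fin d))) := by
  refine le_iSup₂_of_le p.μ p.support_subset (le_of_forall_lt fun a ha => ?_)
  obtain ⟨s, has, hsβ⟩ := ENNReal.lt_iff_exists_nnreal_btwn.1 ha
  have hs : (s : ℝ) < β := (ENNReal.lt_ofReal_iff_toReal_lt ENNReal.coe_ne_top).1 hsβ
  rw [← ENNReal.ofReal_coe_nnreal] at has
  exact has.trans_le (le_iSup₂_of_le (f := fun (s : ℝ) _ => ENNReal.ofReal s) (s : ℝ)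
    ⟨s.2, hs.le.trans hβ, p.decay s s.2 hs⟩ le_rfl)

lemma XSpace.isSalem_of_dimH_le (hβ : β ≤ d) {p : XSpace d β}
    (h : dimH (p.E : Set (Torus (Fin d))) ≤ ENNReal.ofReal β) :
    IsSalem (p.E : Set (Torus (Fin d))) ∧
      fourierDim (p.E : Set (Torus (Fin d))) = ENNReal.ofReal β := by
  have lower := p.ofReal_le_fourierDim hβ
  have upper := fourierDim_le_dimH (p.E : Set (Torus (Fin d)))
  exact ⟨upper.antisymm (h.trans lower), (upper.trans h).antisymm lower⟩

end Baire

end SalemAvoidance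

end

theorem theorem1_general (d n : ℕ) (α : ℝ) (hα0 : 0 ≤ α) (hα : α < (d : ℝ) * n)
    (Z : Set (SalemAvoidance.Torus (Fin n × Fin d)))
    (hZ : SalemAvoidance.lowerMinkowskiDim Z ≤ (α : EReal))
    (β₀ : ℝ) (hβ₀ : β₀ = min (((d : ℝ) * n - α) / ((n : ℝ) - 1 / 2)) (d : ℝ)) :
    (∃ E : Set (SalemAvoidance.Torus (Fin d)),
      IsCompact E ∧ SalemAvoidance.IsSalem E ∧
        SalemAvoidance.fourierDim E = ENNReal.ofReal β₀ ∧ SalemAvoidance.Avoids E Z) ∧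
    (∀ β : ℝ, 0 < β → β ≤ β₀ →
      {p : SalemAvoidance.XSpace d β |
        SalemAvoidance.IsSalem (p.E : Set (SalemAvoidance.Torus (Fin d))) ∧
          SalemAvoidance.Avoids (p.E : Set (SalemAvoidance.Torus (Fin d))) Z} ∈
        residual (SalemAvoidance.XSpace d β)) := by
  have dim_pos : (0 : ℝ) < d * n := hα0.trans_lt hα
  have d_pos : 0 < d := Nat.pos_of_ne_zero fun h => by simp [h] at dim_pos
  have n_pos : 0 < n := Nat.pos_of_ne_zero fun h => by simp [h] at dim_pos
  have half_lt : (0 : ℝ) < (n : ℝ) - 1 / 2 := by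
    linarith [(Nat.one_le_cast.2 n_pos : (1 : ℝ) ≤ n)]
  have β₀_pos : 0 < β₀ :=
    hβ₀ ▸ lt_min (div_pos (sub_pos.2 hα) half_lt) (Nat.cast_pos.2 d_pos)
  have β₀_le_d : β₀ ≤ d := hβ₀ ▸ min_le_right _ _
  have β₀_mul_le : β₀ * ((n : ℝ) - 1 / 2) ≤ d * n - α :=
    (le_div_iff₀ half_lt).1 (hβ₀ ▸ min_le_left _ _)
  have residual_good (β : ℝ) (hβ : 0 < β) (hββ₀ : β ≤ β₀) :=
    SalemAvoidance.residual_dimH_le_and_avoids n_pos hβ (hββ₀.trans β₀_le_d)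
      ((mul_le_mul_of_nonneg_right hββ₀ half_lt.le).trans β₀_mul_le) hZ
  refine ⟨?_, fun β hβ hββ₀ => ?_⟩
  · have := SalemAvoidance.XSpace.baireSpace (d := d) β₀_pos
    have := SalemAvoidance.XSpace.nonempty β₀_le_d
    obtain ⟨p, dim_le, avoids⟩ :=
      (dense_of_mem_residual (residual_good β₀ β₀_pos le_rfl)).nonempty
    obtain ⟨salem, dim_eq⟩ := SalemAvoidance.XSpace.isSalem_of_dimH_le β₀_le_d dim_le
    exact ⟨p.E, p.E.isCompact, salem, dim_eq, avoids⟩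
  · filter_upwards [residual_good β hβ hββ₀] with p ⟨dim_le, avoids⟩
    exact ⟨(SalemAvoidance.XSpace.isSalem_of_dimH_le (hββ₀.trans β₀_le_d) dim_le).1, avoids⟩

theorem theorem1 (d n : ℕ) (α : ℝ) (hα0 : 0 ≤ α) (hα : α < (d : ℝ) * n)
    (Z : Set (SalemAvoidance.Torus (Fin n × Fin d))) (hZc : IsCompact Z)
    (hZ : SalemAvoidance.lowerMinkowskiDim Z ≤ (α : EReal))
    (β₀ : ℝ) (hβ₀ : β₀ = min (((d : ℝ) * n - α) / ((n : ℝ) - 1 / 2)) (d : ℝ)) :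
    (∃ E : Set (SalemAvoidance.Torus (Fin d)),
      IsCompact E ∧ SalemAvoidance.IsSalem E ∧
        SalemAvoidance.fourierDim E = ENNReal.ofReal β₀ ∧ SalemAvoidance.Avoids E Z) ∧
    (∀ β : ℝ, 0 < β → β ≤ β₀ →
      {p : SalemAvoidance.XSpace d β |
        SalemAvoidance.IsSalem (p.E : Set (SalemAvoidance.Torus (Fin d))) ∧
          SalemAvoidance.Avoids (p.E : Set (SalemAvoidance.Torus (Fin d))) Z} ∈
        residual (SalemAvoidance.XSpace d β)) :=
  theorem1_general d n α hα0 hα Z hZ β₀ hβ₀
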